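/- **Proposition 2.1.** Let $k$ be a field and $q\in k$ with $q\neq 0$, $q\neq q^{-1}$. Elements of $M_n\otimes M_n$ are written ${\bf R}={\bf R}^i{}_j{}^k{}_l$, suffices denote tensor positions, ${\bf R}_{21}{}^i{}_j{}^k{}_l={\bf R}^k{}_l{}^i{}_j$, and $P$ is the permutation matrix. *Data.* Let ${\bf R'},{\bf R}\in M_n(k)\otimes M_n(k)$ be invertible with $${\bf R}_{12}{\bf R}_{13}{\bf R}_{23}={\bf R}_{23}{\bf R}_{13}{\bf R}_{12},\quad {\bf R}_{12}{\bf R}_{13}{\bf R'}_{23}={\bf R'}_{23}{\bf R}_{13}{\bf R}_{12},\quad {\bf R}_{23}{\bf R}_{13}{\bf R'}_{12}={\bf R'}_{12}{\bf R}_{13}{\bf R}_{23},$$ $$(P{\bf R}+1)(P{\bf R'}-1)=0,\quad {\bf R}_{21}{\bf R'}={\bf R'}_{21}{\bf R}.$$ Let $\lambda\in k$, $\lambda\neq0$, and let $H$ be a Hopf algebra over $k$, generated as a Hopf algebra by the entries of two matrices $l^\pm=(l^{\pm i}{}_j)$, such that $$l^\pm_1l^\pm_2{\bf R}={\bf R}\,l^\pm_2l^\pm_1,\quad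 l^-_1l^+_2{\bf R}={\bf R}\,l^+_2l^-_1,\quad l^\pm_1l^\pm_2{\bf R'}={\bf R'}\,l^\pm_2l^\pm_1,\quad \Delta l^{\pm i}{}_j=\sum_a l^{\pm i}{}_a\otimes l^{\pm a}{}_j,\quad \epsilon(l^{\pm i}{}_j)=\delta^i_j,$$ and such that there is an algebra map $\rho:H\to M_n(k)$ with $\rho^a{}_b(l^{+i}{}_j)=\lambda{\bf R}^a{}_b{}^i{}_j$ and $\rho^a{}_b(l^{-i}{}_j)=\lambda^{-1}({\bf R}^{-1})^i{}_j{}^a{}_b$. (These hold in particular when $H$ is quasitriangular with universal R-matrix $\mathcal R$, $l^+=({\rm id}\otimes\rho)\mathcal R$, $l^-=(\rho\otimes{\rm id})\mathcal R^{-1}$, $(\rho\otimes\rho)\mathcal R=\lambda{\bf R}$, and $H$ is generated by these $l^\pm$.) *The extended $q$-Poincaré algebra* $P({\bf R'},{\bf R})$ is the algebra generated by $H$, $p^1,\dots,p^n$ and an invertible element $\varsigma$ with the relations of $H$ and $$p_1p_2={\bf R'}p_2p_1,\quad l^+_1p_2=\lambda^{-1}{\bf R}_{21}^{-1}p_2l^+_1,\quad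 l^-_1p_2=\lambda{\bf R}p_2l^-_1,\quad \varsigma p=\lambda^{-1}p\varsigma,\quad [l^\pm,\varsigma]=0.$$ *The $q$-conformal algebra* $C({\bf R'},{\bf R})$ is the algebra generated by $P({\bf R'},{\bf R})$ and $c_1,\dots,c_n$ with the relations of $P({\bf R'},{\bf R})$ and $$c_2c_1=c_1c_2{\bf R'},\quad l^+_1c_2=\lambda c_2l^+_1{\bf R}_{21},\quad l^-_1c_2=\lambda^{-1}c_2l^-_1{\bf R}^{-1},\quad \varsigma c=\lambda c\varsigma,\quad [p^i,c_j]=\frac{l^{+i}{}_j\varsigma^{-1}-l^{-i}{}_j\varsigma}{q-q^{-1}}.$$ *Claim.* $P({\bf R'},{\bf R})$ is a Hopf algebra for a structure extending that of $H$ (that is, $H\to P({\bf R'},{\bf R})$ respects coproduct, counit and antipode) with $$\Delta\varsigma=\varsigma\otimes\varsigma,\quad \epsilon(\varsigma)=1,\quad S\varsigma=\varsigma^{-1},\quad \Delta p^i=p^i\otimes1+\sum_a\varsigma l^{-i}{}_a\otimes p^a,\quad \epsilon(p^i)=0,\quad Sp^i=-\sum_a(Sl^{-i}{}_a)\varsigma^{-1}p^a,$$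 and $C({\bf R'},{\bf R})$ is a Hopf algebra that is an extension of it: the canonical map $P({\bf R'},{\bf R})\to C({\bf R'},{\bf R})$ is injective and respects coproduct, counit and antipode, and $$\Delta c_i=\sum_a c_a\otimes l^{+a}{}_i\varsigma^{-1}+1\otimes c_i,\quad \epsilon(c_i)=0,\quad Sc_i=-\sum_a c_a\varsigma\,Sl^{+a}{}_i.$$ -/

import Mathlib

open scoped TensorProduct

noncomputable section

namespace QConformal

/-! ### R-matrix notation

An element `R` of `M_n ⊗ M_n`, with entries `R^i_j^k_l`, is the matrix with rows and columns
indexed by pairs: `R^i_j^k_l = R (i, k) (j, l)`.  Products of such matrices are products in the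
algebra `M_n ⊗ M_n`. -/

/-- `M_n ⊗ M_n`, as matrices indexed by pairs. -/
abbrev Mat2 (n : ℕ) (A : Type*) := Matrix (Fin n × Fin n) (Fin n × Fin n) A

/-- `M_n ⊗ M_n ⊗ M_n`, as matrices indexed by triples. -/
abbrev Mat3 (n : ℕ) (A : Type*) :=
  Matrix (Fin n × Fin n × Fin n) (Fin n × Fin n × Fin n) A

section RMatrices

variable {A : Type*} [Semiring A] {n : ℕ}

/-- `R₁₂ = R ⊗ id`. -/
def on12 (R : Mat2 n A) : Mat3 n A := fun x y =>
  if x.2.2 = y.2.2 then R (x.1, x.2.1) (y.1, y.2.1) else 0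

/-- `R₂₃ = id ⊗ R`. -/
def on23 (R : Mat2 n A) : Mat3 n A := fun x y =>
  if x.1 = y.1 then R (x.2.1, x.2.2) (y.2.1, y.2.2) else 0

/-- `R₁₃`: `R` in the first and third tensor factors. -/
def on13 (R : Mat2 n A) : Mat3 n A := fun x y =>
  if x.2.1 = y.2.1 then R (x.1, x.2.2) (y.1, y.2.2) else 0

/-- The transposed matrix `R₂₁`, `(R₂₁)^i_j^k_l = R^k_l^i_j`. -/
def flip21 (R : Mat2 n A) : Mat2 n A := fun x y => R (x.2, x.1) (y.2, y.1)

/-- The permutation matrix `P`, `P^i_j^k_l = δ^i_l δ^k_j`. -/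
def perm (n : ℕ) (A : Type*) [Semiring A] : Mat2 n A := fun x y =>
  if x.1 = y.2 ∧ x.2 = y.1 then 1 else 0

/-- `M₁ = M ⊗ id` for an `n × n` matrix with entries in `A`. -/
def leg1 (M : Matrix (Fin n) (Fin n) A) : Mat2 n A := fun x y =>
  if x.2 = y.2 then M x.1 y.1 else 0

/-- `M₂ = id ⊗ M` for an `n × n` matrix with entries in `A`. -/
def leg2 (M : Matrix (Fin n) (Fin n) A) : Mat2 n A := fun x y =>
  if x.1 = y.1 then M x.2 y.2 else 0

end RMatrices

/-- The conditions on the pair `R', R` under which the vectors `p^i` with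
`p₁ p₂ = R' p₂ p₁` and braid statistics `R` form a linear braided group `V(R', R)`. -/
structure IsBraidedPair {k : Type*} [Field k] {n : ℕ} (R' R : Mat2 n k) : Prop where
  isUnit_R : IsUnit R
  isUnit_R' : IsUnit R'
  /-- `R₁₂ R₁₃ R₂₃ = R₂₃ R₁₃ R₁₂` -/
  yang_baxter : on12 R * on13 R * on23 R = on23 R * on13 R * on12 R
  /-- `R₁₂ R₁₃ R'₂₃ = R'₂₃ R₁₃ R₁₂` -/
  mixed_left : on12 R * on13 R * on23 R' = on23 R' * on13 R * on12 R
  /-- `R₂₃ R₁₃ R'₁₂ = R'₁₂ R₁₃ R₂₃` -/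
  mixed_right : on23 R * on13 R * on12 R' = on12 R' * on13 R * on23 R
  /-- `(P R + 1) (P R' - 1) = 0` -/
  coaddition : (perm n k * R + 1) * (perm n k * R' - 1) = 0
  /-- `R₂₁ R' = R'₂₁ R` -/
  exchange : flip21 R * R' = flip21 R' * R

/-! ### The data: `R'`, `R`, the constant `lam` and the rotation sector -/

/-- The (raw) R-matrix data: the matrices `R'` and `R`, the quantum group normalisation constant
`lam`, and, in the Hopf algebra `H` of rotations, the matrices of elements `l^±` together with
the fundamental representation `rho` of `H`. -/
structure Data (k : Type*) [Field k] (n : ℕ) (H : Type*) [Ring H] [HopfAlgebra k H] where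
  R' : Mat2 n k
  R : Mat2 n k
  lam : k
  lp : Matrix (Fin n) (Fin n) H
  lm : Matrix (Fin n) (Fin n) H
  rho : H →ₐ[k] Matrix (Fin n) (Fin n) k

/-- Regularity of the data.  The pair `R', R` defines linear braided groups; the `l^±` obey the
FRT relations, have the matrix coproduct, and generate the Hopf algebra `H`; the relations
`p₁ p₂ = R' p₂ p₁` and `c₂ c₁ = c₁ c₂ R'` are covariant under the coactions `p ↦ l⁻ ⊗ p`,
`c ↦ c ⊗ l⁺`, in the R-matrix form `l^±₁ l^±₂ R' = R' l^±₂ l^±₁`; and in the fundamental representation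
`rho (l⁺) = lam R`, `rho (l⁻) = lam⁻¹ R₂₁⁻¹`. -/
structure Data.IsRegular {k : Type*} [Field k] {n : ℕ} {H : Type*} [Ring H] [HopfAlgebra k H]
    (D : Data k n H) : Prop where
  braidedPair : IsBraidedPair D.R' D.R
  lam_ne_zero : D.lam ≠ 0
  /-- `l⁺₁ l⁺₂ R = R l⁺₂ l⁺₁` -/
  frt_plus : leg1 D.lp * leg2 D.lp * D.R.map (algebraMap k H) =
    D.R.map (algebraMap k H) * leg2 D.lp * leg1 D.lp
  /-- `l⁻₁ l⁻₂ R = R l⁻₂ l⁻₁` -/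
  frt_minus : leg1 D.lm * leg2 D.lm * D.R.map (algebraMap k H) =
    D.R.map (algebraMap k H) * leg2 D.lm * leg1 D.lm
  /-- `l⁻₁ l⁺₂ R = R l⁺₂ l⁻₁` -/
  frt_mixed : leg1 D.lm * leg2 D.lp * D.R.map (algebraMap k H) =
    D.R.map (algebraMap k H) * leg2 D.lp * leg1 D.lm
  /-- `l⁺₁ l⁺₂ R' = R' l⁺₂ l⁺₁` -/
  covariant_plus : leg1 D.lp * leg2 D.lp * D.R'.map (algebraMap k H) =
    D.R'.map (algebraMap k H) * leg2 D.lp * leg1 D.lp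
  /-- `l⁻₁ l⁻₂ R' = R' l⁻₂ l⁻₁` -/
  covariant_minus : leg1 D.lm * leg2 D.lm * D.R'.map (algebraMap k H) =
    D.R'.map (algebraMap k H) * leg2 D.lm * leg1 D.lm
  comul_lp : ∀ i j, Coalgebra.comul (R := k) (D.lp i j) = ∑ a, D.lp i a ⊗ₜ[k] D.lp a j
  comul_lm : ∀ i j, Coalgebra.comul (R := k) (D.lm i j) = ∑ a, D.lm i a ⊗ₜ[k] D.lm a j
  counit_lp : ∀ i j, Coalgebra.counit (R := k) (D.lp i j) = if i = j then 1 else 0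
  counit_lm : ∀ i j, Coalgebra.counit (R := k) (D.lm i j) = if i = j then 1 else 0
  /-- `rho^a_b (l⁺^i_j) = lam R^a_b^i_j` -/
  rho_lp : ∀ i j a b, D.rho (D.lp i j) a b = D.lam * D.R (a, i) (b, j)
  /-- `rho^a_b (l⁻^i_j) = lam⁻¹ (R₂₁⁻¹)^a_b^i_j = lam⁻¹ (R⁻¹)^i_j^a_b` -/
  rho_lm : ∀ i j a b, D.rho (D.lm i j) a b = D.lam⁻¹ * D.R⁻¹ (i, a) (j, b)
  /-- `H` is generated, as a Hopf algebra, by the `l^±`. -/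
  generated : ∀ B : Subalgebra k H, (∀ i j, D.lp i j ∈ B) → (∀ i j, D.lm i j ∈ B) →
    (∀ x ∈ B, HopfAlgebra.antipode k x ∈ B) → B = ⊤

/-! ### Adjoining generators to an algebra -/

section FreeExt

variable (k : Type*) [CommRing k] (A : Type*) [Ring A] [Algebra k A] (X : Type*)

/-- The relations of the algebra `A`, imposed on the free algebra on `A` and `X`. -/
inductive FreeExtRel : FreeAlgebra k (A ⊕ X) → FreeAlgebra k (A ⊕ X) → Prop
  | scalar (r : k) : FreeExtRel (FreeAlgebra.ι k (Sum.inl (algebraMap k A r)))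
      (algebraMap k (FreeAlgebra k (A ⊕ X)) r)
  | add (a b : A) : FreeExtRel (FreeAlgebra.ι k (Sum.inl (a + b)))
      (FreeAlgebra.ι k (Sum.inl a) + FreeAlgebra.ι k (Sum.inl b))
  | mul (a b : A) : FreeExtRel (FreeAlgebra.ι k (Sum.inl (a * b)))
      (FreeAlgebra.ι k (Sum.inl a) * FreeAlgebra.ι k (Sum.inl b))

/-- The algebra obtained from `A` by freely adjoining (noncommuting) generators indexed by `X`:
the free product of `A` with the free algebra on `X`. -/
abbrev FreeExt := RingQuot (FreeExtRel k A X)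

variable {k A X}

/-- The generator of `FreeExt k A X` given by `x : X`. -/
def FreeExt.gen (x : X) : FreeExt k A X :=
  RingQuot.mkAlgHom k (FreeExtRel k A X) (FreeAlgebra.ι k (Sum.inr x))

variable (k A X) in
/-- The canonical map from `A` to `FreeExt k A X`. -/
def FreeExt.base : A →ₐ[k] FreeExt k A X :=
  AlgHom.ofLinearMap
    { toFun := fun a => RingQuot.mkAlgHom k (FreeExtRel k A X) (FreeAlgebra.ι k (Sum.inl a))
      map_add' := fun a b => by
        rw [RingQuot.mkAlgHom_rel k (FreeExtRel.add a b), map_add]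
      map_smul' := fun r a => by
        rw [Algebra.smul_def, RingQuot.mkAlgHom_rel k (FreeExtRel.mul _ a), map_mul,
          RingQuot.mkAlgHom_rel k (FreeExtRel.scalar r), AlgHom.commutes, RingHom.id_apply,
          Algebra.smul_def] }
    (by
      have h := RingQuot.mkAlgHom_rel k (FreeExtRel.scalar (k := k) (A := A) (X := X) 1)
      simpa using h)
    (fun a b => by
      have h := RingQuot.mkAlgHom_rel k (FreeExtRel.mul (k := k) (X := X) a b)
      simpa using h)

end FreeExt

/-! ### The extended `q`-Poincaré algebra and the `q`-conformal algebra -/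

/-- The generators of the extended `q`-Poincaré algebra besides the rotations: the momenta `p^i`,
the dilaton `ς` and its inverse. -/
inductive PoincareGen (n : ℕ)
  | mom (i : Fin n)
  | dil
  | dilInv

section Algebras

variable {k : Type*} [Field k] {n : ℕ} {H : Type*} [Ring H] [HopfAlgebra k H]

open FreeExt PoincareGen

/-- The relations of the extended `q`-Poincaré algebra. -/
inductive PoincareRel (D : Data k n H) :
    FreeExt k H (PoincareGen n) → FreeExt k H (PoincareGen n) → Prop
  | dil_mul_inv : PoincareRel D (gen dil * gen dilInv) 1
  | dil_inv_mul : PoincareRel D (gen dilInv * gen dil) 1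
  /-- `p₁ p₂ = R' p₂ p₁` -/
  | mom_mom (i j : Fin n) : PoincareRel D (gen (mom i) * gen (mom j))
      (∑ a, ∑ b, D.R' (i, j) (a, b) • (gen (mom b) * gen (mom a)))
  /-- `l⁺₁ p₂ = lam⁻¹ R₂₁⁻¹ p₂ l⁺₁` -/
  | lp_mom (i j m : Fin n) : PoincareRel D (base k H _ (D.lp i j) * gen (mom m))
      (D.lam⁻¹ • ∑ a, ∑ b, D.R⁻¹ (m, i) (b, a) • (gen (mom b) * base k H _ (D.lp a j)))
  /-- `l⁻₁ p₂ = lam R p₂ l⁻₁` -/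
  | lm_mom (i j m : Fin n) : PoincareRel D (base k H _ (D.lm i j) * gen (mom m))
      (D.lam • ∑ a, ∑ b, D.R (i, m) (a, b) • (gen (mom b) * base k H _ (D.lm a j)))
  /-- `ς p = lam⁻¹ p ς` -/
  | dil_mom (i : Fin n) : PoincareRel D (gen dil * gen (mom i))
      (D.lam⁻¹ • (gen (mom i) * gen dil))
  | lp_dil (i j : Fin n) : PoincareRel D (base k H _ (D.lp i j) * gen dil)
      (gen dil * base k H _ (D.lp i j))
  | lm_dil (i j : Fin n) : PoincareRel D (base k H _ (D.lm i j) * gen dil)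
      (gen dil * base k H _ (D.lm i j))

/-- The extended `q`-Poincaré algebra `P(R', R)`. -/
abbrev Poincare (D : Data k n H) := RingQuot (PoincareRel D)

namespace Poincare

variable (D : Data k n H)

/-- The inclusion of the rotations. -/
def rot : H →ₐ[k] Poincare D :=
  (RingQuot.mkAlgHom k (PoincareRel D)).comp (base k H (PoincareGen n))

/-- The momenta `p^i`. -/
def p (i : Fin n) : Poincare D := RingQuot.mkAlgHom k (PoincareRel D) (gen (mom i))

/-- The dilaton `ς`. -/
def dil : Poincare D := RingQuot.mkAlgHom k (PoincareRel D) (gen PoincareGen.dil)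

/-- The inverse `ς⁻¹` of the dilaton. -/
def dilInv : Poincare D := RingQuot.mkAlgHom k (PoincareRel D) (gen PoincareGen.dilInv)

/-- The rotation generators `l⁺^i_j`. -/
def lp (i j : Fin n) : Poincare D := rot D (D.lp i j)

/-- The rotation generators `l⁻^i_j`. -/
def lm (i j : Fin n) : Poincare D := rot D (D.lm i j)

end Poincare

/-- The relations between the special conformal generators `c_i`, which are adjoined to the
extended `q`-Poincaré algebra, and between these and the generators of the latter. -/
inductive ConformalRel (D : Data k n H) (q : k) :
    FreeExt k (Poincare D) (Fin n) → FreeExt k (Poincare D) (Fin n) → Prop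
  /-- `c₂ c₁ = c₁ c₂ R'` -/
  | conf_conf (i j : Fin n) : ConformalRel D q (gen j * gen i)
      (∑ a, ∑ b, D.R' (a, b) (i, j) • (gen a * gen b))
  /-- `l⁺₁ c₂ = lam c₂ l⁺₁ R₂₁` -/
  | lp_conf (i j m : Fin n) : ConformalRel D q (base k _ _ (Poincare.lp D i j) * gen m)
      (D.lam • ∑ a, ∑ b, D.R (b, a) (m, j) • (gen b * base k _ _ (Poincare.lp D i a)))
  /-- `l⁻₁ c₂ = lam⁻¹ c₂ l⁻₁ R⁻¹` -/
  | lm_conf (i j m : Fin n) : ConformalRel D q (base k _ _ (Poincare.lm D i j) * gen m)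
      (D.lam⁻¹ • ∑ a, ∑ b, D.R⁻¹ (a, b) (j, m) • (gen b * base k _ _ (Poincare.lm D i a)))
  /-- `ς c = lam c ς` -/
  | dil_conf (i : Fin n) : ConformalRel D q (base k _ _ (Poincare.dil D) * gen i)
      (D.lam • (gen i * base k _ _ (Poincare.dil D)))
  /-- `[p^i, c_j] = (l⁺^i_j ς⁻¹ - l⁻^i_j ς) / (q - q⁻¹)` -/
  | mom_conf (i j : Fin n) : ConformalRel D q
      (base k _ _ (Poincare.p D i) * gen j - gen j * base k _ _ (Poincare.p D i))
      ((q - q⁻¹)⁻¹ • base k _ _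
        (Poincare.lp D i j * Poincare.dilInv D - Poincare.lm D i j * Poincare.dil D))

/-- The `q`-conformal algebra `C(R', R)`. -/
abbrev Conformal (D : Data k n H) (q : k) := RingQuot (ConformalRel D q)

namespace Conformal

variable (D : Data k n H) (q : k)

/-- The canonical map from the extended `q`-Poincaré algebra. -/
def ofPoincare : Poincare D →ₐ[k] Conformal D q :=
  (RingQuot.mkAlgHom k (ConformalRel D q)).comp (base k (Poincare D) (Fin n))

/-- The special conformal generators `c_i`. -/
def c (i : Fin n) : Conformal D q := RingQuot.mkAlgHom k (ConformalRel D q) (gen i)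

/-- `l⁺^i_j` as an element of the `q`-conformal algebra. -/
def lp (i j : Fin n) : Conformal D q := ofPoincare D q (Poincare.lp D i j)

/-- `ς` as an element of the `q`-conformal algebra. -/
def dil : Conformal D q := ofPoincare D q (Poincare.dil D)

/-- `ς⁻¹` as an element of the `q`-conformal algebra. -/
def dilInv : Conformal D q := ofPoincare D q (Poincare.dilInv D)

end Conformal

end Algebras

/-! ### Hopf algebra structures on a given algebra -/

/-- A Hopf algebra structure on a given `k`-algebra `A`. -/
structure HopfStructure (k : Type*) [CommRing k] (A : Type*) [Ring A] [Algebra k A] where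
  comul : A →ₐ[k] A ⊗[k] A
  counit : A →ₐ[k] k
  antipode : A →ₗ[k] A
  coassoc : (Algebra.TensorProduct.assoc k k k A A A).toAlgHom.comp
      ((Algebra.TensorProduct.map comul (.id k A)).comp comul) =
    (Algebra.TensorProduct.map (.id k A) comul).comp comul
  counit_left : (Algebra.TensorProduct.map counit (.id k A)).comp comul =
    (Algebra.TensorProduct.lid k A).symm
  counit_right : (Algebra.TensorProduct.map (.id k A) counit).comp comul =
    (Algebra.TensorProduct.rid k k A).symm
  antipode_left : LinearMap.mul' k A ∘ₗ antipode.rTensor A ∘ₗ comul.toLinearMap =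
    Algebra.linearMap k A ∘ₗ counit.toLinearMap
  antipode_right : LinearMap.mul' k A ∘ₗ antipode.lTensor A ∘ₗ comul.toLinearMap =
    Algebra.linearMap k A ∘ₗ counit.toLinearMap

/-- A Hopf algebra structure on `A` makes `A` a Hopf algebra in the sense of Mathlib (and
conversely, its fields are the axioms of `HopfAlgebra` over the algebra `A`). -/
abbrev HopfStructure.toHopfAlgebra {k : Type*} [CommRing k] {A : Type*} [Ring A] [Algebra k A]
    (S : HopfStructure k A) : HopfAlgebra k A :=
  letI : Bialgebra k A :=
    Bialgebra.ofAlgHom S.comul S.counit S.coassoc S.counit_left S.counit_right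
  { antipode := S.antipode
    mul_antipode_rTensor_comul := S.antipode_left
    mul_antipode_lTensor_comul := S.antipode_right }

section PoincareHopf

variable {k : Type*} [Field k] {n : ℕ} {H : Type*} [Ring H] [HopfAlgebra k H]

/-- The stated Hopf algebra structure of the extended `q`-Poincaré algebra: the rotations are a
sub-Hopf algebra, `Δς = ς ⊗ ς`, and `Δp = p ⊗ 1 + ς l⁻ ⊗ p`, `Sp = -(S l⁻) ς⁻¹ p`. -/
structure IsPoincareHopf (D : Data k n H) (S : HopfStructure k (Poincare D)) : Prop where
  comul_rot : ∀ h : H, S.comul (Poincare.rot D h) =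
    Algebra.TensorProduct.map (Poincare.rot D) (Poincare.rot D) (Coalgebra.comul (R := k) h)
  counit_rot : ∀ h : H, S.counit (Poincare.rot D h) = Coalgebra.counit (R := k) h
  antipode_rot : ∀ h : H,
    S.antipode (Poincare.rot D h) = Poincare.rot D (HopfAlgebra.antipode k h)
  comul_dil : S.comul (Poincare.dil D) = Poincare.dil D ⊗ₜ[k] Poincare.dil D
  counit_dil : S.counit (Poincare.dil D) = 1
  antipode_dil : S.antipode (Poincare.dil D) = Poincare.dilInv D
  comul_p : ∀ i, S.comul (Poincare.p D i) = Poincare.p D i ⊗ₜ[k] 1 +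
    ∑ a, (Poincare.dil D * Poincare.lm D i a) ⊗ₜ[k] Poincare.p D a
  counit_p : ∀ i, S.counit (Poincare.p D i) = 0
  antipode_p : ∀ i, S.antipode (Poincare.p D i) =
    -∑ a, S.antipode (Poincare.lm D i a) * Poincare.dilInv D * Poincare.p D a

end PoincareHopf

end QConformal

end

/-! Both algebras are presented by generators and relations. Algebra maps `Δ`, `ε` and an
anti-algebra map `S` therefore exist once the prescribed images satisfy the relations, and the Hopf
axioms need checking on generators only (`HopfStructure.ofGenerators`). The relations are studied in
an arbitrary algebra (`IsPoincareRep`, `IsConformalRep`): two representations give one in the tensor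
product (`comul`), the counit of `H` gives one in `k`, and each representation gives one in the
opposite algebra (`antipode`).

The quadratic relation for `p ⊗ 1 + ς l⁻ ⊗ p` is braided addition. The powers of `lam` from `l⁻` and
`ς` cancel, so `ς l⁻ ⊗ p` is a second quantum plane with braid statistics exactly `R` relative to `p
⊗ 1`, and `R'(1 + PR) = P + R` makes the sum a quantum plane again (`BraidRel.add_self`). The `c_i`
are handled by the same lemmas in the opposite algebra, with transposed matrices and `R₂₁⁻¹` in
place of `R`. In `[Δp, Δc]` the terms `ς l⁻ ⊗ p` and `c ⊗ l⁺ς⁻¹` give no contribution, since an `R`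
from one tensor factor meets an `R⁻¹` from the other; what remains telescopes.

For injectivity, moving the `c`'s to the left suggests rules `a c_j = ∑ c_m σ(a)_mj + δ_j(a)` for
`a` in the `q`-Poincaré algebra `P`. Discarding the terms that begin with a `c` should make `P` a
right module of `C`, with `P` acting by right multiplication and `c_j` by `δ_j`. This module is
constructed. A pair `(σ, δ)` of the right kind amounts to an algebra map to block triangular
matrices with rows `(σ(a), 0)` and `(δ(a), a)`, and the universal property of `P` supplies it
(`IsPoincareRep.commutation`). On `H`, `σ(h) = h₁ ρ(h₂)`; the relations of `l^±` with `δ(p)` hold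
because `ρ(l^±)` is inverse to the braid matrix (`BraidRel.blockHom_low`). The quadratic relation
between the `δ_j` is `IsSkewDerivation.second_eq`; it follows from the mixed Yang–Baxter equations
and `(1 + RP)R'P = 1 + RP`. As `1 · a = a` in the module, `P` embeds. -/

noncomputable section

namespace QConformal

/-! ### Universal properties -/

section Lift

variable {k : Type*} [CommRing k] {A : Type*} [Ring A] [Algebra k A] {X : Type*}
  {E : Type*} [Ring E] [Algebra k E]

/-- The algebra map out of `FreeExt k A X` given by an algebra map on `A` and the images of the
adjoined generators. -/
def FreeExt.lift (f : A →ₐ[k] E) (g : X → E) : FreeExt k A X →ₐ[k] E :=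
  RingQuot.liftAlgHom k ⟨FreeAlgebra.lift k (Sum.elim f g), by
    intro x y h
    cases h <;> simp⟩

@[simp] theorem FreeExt.lift_gen (f : A →ₐ[k] E) (g : X → E) (x : X) :
    FreeExt.lift f g (FreeExt.gen x) = g x := by
  simp [FreeExt.lift, FreeExt.gen]

@[simp] theorem FreeExt.lift_base (f : A →ₐ[k] E) (g : X → E) (a : A) :
    FreeExt.lift f g (FreeExt.base k A X a) = f a := by
  simp [FreeExt.lift, FreeExt.base]

theorem FreeExt.adjoin_eq_top :
    Algebra.adjoin k (Set.range (FreeExt.base k A X) ∪ Set.range (FreeExt.gen (k := k) (A := A)))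
      = ⊤ := by
  have h := congrArg (Subalgebra.map (RingQuot.mkAlgHom k (FreeExtRel k A X)))
    (FreeAlgebra.adjoin_range_ι k (A ⊕ X))
  rw [AlgHom.map_adjoin, Algebra.map_top,
    (AlgHom.range_eq_top _).2 (RingQuot.mkAlgHom_surjective k _)] at h
  rw [eq_top_iff, ← h]
  apply Algebra.adjoin_mono
  rintro _ ⟨_, ⟨a | x, rfl⟩, rfl⟩
  · exact Or.inl ⟨a, rfl⟩
  · exact Or.inr ⟨x, rfl⟩

end Lift

/-! ### Hopf algebra structures from generators -/

section OfGenerators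

variable {k : Type*} [CommRing k] {A : Type*} [Ring A] [Algebra k A]

/-- If an antimultiplicative `S` satisfies the left antipode axiom on `T`, the axiom for products
`T * t` reduces to the one for `t`. -/
theorem mul_rTensor_mul (S : A →ₐ[k] Aᵐᵒᵖ) (T t : A ⊗[k] A) (e : k)
    (hT : LinearMap.mul' k A ((((MulOpposite.opLinearEquiv k).symm.toLinearMap ∘ₗ
      S.toLinearMap).rTensor A) T) = algebraMap k A e) :
    LinearMap.mul' k A ((((MulOpposite.opLinearEquiv k).symm.toLinearMap ∘ₗ
      S.toLinearMap).rTensor A) (T * t)) =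
    e • LinearMap.mul' k A ((((MulOpposite.opLinearEquiv k).symm.toLinearMap ∘ₗ
      S.toLinearMap).rTensor A) t) := by
  induction t with
  | zero => simp
  | add x y hx hy => rw [mul_add, map_add, map_add, hx, hy, map_add, map_add, smul_add]
  | tmul b b' =>
    -- `S(ab) a'b' = S(b) (S(a) a') b'`: the left factor `T` is contracted innermost, and its value
    -- is a scalar.
    have key : ∀ T : A ⊗[k] A, LinearMap.mul' k A ((((MulOpposite.opLinearEquiv k).symm.toLinearMap
        ∘ₗ S.toLinearMap).rTensor A) (T * b ⊗ₜ[k] b')) = (S b).unop *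
        LinearMap.mul' k A ((((MulOpposite.opLinearEquiv k).symm.toLinearMap
        ∘ₗ S.toLinearMap).rTensor A) T) * b' := by
      intro T
      induction T with
      | zero => simp
      | add x y hx hy => rw [add_mul, map_add, map_add, hx, hy, map_add, map_add, mul_add, add_mul]
      | tmul a a' => simp [mul_assoc]
    rw [key, hT, ← Algebra.commutes, mul_assoc, ← Algebra.smul_def]
    simp

/-- Mirror image: in `b a S(a') S(b')` it is the right factor `t` that is contracted innermost. -/
theorem mul_lTensor_mul (S : A →ₐ[k] Aᵐᵒᵖ) (T t : A ⊗[k] A) (e : k)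
    (ht : LinearMap.mul' k A ((((MulOpposite.opLinearEquiv k).symm.toLinearMap ∘ₗ
      S.toLinearMap).lTensor A) t) = algebraMap k A e) :
    LinearMap.mul' k A ((((MulOpposite.opLinearEquiv k).symm.toLinearMap ∘ₗ
      S.toLinearMap).lTensor A) (T * t)) =
    e • LinearMap.mul' k A ((((MulOpposite.opLinearEquiv k).symm.toLinearMap ∘ₗ
      S.toLinearMap).lTensor A) T) := by
  induction T with
  | zero => simp
  | add x y hx hy => rw [add_mul, map_add, map_add, hx, hy, map_add, map_add, smul_add]
  | tmul b b' =>
    have key : ∀ T : A ⊗[k] A, LinearMap.mul' k A ((((MulOpposite.opLinearEquiv k).symm.toLinearMap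
        ∘ₗ S.toLinearMap).lTensor A) (b ⊗ₜ[k] b' * T)) = b *
        LinearMap.mul' k A ((((MulOpposite.opLinearEquiv k).symm.toLinearMap
        ∘ₗ S.toLinearMap).lTensor A) T) * (S b').unop := by
      intro T
      induction T with
      | zero => simp
      | add x y hx hy => rw [mul_add, map_add, map_add, hx, hy, map_add, map_add, mul_add, add_mul]
      | tmul a a' => simp [mul_assoc]
    rw [key, ht, ← Algebra.commutes, mul_assoc, ← Algebra.smul_def]
    simp

/-- A Hopf algebra structure from algebra maps `comul`, `counit` and an anti-algebra map `antipode`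
that satisfy the Hopf algebra axioms on a set of algebra generators. -/
def HopfStructure.ofGenerators (comul : A →ₐ[k] A ⊗[k] A) (counit : A →ₐ[k] k)
    (S : A →ₐ[k] Aᵐᵒᵖ) (s : Set A) (hs : Algebra.adjoin k s = ⊤)
    (coassoc : ∀ x ∈ s, Algebra.TensorProduct.assoc k k k A A A
        (Algebra.TensorProduct.map comul (.id k A) (comul x)) =
      Algebra.TensorProduct.map (.id k A) comul (comul x))
    (counit_left : ∀ x ∈ s, Algebra.TensorProduct.map counit (.id k A) (comul x) = 1 ⊗ₜ x)
    (counit_right : ∀ x ∈ s, Algebra.TensorProduct.map (.id k A) counit (comul x) = x ⊗ₜ 1)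
    (antipode_left : ∀ x ∈ s, LinearMap.mul' k A ((((MulOpposite.opLinearEquiv k).symm.toLinearMap
      ∘ₗ S.toLinearMap).rTensor A) (comul x)) = algebraMap k A (counit x))
    (antipode_right : ∀ x ∈ s, LinearMap.mul' k A ((((MulOpposite.opLinearEquiv k).symm.toLinearMap
      ∘ₗ S.toLinearMap).lTensor A) (comul x)) = algebraMap k A (counit x)) :
    HopfStructure k A where
  comul := comul
  counit := counit
  antipode := (MulOpposite.opLinearEquiv k).symm.toLinearMap ∘ₗ S.toLinearMap
  coassoc := AlgHom.ext_of_adjoin_eq_top hs fun x hx => by simpa using coassoc x hx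
  counit_left := AlgHom.ext_of_adjoin_eq_top hs fun x hx => by simpa using counit_left x hx
  counit_right := AlgHom.ext_of_adjoin_eq_top hs fun x hx => by simpa using counit_right x hx
  antipode_left := by
    ext x
    have hx : x ∈ Algebra.adjoin k s := hs ▸ Algebra.mem_top
    simp only [LinearMap.comp_apply, AlgHom.toLinearMap_apply, Algebra.linearMap_apply]
    induction hx using Algebra.adjoin_induction with
    | mem x hx => exact antipode_left x hx
    | algebraMap r => simp [Algebra.TensorProduct.one_def, Algebra.algebraMap_eq_smul_one]
    | add x y _ _ hx hy => simp only [map_add, hx, hy]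
    | mul x y _ _ hx hy =>
      rw [map_mul, mul_rTensor_mul _ _ _ _ hx, hy, map_mul, map_mul, Algebra.smul_def]
  antipode_right := by
    ext x
    have hx : x ∈ Algebra.adjoin k s := hs ▸ Algebra.mem_top
    simp only [LinearMap.comp_apply, AlgHom.toLinearMap_apply, Algebra.linearMap_apply]
    induction hx using Algebra.adjoin_induction with
    | mem x hx => exact antipode_right x hx
    | algebraMap r => simp [Algebra.TensorProduct.one_def, Algebra.algebraMap_eq_smul_one]
    | add x y _ _ hx hy => simp only [map_add, hx, hy]
    | mul x y _ _ hx hy =>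
      rw [map_mul, mul_lTensor_mul _ _ _ _ hy, hx, map_mul, map_mul, Algebra.smul_def,
        Algebra.commutes]

end OfGenerators

/-! ### Braid relations between vectors and matrices over an algebra -/

section Legs

variable {A : Type*} [Semiring A] {n : ℕ}

theorem leg1_mul_leg2_apply (M N : Matrix (Fin n) (Fin n) A) (p q : Fin n × Fin n) :
    (leg1 M * leg2 N) p q = M p.1 q.1 * N p.2 q.2 := by
  simp [Matrix.mul_apply, leg1, leg2, Fintype.sum_prod_type]

theorem leg2_mul_leg1_apply (M N : Matrix (Fin n) (Fin n) A) (p q : Fin n × Fin n) :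
    (leg2 N * leg1 M) p q = N p.2 q.2 * M p.1 q.1 := by
  simp [Matrix.mul_apply, leg1, leg2, Fintype.sum_prod_type]

theorem perm_mul_apply (M : Mat2 n A) (p q : Fin n × Fin n) :
    (perm n A * M) p q = M p.swap q := by
  simp only [Matrix.mul_apply, perm, Fintype.sum_prod_type, ite_and, ite_mul, one_mul, zero_mul,
    Prod.swap]
  rw [Finset.sum_comm]
  simp

theorem mul_perm_apply (M : Mat2 n A) (p q : Fin n × Fin n) :
    (M * perm n A) p q = M p q.swap := by
  simp only [Matrix.mul_apply, perm, Fintype.sum_prod_type, ite_and, mul_ite, mul_one, mul_zero,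
    Prod.swap]
  simp

theorem perm_mul_perm : perm n A * perm n A = 1 := by
  ext p q
  rw [perm_mul_apply, perm, Matrix.one_apply]
  simp [Prod.ext_iff, and_comm]

theorem flip21_eq (M : Mat2 n A) : flip21 M = perm n A * M * perm n A := by
  ext p q
  rw [mul_perm_apply, perm_mul_apply]
  rfl

theorem flip21_mul (M N : Mat2 n A) : flip21 (M * N) = flip21 M * flip21 N := by
  simp only [flip21_eq, Matrix.mul_assoc]
  rw [← Matrix.mul_assoc (perm n A) (perm n A), perm_mul_perm, Matrix.one_mul]

theorem flip21_one : flip21 (1 : Mat2 n A) = 1 := by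
  rw [flip21_eq, Matrix.mul_one, perm_mul_perm]

theorem flip21_leg1 (M : Matrix (Fin n) (Fin n) A) : flip21 (leg1 M) = leg2 M := rfl

theorem flip21_leg2 (M : Matrix (Fin n) (Fin n) A) : flip21 (leg2 M) = leg1 M := rfl

end Legs

/-! ### Quadratic relations in leg notation and their closure properties. -/

section BraidRel

variable {k : Type*} [Field k] {n : ℕ} {E : Type*} [Ring E] [Algebra k E]

/-- The relations `y₁ x₂ = X x₂ y₁` between vectors with entries in an algebra. -/
def BraidRel (X : Mat2 n k) (y x : Fin n → E) : Prop :=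
  ∀ i j, y i * x j = ∑ a, ∑ b, X (i, j) (a, b) • (x b * y a)

/-- The relations `G₁ K₂ X = X K₂ G₁` between matrices with entries in an algebra. -/
def MatRel (X : Mat2 n k) (G K : Matrix (Fin n) (Fin n) E) : Prop :=
  ∀ i j c d, ∑ a, ∑ b, X (a, b) (c, d) • (G i a * K j b) =
    ∑ a, ∑ b, X (i, j) (a, b) • (K b d * G a c)

/-- The relations `K₂ G₁ X = X G₁ K₂`, which are those of `MatRel` for the opposite product. -/
def OpMatRel (X : Mat2 n k) (G K : Matrix (Fin n) (Fin n) E) : Prop :=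
  ∀ i j c d, ∑ a, ∑ b, X (a, b) (c, d) • (K j b * G i a) =
    ∑ a, ∑ b, X (i, j) (a, b) • (G a c * K b d)

/-- The relations between a vector `x` and the inverse `K` of a matrix whose columns `y` satisfy
`BraidRel X y x`. -/
def InvRel (X : Mat2 n k) (K : Matrix (Fin n) (Fin n) E) (x : Fin n → E) : Prop :=
  ∀ s t m, x m * K s t = ∑ i, ∑ b, X (i, m) (t, b) • (K s i * x b)

/-- The entrywise form matches the presentations of the algebras; this form allows computation with
products of matrices whose scalar entries are central in `E`. -/
theorem braidRel_iff (X : Mat2 n k) (y x : Fin n → E) : BraidRel X y x ↔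
    (fun p : Fin n × Fin n => y p.1 * x p.2) =
      (X.map (algebraMap k E)).mulVec fun p => x p.2 * y p.1 := by
  simp only [funext_iff, Prod.forall, BraidRel, Matrix.mulVec, dotProduct, Fintype.sum_prod_type,
    Matrix.map_apply, Algebra.smul_def]

theorem matRel_iff (X : Mat2 n k) (G K : Matrix (Fin n) (Fin n) E) : MatRel X G K ↔
    leg1 G * leg2 K * X.map (algebraMap k E) = X.map (algebraMap k E) * leg2 K * leg1 G := by
  rw [Matrix.mul_assoc (X.map _), ← Matrix.ext_iff]
  simp only [Prod.forall, MatRel, Matrix.mul_apply (M := leg1 G * leg2 K),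
    Matrix.mul_apply (M := X.map _), leg1_mul_leg2_apply, leg2_mul_leg1_apply,
    Fintype.sum_prod_type, Matrix.map_apply, Algebra.smul_def, Algebra.commutes]

theorem opMatRel_iff (X : Mat2 n k) (G K : Matrix (Fin n) (Fin n) E) : OpMatRel X G K ↔
    leg2 K * leg1 G * X.map (algebraMap k E) = X.map (algebraMap k E) * leg1 G * leg2 K := by
  rw [Matrix.mul_assoc (X.map _), ← Matrix.ext_iff]
  simp only [Prod.forall, OpMatRel, Matrix.mul_apply (M := leg2 K * leg1 G),
    Matrix.mul_apply (M := X.map _), leg1_mul_leg2_apply, leg2_mul_leg1_apply,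
    Fintype.sum_prod_type, Matrix.map_apply, Algebra.smul_def, Algebra.commutes]

variable {X : Mat2 n k} {x y z u : Fin n → E} {G K : Matrix (Fin n) (Fin n) E}

theorem map_algebraMap_mul (X Y : Mat2 n k) :
    (X * Y).map (algebraMap k E) = X.map (algebraMap k E) * Y.map (algebraMap k E) :=
  Matrix.map_mul

theorem map_algebraMap_one : (1 : Mat2 n k).map (algebraMap k E) = 1 :=
  Matrix.map_one _ (map_zero _) (map_one _)

theorem map_algebraMap_add (X Y : Mat2 n k) :
    (X + Y).map (algebraMap k E) = X.map (algebraMap k E) + Y.map (algebraMap k E) :=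
  Matrix.map_add _ (map_add _) _ _

theorem map_algebraMap_perm : (perm n k).map (algebraMap k E) = perm n E := by
  ext p q
  simp only [Matrix.map_apply, perm]
  split_ifs <;> simp

theorem map_algebraMap_flip21 (X : Mat2 n k) :
    (flip21 X).map (algebraMap k E) = flip21 (X.map (algebraMap k E)) := rfl

theorem mulVec_prod_apply (M : Mat2 n E) (w : Fin n × Fin n → E) (p : Fin n × Fin n) :
    M.mulVec w p = ∑ a, ∑ b, M p (a, b) * w (a, b) := by
  simp only [Matrix.mulVec, dotProduct, Fintype.sum_prod_type]

theorem map_mulVec_apply (X : Mat2 n k) (w : Fin n × Fin n → E) (p : Fin n × Fin n) :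
    (X.map (algebraMap k E)).mulVec w p = ∑ a, ∑ b, X p (a, b) • w (a, b) := by
  simp only [mulVec_prod_apply, Matrix.map_apply, Algebra.smul_def]

theorem perm_mulVec (w : Fin n × Fin n → E) : (perm n E).mulVec w = fun p => w p.swap := by
  have h : (perm n E) = (1 : Mat2 n E).submatrix Prod.swap id := by
    ext p q
    rw [← Matrix.mul_one (perm n E), perm_mul_apply]
    rfl
  ext p
  rw [h, ← Matrix.one_mulVec w]
  simp [Matrix.mulVec, dotProduct, Matrix.submatrix_apply, Matrix.one_apply]

theorem leg1_mul_leg2_mulVec (h : ∀ a j b, Commute (x a) (K j b)) :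
    (leg1 G * leg2 K).mulVec (fun p => x p.1 * z p.2) =
      fun p => G.mulVec x p.1 * K.mulVec z p.2 := by
  ext p
  simp only [Matrix.mulVec, dotProduct, leg1_mul_leg2_apply, Fintype.sum_prod_type,
    Finset.sum_mul_sum]
  refine Finset.sum_congr rfl fun a _ => Finset.sum_congr rfl fun b _ => ?_
  rw [mul_assoc, mul_assoc, ← mul_assoc (x a), (h a _ b).eq, mul_assoc]

theorem leg2_mul_leg1_mulVec (h : ∀ i a b, Commute (G i a) (z b)) :
    (leg2 K * leg1 G).mulVec (fun p => z p.2 * x p.1) =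
      fun p => K.mulVec z p.2 * G.mulVec x p.1 := by
  ext p
  simp only [Matrix.mulVec, dotProduct, leg2_mul_leg1_apply, Fintype.sum_prod_type,
    Finset.sum_mul_sum]
  rw [Finset.sum_comm]
  refine Finset.sum_congr rfl fun a _ => Finset.sum_congr rfl fun b _ => ?_
  rw [mul_assoc, mul_assoc, ← mul_assoc (G _ b), (h _ b a).eq, mul_assoc]

/-- Covariance: `G₁x₁K₂z₂ = G₁K₂ X z₂x₁ = X K₂G₁ z₂x₁`. In a coproduct the matrices and the vectors
lie in different tensor factors, whence the commutation hypotheses. -/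
theorem BraidRel.mulVec (hX : MatRel X G K) (h : BraidRel X x z)
    (hK : ∀ a j b, Commute (x a) (K j b)) (hz : ∀ i a b, Commute (G i a) (z b)) :
    BraidRel X (G.mulVec x) (K.mulVec z) := by
  rw [braidRel_iff] at h ⊢
  rw [matRel_iff] at hX
  rw [← leg1_mul_leg2_mulVec hK, h, Matrix.mulVec_mulVec, hX, Matrix.mul_assoc,
    ← Matrix.mulVec_mulVec, leg2_mul_leg1_mulVec hz]

theorem BraidRel.add_right (h : BraidRel X y x) (h' : BraidRel X y z) :
    BraidRel X y (x + z) := by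
  intro i j
  simp only [Pi.add_apply, mul_add, add_mul, h i j, h' i j, smul_add, Finset.sum_add_distrib]

theorem BraidRel.add_left (h : BraidRel X y x) (h' : BraidRel X z x) :
    BraidRel X (y + z) x := by
  intro i j
  simp only [Pi.add_apply, mul_add, add_mul, h i j, h' i j, smul_add, Finset.sum_add_distrib]

theorem BraidRel.zero_left : BraidRel X (0 : Fin n → E) x := by
  intro i j; simp

theorem BraidRel.sum_left {ι : Type*} (s : Finset ι) (f : ι → Fin n → E)
    (h : ∀ a ∈ s, BraidRel X (f a) x) : BraidRel X (∑ a ∈ s, f a) x := by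
  classical
  induction s using Finset.induction_on with
  | empty => exact BraidRel.zero_left
  | insert a s ha ih =>
    rw [Finset.sum_insert ha]
    exact (h a (by simp)).add_left (ih fun b hb => h b (by simp [hb]))

theorem BraidRel.mul_right {g : E} (h : BraidRel X y x) (hg : ∀ j, Commute g (x j)) :
    BraidRel X (fun i => y i * g) x := by
  intro i j
  simp only
  rw [mul_assoc, (hg j).eq, ← mul_assoc, h i j, Finset.sum_mul]
  simp only [Finset.sum_mul, smul_mul_assoc, mul_assoc]

theorem BraidRel.mulVec_left (h : ∀ a, BraidRel X (fun i => G i a) x)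
    (hu : ∀ a j, Commute (u a) (x j)) : BraidRel X (G.mulVec u) x := by
  have : G.mulVec u = ∑ a, fun i => G i a * u a := by
    ext i
    simp [Matrix.mulVec, dotProduct]
  rw [this]
  exact BraidRel.sum_left _ _ fun a _ => (h a).mul_right (hu a)

theorem BraidRel.mul_left {g : E} {μ : k} (h : BraidRel X y x)
    (hg : ∀ j, g * x j = μ • (x j * g)) : BraidRel (μ • X) (fun i => g * y i) x := by
  intro i j
  simp only [mul_assoc, h i j, Finset.mul_sum, mul_smul_comm, Matrix.smul_apply]
  refine Finset.sum_congr rfl fun a _ => Finset.sum_congr rfl fun b _ => ?_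
  rw [← mul_assoc, hg, smul_mul_assoc, smul_smul, mul_assoc, smul_eq_mul, mul_comm]

/-- The sum of two copies of a quantum plane with braid statistics is again a copy. -/
theorem BraidRel.add_self {R' R : Mat2 n k} (hR : R' * (1 + perm n k * R) = perm n k + R)
    (hx : BraidRel R' x x) (hy : BraidRel R' y y) (hyx : BraidRel R y x) :
    BraidRel R' (x + y) (x + y) := by
  rw [braidRel_iff] at *
  -- The cross terms of `(x+y)₁(x+y)₂` are `(P + R) x₂y₁`, those of `R'(x+y)₂(x+y)₁` are `R'(1 + PR)
  -- x₂y₁`; the terms with two `x` or two `y` match by `hx` and `hy`.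
  have hxy : (fun p : Fin n × Fin n => x p.1 * y p.2) =
      (perm n E).mulVec fun p => x p.2 * y p.1 := by
    rw [perm_mulVec]; rfl
  have hyx' : (fun p : Fin n × Fin n => y p.2 * x p.1) =
      (perm n E).mulVec fun p => y p.1 * x p.2 := by
    rw [perm_mulVec]; rfl
  have hR' := congrArg (fun M => (M.map (algebraMap k E)).mulVec
    fun p : Fin n × Fin n => x p.2 * y p.1) hR
  simp only [map_algebraMap_mul, map_algebraMap_add, map_algebraMap_one, map_algebraMap_perm,
    ← Matrix.mulVec_mulVec, Matrix.add_mulVec, Matrix.one_mulVec, ← hyx, ← hyx', ← hxy] at hR'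
  have e1 : (fun p : Fin n × Fin n => (x + y) p.1 * (x + y) p.2) =
      (fun p => x p.1 * x p.2) + ((fun p => x p.1 * y p.2) + fun p => y p.1 * x p.2) +
        fun p => y p.1 * y p.2 := by
    ext p; simp only [Pi.add_apply]; noncomm_ring
  have e2 : (fun p : Fin n × Fin n => (x + y) p.2 * (x + y) p.1) =
      (fun p => x p.2 * x p.1) + ((fun p => x p.2 * y p.1) + fun p => y p.2 * x p.1) +
        fun p => y p.2 * y p.1 := by
    ext p; simp only [Pi.add_apply]; noncomm_ring
  rw [e1, e2, Matrix.mulVec_add, Matrix.mulVec_add, ← hx, ← hy, hR']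

theorem BraidRel.symm {Y : Mat2 n k} (hYX : Y * X = 1) (h : BraidRel X y x) :
    BraidRel (flip21 Y) x y := by
  rw [braidRel_iff] at *
  have h' := congrArg (Y.map (algebraMap k E)).mulVec h
  rw [Matrix.mulVec_mulVec, ← map_algebraMap_mul, hYX, map_algebraMap_one, Matrix.one_mulVec] at h'
  ext p
  have := congrFun h' p.swap
  simp only [Prod.fst_swap, Prod.snd_swap] at this
  rw [← this]
  simp only [Matrix.mulVec, dotProduct, Fintype.sum_prod_type, Matrix.map_apply, flip21]
  rw [Finset.sum_comm]
  rfl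

/-- Multiply `G₁x₂ = X x₂G₁` by `K₁` on both sides to get `x₂K₁ = K₁ X x₂`. The case of interest is
`K = S(G)`. -/
theorem invRel_of_braidRel (h : ∀ j, BraidRel X (fun i => G i j) x) (hGK : G * K = 1)
    (hKG : K * G = 1) : InvRel X K x := by
  intro s t m
  have h1 : ∀ a j, ∑ i, K a i * G i j = if a = j then 1 else 0 := fun a j => by
    rw [← Matrix.mul_apply, hKG, Matrix.one_apply]
  have h2 : ∀ a j, ∑ i, G a i * K i j = if a = j then 1 else 0 := fun a j => by
    rw [← Matrix.mul_apply, hGK, Matrix.one_apply]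
  calc x m * K s t = ∑ j, (∑ i, K s i * G i j) * (x m * K j t) := by simp [h1]
    _ = ∑ j, ∑ i, K s i * (G i j * x m) * K j t := by simp only [Finset.sum_mul, mul_assoc]
    _ = ∑ j, ∑ i, ∑ a, ∑ b, X (i, m) (a, b) • (K s i * x b * (G a j * K j t)) := by
      refine Finset.sum_congr rfl fun j _ => Finset.sum_congr rfl fun i _ => ?_
      rw [h j i m]
      simp only [Finset.mul_sum, Finset.sum_mul, mul_smul_comm, smul_mul_assoc, mul_assoc]
    _ = ∑ i, ∑ a, ∑ b, X (i, m) (a, b) • (K s i * x b * ∑ j, G a j * K j t) := by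
      rw [Finset.sum_comm]
      refine Finset.sum_congr rfl fun i _ => ?_
      rw [Finset.sum_comm]
      refine Finset.sum_congr rfl fun a _ => ?_
      rw [Finset.sum_comm]
      simp only [Finset.mul_sum, Finset.smul_sum]
    _ = _ := by
      simp only [h2, mul_ite, mul_one, mul_zero, smul_ite, smul_zero]
      refine Finset.sum_congr rfl fun i _ => ?_
      rw [Finset.sum_comm]
      simp

theorem InvRel.mul_left {g : E} {μ : k} (h : InvRel X K x)
    (hg : ∀ j, x j * g = μ • (g * x j)) : InvRel (μ • X) (Matrix.of fun i j => g * K i j) x := by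
  intro s t m
  simp only [Matrix.of_apply, ← mul_assoc, hg]
  simp only [smul_mul_assoc, mul_assoc, h s t m, Finset.mul_sum, mul_smul_comm, Matrix.smul_apply,
    Finset.smul_sum, smul_smul, smul_eq_mul]

/-- `G₂x₂K₁ = G₂K₁ X x₂ = X K₁G₂ x₂`. Read in the opposite algebra, this is a `BraidRel` for the
vector `Gx`, as needed for the antipode of `p`. -/
theorem InvRel.mulVec (hK : InvRel X K x) (hX : OpMatRel X K G) (i j m : Fin n) :
    G.mulVec x m * K i j = ∑ a, ∑ b, X (i, m) (a, b) • (K a j * G.mulVec x b) := by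
  calc G.mulVec x m * K i j = ∑ c, G m c * (x c * K i j) := by
        simp only [Matrix.mulVec, dotProduct, Finset.sum_mul, mul_assoc]
    _ = ∑ c, ∑ a, ∑ b, X (a, c) (j, b) • (G m c * K i a * x b) := by
        simp only [hK i j, Finset.mul_sum, mul_smul_comm, mul_assoc]
    _ = ∑ b, (∑ a, ∑ c, X (a, c) (j, b) • (G m c * K i a)) * x b := by
        simp only [Finset.sum_mul, smul_mul_assoc]
        rw [Finset.sum_comm]
        simp_rw [Finset.sum_comm (s := Finset.univ) (t := Finset.univ)
          (f := fun c b => X (_, c) (j, b) • _)]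
        rw [Finset.sum_comm]
    _ = ∑ b, (∑ a, ∑ e, X (i, m) (a, e) • (K a j * G e b)) * x b := by
        simp only [hX i m j]
    _ = _ := by
        simp only [Finset.sum_mul, smul_mul_assoc, Matrix.mulVec, dotProduct, Finset.mul_sum,
          Finset.smul_sum, mul_assoc]
        rw [Finset.sum_comm]
        refine Finset.sum_congr rfl fun a _ => ?_
        rw [Finset.sum_comm]

/-- Reordering gives `(Gx)₂(Gx)₁ = G₂G₁ R x₂x₁`, hence `(Gx)₁(Gx)₂ = G₁G₂ P R x₂x₁`. Applying `R'`
and moving it past `G₁G₂` yields `G₂G₁ R'PR x₂x₁ = G₂G₁ RP R' x₂x₁ = G₂G₁ RP x₁x₂`, which is the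
first expression again. -/
theorem InvRel.mulVec_self {R' R : Mat2 n k} (hR : R' * perm n k * R = R * perm n k * R')
    (hx : BraidRel R' x x) (hG : InvRel R G x) (hX : OpMatRel R' G G) (i j : Fin n) :
    G.mulVec x j * G.mulVec x i = ∑ a, ∑ b, R' (i, j) (a, b) • (G.mulVec x a * G.mulVec x b) := by
  have hL : (fun p : Fin n × Fin n => G.mulVec x p.2 * G.mulVec x p.1) =
      (leg2 G * leg1 G * R.map (algebraMap k E)).mulVec fun p => x p.2 * x p.1 := by
    ext p
    rw [← Matrix.mulVec_mulVec, mulVec_prod_apply]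
    simp only [leg2_mul_leg1_apply, map_mulVec_apply]
    calc G.mulVec x p.2 * G.mulVec x p.1 = ∑ a, ∑ b, G p.2 a * (x a * G p.1 b) * x b := by
          simp only [Matrix.mulVec, dotProduct, Finset.sum_mul_sum, mul_assoc]
      _ = ∑ a, ∑ b, ∑ c, ∑ d, R (c, a) (b, d) • (G p.2 a * G p.1 c * (x d * x b)) := by
          simp only [hG p.1, Finset.mul_sum, Finset.sum_mul, mul_smul_comm, smul_mul_assoc,
            mul_assoc]
      _ = ∑ a, ∑ c, ∑ b, ∑ d, R (c, a) (b, d) • (G p.2 a * G p.1 c * (x d * x b)) :=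
          Finset.sum_congr rfl fun a _ => Finset.sum_comm
      _ = _ := by
          rw [Finset.sum_comm]
          simp only [Finset.mul_sum, mul_smul_comm]
  have hP : (fun p : Fin n × Fin n => G.mulVec x p.1 * G.mulVec x p.2) =
      (perm n E).mulVec fun p => G.mulVec x p.2 * G.mulVec x p.1 := by
    rw [perm_mulVec]; rfl
  have hxP : (fun p : Fin n × Fin n => x p.2 * x p.1) =
      (perm n E).mulVec fun p => x p.1 * x p.2 := by
    rw [perm_mulVec]; rfl
  rw [braidRel_iff] at hx
  rw [opMatRel_iff] at hX
  have hPL : perm n E * (leg2 G * leg1 G) = leg1 G * leg2 G * perm n E := by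
    have := flip21_mul (leg2 G) (leg1 G)
    rw [flip21_eq, flip21_leg1, flip21_leg2] at this
    rw [← this, Matrix.mul_assoc _ _ (perm n E), perm_mul_perm, Matrix.mul_one]
  have hR2 := congrArg (fun M => M.map (algebraMap k E)) hR
  simp only [map_algebraMap_mul, map_algebraMap_perm] at hR2
  have : (fun p : Fin n × Fin n => G.mulVec x p.2 * G.mulVec x p.1) =
      (R'.map (algebraMap k E)).mulVec fun p => G.mulVec x p.1 * G.mulVec x p.2 := by
    rw [hP, hL]
    simp only [Matrix.mulVec_mulVec]
    rw [← Matrix.mul_assoc (perm n E), hPL, ← Matrix.mul_assoc, ← Matrix.mul_assoc,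
      ← Matrix.mul_assoc, ← hX, Matrix.mul_assoc _ (perm n E), Matrix.mul_assoc _ (R'.map _),
      ← Matrix.mul_assoc (R'.map _), hR2, ← Matrix.mul_assoc,
      ← Matrix.mulVec_mulVec (M := leg2 G * leg1 G * _), ← hx,
      ← Matrix.mul_assoc, ← Matrix.mulVec_mulVec (N := perm n E), ← hxP]
  have := congrFun this (i, j)
  rwa [map_mulVec_apply] at this

end BraidRel

/-! ### Matrix relations under algebra maps, opposite algebras, rescaling and inversion. -/

section MatRel

variable {k : Type*} [Field k] {n : ℕ} {E F : Type*} [Ring E] [Algebra k E] [Ring F] [Algebra k F]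
variable {X : Mat2 n k} {x y : Fin n → E} {G K : Matrix (Fin n) (Fin n) E}

theorem MatRel.map (h : MatRel X G K) (f : E →ₐ[k] F) : MatRel X (G.map f) (K.map f) := by
  intro i j c d
  simpa only [map_sum, map_smul, map_mul, Matrix.map_apply] using congrArg f (h i j c d)

theorem OpMatRel.map (h : OpMatRel X G K) (f : E →ₐ[k] F) : OpMatRel X (G.map f) (K.map f) := by
  intro i j c d
  simpa only [map_sum, map_smul, map_mul, Matrix.map_apply] using congrArg f (h i j c d)

theorem BraidRel.map (h : BraidRel X y x) (f : E →ₐ[k] F) :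
    BraidRel X (fun i => f (y i)) (fun i => f (x i)) := by
  intro i j
  simpa only [map_sum, map_smul, map_mul] using congrArg f (h i j)

/-- The transposed matrix, with entries in the opposite algebra. -/
def opT (G : Matrix (Fin n) (Fin n) E) : Matrix (Fin n) (Fin n) Eᵐᵒᵖ :=
  Matrix.of fun i j => MulOpposite.op (G j i)

/-- Reversing products and transposing the entries interchanges the two sides of the relation, so
its type is kept and `X` is transposed. This carries the results on `p` over to `c`. -/
theorem MatRel.opT (h : MatRel X G K) : MatRel X.transpose (opT G) (opT K) := by
  intro i j c d
  have := congrArg MulOpposite.op (h c d i j)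
  simp only [Finset.op_sum, MulOpposite.op_smul, MulOpposite.op_mul] at this
  exact this.symm

theorem OpMatRel.opT (h : OpMatRel X G K) :
    OpMatRel X.transpose (opT G) (QConformal.opT K) := by
  intro i j c d
  have := congrArg MulOpposite.op (h c d i j)
  simp only [Finset.op_sum, MulOpposite.op_smul, MulOpposite.op_mul] at this
  exact this.symm

theorem MatRel.mul_left_right {g : E} (h : MatRel X G K) (hg : ∀ i j, Commute g (G i j)) :
    MatRel X G (Matrix.of fun i j => g * K i j) := by
  intro i j c d
  have := congrArg (g * ·) (h i j c d)
  simp only [Finset.mul_sum, mul_smul_comm] at this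
  simp only [Matrix.of_apply, ← mul_assoc, ← (hg _ _).eq]
  simpa only [mul_assoc] using this

theorem MatRel.mul_left_left {g : E} (h : MatRel X G K) (hg : ∀ i j, Commute g (K i j)) :
    MatRel X (Matrix.of fun i j => g * G i j) K := by
  intro i j c d
  have := congrArg (g * ·) (h i j c d)
  simp only [Finset.mul_sum, mul_smul_comm] at this
  simp only [Matrix.of_apply]
  simp only [← mul_assoc, ← (hg _ _).eq]
  simpa only [mul_assoc] using this

theorem OpMatRel.mul_left_right {g : E} (h : OpMatRel X G K) (hg : ∀ i j, Commute g (G i j)) :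
    OpMatRel X G (Matrix.of fun i j => g * K i j) := by
  intro i j c d
  have := congrArg (g * ·) (h i j c d)
  simp only [Finset.mul_sum, mul_smul_comm] at this
  simp only [Matrix.of_apply]
  simp only [← mul_assoc, ← (hg _ _).eq]
  simpa only [mul_assoc] using this

theorem OpMatRel.mul_left_left {g : E} (h : OpMatRel X G K) (hg : ∀ i j, Commute g (K i j)) :
    OpMatRel X (Matrix.of fun i j => g * G i j) K := by
  intro i j c d
  have := congrArg (g * ·) (h i j c d)
  simp only [Finset.mul_sum, mul_smul_comm] at this
  simp only [Matrix.of_apply]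
  simp only [← mul_assoc, ← (hg _ _).eq]
  simpa only [mul_assoc] using this

theorem MatRel.smul (h : MatRel X G K) (r : k) : MatRel (r • X) G K := by
  intro i j c d
  simpa only [Finset.smul_sum, smul_smul, Matrix.smul_apply, smul_eq_mul] using
    congrArg (r • ·) (h i j c d)

/-- Multiplying by `Y` on both sides gives `Y G₁K₂ = K₂G₁ Y`; exchanging the legs then swaps the
roles of `G` and `K`. -/
theorem MatRel.inv {Y : Mat2 n k} (h : MatRel X G K) (hXY : X * Y = 1) (hYX : Y * X = 1) :
    MatRel (flip21 Y) K G := by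
  rw [matRel_iff] at *
  have h1 := congrArg (·.map (algebraMap k E)) hXY
  have h2 := congrArg (·.map (algebraMap k E)) hYX
  simp only [map_algebraMap_mul, map_algebraMap_one] at h1 h2
  have h3 := congrArg (fun M => flip21 (Y.map (algebraMap k E) * M * Y.map (algebraMap k E))) h
  simp only [Matrix.mul_assoc, h1, Matrix.mul_one] at h3
  rw [← Matrix.mul_assoc (Y.map _) (X.map _), h2, Matrix.one_mul] at h3
  simp only [flip21_mul, flip21_leg1, flip21_leg2] at h3
  rw [map_algebraMap_flip21]
  simp only [Matrix.mul_assoc]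
  exact h3.symm

end MatRel

/-! ### Consequences of the conditions on `R', R` -/

namespace IsBraidedPair

variable {k : Type*} [Field k] {n : ℕ} {R' R : Mat2 n k}

theorem mul_inv_cancel (h : IsBraidedPair R' R) : R * R⁻¹ = 1 :=
  Matrix.mul_nonsing_inv _ ((Matrix.isUnit_iff_isUnit_det _).1 h.isUnit_R)

theorem inv_mul_cancel (h : IsBraidedPair R' R) : R⁻¹ * R = 1 :=
  Matrix.nonsing_inv_mul _ ((Matrix.isUnit_iff_isUnit_det _).1 h.isUnit_R)

theorem exchange' (h : IsBraidedPair R' R) : R' * perm n k * R = R * perm n k * R' := by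
  have := congrArg (perm n k * ·) h.exchange
  simp only [flip21_eq, ← Matrix.mul_assoc, perm_mul_perm, Matrix.one_mul] at this
  exact this.symm

/-- The coaddition condition multiplied on the left by `P`, using `P² = 1`. -/
theorem add_exchange (h : IsBraidedPair R' R) : R' + R * perm n k * R' = perm n k + R := by
  have := congrArg (perm n k * ·) h.coaddition
  simp only [mul_sub, add_mul, mul_add, ← Matrix.mul_assoc, perm_mul_perm, Matrix.one_mul,
    mul_one, mul_zero] at this
  rw [← sub_eq_zero, ← this]
  abel

theorem coaddition_R (h : IsBraidedPair R' R) : R' * (1 + perm n k * R) = perm n k + R := by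
  rw [mul_add, mul_one, ← Matrix.mul_assoc, h.exchange', h.add_exchange]

theorem exchange_inv (h : IsBraidedPair R' R) : R' * R⁻¹ * perm n k = perm n k * R⁻¹ * R' := by
  have := congrArg (fun M => perm n k * R⁻¹ * M * R⁻¹ * perm n k) h.exchange'
  simp only [Matrix.mul_assoc] at this
  rw [← Matrix.mul_assoc R R⁻¹, h.mul_inv_cancel, Matrix.one_mul, perm_mul_perm, Matrix.mul_one,
    ← Matrix.mul_assoc R⁻¹ R, h.inv_mul_cancel, Matrix.one_mul,
    ← Matrix.mul_assoc (perm n k) (perm n k), perm_mul_perm, Matrix.one_mul] at this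
  simpa only [Matrix.mul_assoc] using this.symm

theorem add_exchange_inv (h : IsBraidedPair R' R) :
    R' + perm n k * R⁻¹ * R' = perm n k + flip21 R⁻¹ := by
  have := congrArg (fun M => perm n k * R⁻¹ * M) h.add_exchange
  simp only [mul_add, Matrix.mul_assoc] at this
  rw [← Matrix.mul_assoc R⁻¹ R, h.inv_mul_cancel, Matrix.one_mul,
    ← Matrix.mul_assoc (perm n k) (perm n k), perm_mul_perm, Matrix.one_mul, Matrix.mul_one] at this
  rw [flip21_eq, Matrix.mul_assoc, add_comm, this, add_comm, Matrix.mul_assoc]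

/-- The inverse braiding `R₂₁⁻¹` is as good as `R` for braided addition. It governs the statistics
between `ς⁻¹l⁺` and `p`, and its transpose those of the `c`'s. -/
theorem coaddition_R_inv (h : IsBraidedPair R' R) :
    R' * (1 + perm n k * flip21 R⁻¹) = perm n k + flip21 R⁻¹ := by
  rw [mul_add, mul_one, ← h.add_exchange_inv, ← h.exchange_inv, flip21_eq, Matrix.mul_assoc,
    ← Matrix.mul_assoc (perm n k) (perm n k), perm_mul_perm, Matrix.one_mul, Matrix.mul_assoc]

theorem exchange_flip (h : IsBraidedPair R' R) :
    flip21 R⁻¹ * perm n k * R' = R' * perm n k * flip21 R⁻¹ := by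
  rw [flip21_eq, Matrix.mul_assoc _ (perm n k) (perm n k), perm_mul_perm, Matrix.mul_one,
    ← h.exchange_inv, ← Matrix.mul_assoc, ← Matrix.mul_assoc, Matrix.mul_assoc R' (perm n k),
    perm_mul_perm, Matrix.mul_one]

theorem add_exchange_flip (h : IsBraidedPair R' R) :
    R' + flip21 R⁻¹ * perm n k * R' = perm n k + flip21 R⁻¹ := by
  rw [← h.add_exchange_inv, flip21_eq, Matrix.mul_assoc _ (perm n k) (perm n k), perm_mul_perm,
    Matrix.mul_one]

theorem perm_transpose : (perm n k).transpose = perm n k := by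
  ext p q
  simp only [Matrix.transpose_apply, perm, eq_comm (a := q.1), eq_comm (a := q.2),
    and_comm (a := p.2 = q.1)]

theorem coaddition_transpose (h : IsBraidedPair R' R) :
    R'.transpose * (1 + perm n k * (flip21 R⁻¹).transpose) =
    perm n k + (flip21 R⁻¹).transpose := by
  have := congrArg Matrix.transpose h.add_exchange_flip
  simp only [Matrix.transpose_add, Matrix.transpose_mul, perm_transpose] at this
  rw [mul_add, mul_one, this]

theorem exchange_transpose (h : IsBraidedPair R' R) :
    R'.transpose * perm n k * (flip21 R⁻¹).transpose =
    (flip21 R⁻¹).transpose * perm n k * R'.transpose := by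
  have := congrArg Matrix.transpose h.exchange_flip
  simpa only [Matrix.transpose_mul, perm_transpose, Matrix.mul_assoc] using this

end IsBraidedPair

/-! ### Consequences of the regularity of the data -/

namespace Data

variable {k : Type*} [Field k] {n : ℕ} {H : Type*} [Ring H] [HopfAlgebra k H]

/-- The matrix in the relations `l⁺₁ p₂ = lam⁻¹ R₂₁⁻¹ p₂ l⁺₁`. -/
def braidPlus (D : Data k n H) : Mat2 n k := D.lam⁻¹ • flip21 D.R⁻¹

/-- The matrix in the relations `l⁻₁ p₂ = lam R p₂ l⁻₁`. -/
def braidMinus (D : Data k n H) : Mat2 n k := D.lam • D.R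

/-- The matrix of antipodes of the entries of a matrix. -/
def matAntipode (k : Type*) [Field k] {n : ℕ} {H : Type*} [Ring H] [HopfAlgebra k H]
    (M : Matrix (Fin n) (Fin n) H) : Matrix (Fin n) (Fin n) H :=
  M.map (HopfAlgebra.antipode k)

theorem mul_matAntipode {M : Matrix (Fin n) (Fin n) H}
    (hM : ∀ i j, Coalgebra.comul (R := k) (M i j) = ∑ a, M i a ⊗ₜ[k] M a j)
    (hM' : ∀ i j, Coalgebra.counit (R := k) (M i j) = if i = j then 1 else 0) :
    M * matAntipode k M = 1 := by
  ext i j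
  have := HopfAlgebra.mul_antipode_lTensor_comul_apply (R := k) (M i j)
  rw [hM, hM'] at this
  simpa [Matrix.mul_apply, Matrix.one_apply, matAntipode, apply_ite (algebraMap k H)] using this

theorem matAntipode_mul {M : Matrix (Fin n) (Fin n) H}
    (hM : ∀ i j, Coalgebra.comul (R := k) (M i j) = ∑ a, M i a ⊗ₜ[k] M a j)
    (hM' : ∀ i j, Coalgebra.counit (R := k) (M i j) = if i = j then 1 else 0) :
    matAntipode k M * M = 1 := by
  ext i j
  have := HopfAlgebra.mul_antipode_rTensor_comul_apply (R := k) (M i j)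
  rw [hM, hM'] at this
  simpa [Matrix.mul_apply, Matrix.one_apply, matAntipode, apply_ite (algebraMap k H)] using this

theorem matRel_matAntipode {X : Mat2 n k} {G K : Matrix (Fin n) (Fin n) H} (h : MatRel X G K) :
    OpMatRel X (matAntipode k G) (matAntipode k K) := by
  intro i j c d
  have := congrArg (HopfAlgebra.antipode k) (h i j c d)
  simpa only [map_sum, map_smul, HopfAlgebra.antipode_mul_antidistrib, matAntipode,
    Matrix.map_apply] using this

/-- The antipode preserves commutation of the image of a matrix, inverse to its matrix of
antipodes, with a fixed element. -/
theorem commute_antipode_iterate {E : Type*} [Ring E] [Algebra k E] (f : H →ₐ[k] E) (z : E) (m : ℕ)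
    (M : Matrix (Fin n) (Fin n) H) (h1 : M * matAntipode k M = 1) (h2 : matAntipode k M * M = 1)
    (hz : ∀ i j, Commute (f (M i j)) z) (i j : Fin n) :
    Commute (f ((HopfAlgebra.antipode k)^[m] (M i j))) z := by
  induction m generalizing M i j with
  | zero => exact hz i j
  | succ m ih =>
    have e1 : ∀ i j, ∑ a, M i a * HopfAlgebra.antipode k (M a j) = if i = j then 1 else 0 := by
      intro i j
      rw [← Matrix.one_apply, ← h1]; rfl
    have e2 : ∀ i j, ∑ a, HopfAlgebra.antipode k (M i a) * M a j = if i = j then 1 else 0 := by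
      intro i j
      rw [← Matrix.one_apply, ← h2]; rfl
    rw [Function.iterate_succ_apply]
    -- As `S` reverses products, applying it to `M S(M) = 1 = S(M) M` shows that the transpose of
    -- `S(M)` is again inverse to its own matrix of antipodes, so the induction can continue with
    -- it.
    refine ih (matAntipode k M).transpose ?_ ?_ ?_ j i
    · ext i j
      have := congrArg (HopfAlgebra.antipode k) (e2 j i)
      rw [map_sum] at this
      simp only [HopfAlgebra.antipode_mul_antidistrib, apply_ite (HopfAlgebra.antipode k),
        HopfAlgebra.antipode_one, map_zero, eq_comm (a := j)] at this
      rwa [← Matrix.one_apply] at this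
    · ext i j
      have := congrArg (HopfAlgebra.antipode k) (e1 j i)
      rw [map_sum] at this
      simp only [HopfAlgebra.antipode_mul_antidistrib, apply_ite (HopfAlgebra.antipode k),
        HopfAlgebra.antipode_one, map_zero, eq_comm (a := j)] at this
      rwa [← Matrix.one_apply] at this
    · intro j i
      have f1 : M.map f * (matAntipode k M).map f = 1 := by
        rw [← Matrix.map_mul, h1, Matrix.map_one _ (map_zero f) (map_one f)]
      have f2 : (matAntipode k M).map f * M.map f = 1 := by
        rw [← Matrix.map_mul, h2, Matrix.map_one _ (map_zero f) (map_one f)]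
      have f3 : M.map f * Matrix.diagonal (fun _ => z) = Matrix.diagonal (fun _ => z) * M.map f := by
        ext i j
        rw [Matrix.mul_diagonal, Matrix.diagonal_mul]
        exact hz i j
      -- Whatever commutes with a matrix commutes with its inverse. For a single element of `H`
      -- there would be no such passage from `h` to `S h`.
      have f4 : (matAntipode k M).map f * Matrix.diagonal (fun _ => z) =
          Matrix.diagonal (fun _ => z) * (matAntipode k M).map f := by
        calc _ = (matAntipode k M).map f * (Matrix.diagonal (fun _ => z) *
              (M.map f * (matAntipode k M).map f)) := by rw [f1, mul_one]
          _ = _ := by rw [← mul_assoc (Matrix.diagonal _), ← f3, mul_assoc, ← mul_assoc, f2, one_mul]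
      have := congrFun (congrFun f4 i) j
      rwa [Matrix.mul_diagonal, Matrix.diagonal_mul] at this

variable {D : Data k n H}

/-- An element that commutes with the images of the `l^±` under an algebra map commutes with the
whole image. -/
theorem IsRegular.commute {E : Type*} [Ring E] [Algebra k E] (hD : D.IsRegular) (f : H →ₐ[k] E)
    (z : E) (hp : ∀ i j, Commute (f (D.lp i j)) z) (hm : ∀ i j, Commute (f (D.lm i j)) z) (h : H) :
    Commute (f h) z := by
  -- Iterates of the antipode are multiplicative or antimultiplicative according to parity; for a
  -- statement about commutation either case will do.
  have hmul : ∀ (m : ℕ) (a b : H),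
      (HopfAlgebra.antipode k)^[m] (a * b) =
          (HopfAlgebra.antipode k)^[m] a * (HopfAlgebra.antipode k)^[m] b ∨
        (HopfAlgebra.antipode k)^[m] (a * b) =
          (HopfAlgebra.antipode k)^[m] b * (HopfAlgebra.antipode k)^[m] a := by
    intro m a b
    induction m with
    | zero => exact Or.inl rfl
    | succ m ih =>
      simp only [Function.iterate_succ_apply']
      rcases ih with ih | ih <;> rw [ih, HopfAlgebra.antipode_mul_antidistrib] <;> simp
  have hadd : ∀ (m : ℕ) (a b : H), (HopfAlgebra.antipode k)^[m] (a + b) =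
      (HopfAlgebra.antipode k)^[m] a + (HopfAlgebra.antipode k)^[m] b := by
    intro m a b
    induction m with
    | zero => rfl
    | succ m ih => simp only [Function.iterate_succ_apply', ih, map_add]
  have hsc : ∀ (m : ℕ) (r : k), (HopfAlgebra.antipode k)^[m] (algebraMap k H r) =
      algebraMap k H r := by
    intro m r
    induction m with
    | zero => rfl
    | succ m ih =>
      rw [Function.iterate_succ_apply', ih, Algebra.algebraMap_eq_smul_one, map_smul,
        HopfAlgebra.antipode_one]
  -- Commutation is demanded for all iterates of the antipode, so that `B` is stable under `S` by a
  -- shift of `m`, as `generated` requires.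
  let B : Subalgebra k H :=
    { carrier := {h | ∀ m, Commute (f ((HopfAlgebra.antipode k)^[m] h)) z}
      mul_mem' := fun {a b} ha hb m => by
        rcases hmul m a b with h | h <;> rw [h, map_mul]
        · exact (ha m).mul_left (hb m)
        · exact (hb m).mul_left (ha m)
      add_mem' := fun {a b} ha hb m => by
        rw [hadd, map_add]
        exact (ha m).add_left (hb m)
      algebraMap_mem' := fun r m => by
        rw [hsc, AlgHom.commutes]
        exact Algebra.commutes r z }
  have hB : B = ⊤ := hD.generated B
    (fun i j m => commute_antipode_iterate f z m D.lp (mul_matAntipode hD.comul_lp hD.counit_lp)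
      (matAntipode_mul hD.comul_lp hD.counit_lp) hp i j)
    (fun i j m => commute_antipode_iterate f z m D.lm (mul_matAntipode hD.comul_lm hD.counit_lm)
      (matAntipode_mul hD.comul_lm hD.counit_lm) hm i j)
    (fun x hx m => by rw [← Function.iterate_succ_apply]; exact hx (m + 1))
  have : h ∈ B := hB ▸ Algebra.mem_top
  exact this 0

/-- The relations are homogeneous in `X`, so the FRT relations hold equally with the normalised
matrices that occur in the commutation rules with `p`; for `l⁺` on the first leg the FRT relation is
inverted. -/
theorem IsRegular.matRel_lp_lp (hD : D.IsRegular) : MatRel D.braidPlus D.lp D.lp :=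
  (((matRel_iff _ _ _).2 hD.frt_plus).inv hD.braidedPair.mul_inv_cancel
    hD.braidedPair.inv_mul_cancel).smul _

theorem IsRegular.matRel_lp_lm (hD : D.IsRegular) : MatRel D.braidPlus D.lp D.lm :=
  (((matRel_iff _ _ _).2 hD.frt_mixed).inv hD.braidedPair.mul_inv_cancel
    hD.braidedPair.inv_mul_cancel).smul _

theorem IsRegular.matRel_lm_lm (hD : D.IsRegular) : MatRel D.braidMinus D.lm D.lm :=
  ((matRel_iff _ _ _).2 hD.frt_minus).smul _

theorem IsRegular.matRel_lm_lp (hD : D.IsRegular) : MatRel D.braidMinus D.lm D.lp :=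
  ((matRel_iff _ _ _).2 hD.frt_mixed).smul _

end Data

/-! ### The extended `q`-Poincaré algebra -/

section Poincare

variable {k : Type*} [Field k] {n : ℕ} {H : Type*} [Ring H] [HopfAlgebra k H] {D : Data k n H}
  {E : Type*} [Ring E] [Algebra k E] {f : H →ₐ[k] E} {x : Fin n → E} {s s' : E}

/-- The relations of the extended `q`-Poincaré algebra, in an algebra `E` over `H`. -/
structure IsPoincareRep (D : Data k n H) (f : H →ₐ[k] E) (x : Fin n → E) (s s' : E) : Prop where
  dil_mul_inv : s * s' = 1
  dil_inv_mul : s' * s = 1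
  mom_mom : BraidRel D.R' x x
  lp_mom : ∀ j, BraidRel D.braidPlus (fun i => f (D.lp i j)) x
  lm_mom : ∀ j, BraidRel D.braidMinus (fun i => f (D.lm i j)) x
  dil_mom : ∀ i, s * x i = D.lam⁻¹ • (x i * s)
  lp_dil : ∀ i j, Commute (f (D.lp i j)) s
  lm_dil : ∀ i j, Commute (f (D.lm i j)) s

namespace Poincare

/-- The universal property of the extended `q`-Poincaré algebra. -/
def lift (h : IsPoincareRep D f x s s') : Poincare D →ₐ[k] E :=
  RingQuot.liftAlgHom k ⟨FreeExt.lift f fun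
      | .mom i => x i
      | .dil => s
      | .dilInv => s', by
    intro a b hab
    cases hab with
    | dil_mul_inv => simpa using h.dil_mul_inv
    | dil_inv_mul => simpa using h.dil_inv_mul
    | mom_mom i j => simpa using h.mom_mom i j
    | lp_mom i j m =>
      simpa [Data.braidPlus, Finset.smul_sum, smul_smul, flip21] using h.lp_mom j i m
    | lm_mom i j m =>
      simpa [Data.braidMinus, Finset.smul_sum, smul_smul] using h.lm_mom j i m
    | dil_mom i => simpa using h.dil_mom i
    | lp_dil i j => simpa using (h.lp_dil i j).eq
    | lm_dil i j => simpa using (h.lm_dil i j).eq⟩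

@[simp] theorem lift_rot (h : IsPoincareRep D f x s s') (a : H) : lift h (rot D a) = f a := by
  simp [lift, rot]

@[simp] theorem lift_p (h : IsPoincareRep D f x s s') (i : Fin n) : lift h (p D i) = x i := by
  simp [lift, p]

@[simp] theorem lift_dil (h : IsPoincareRep D f x s s') : lift h (dil D) = s := by
  simp [lift, dil]

@[simp] theorem lift_dilInv (h : IsPoincareRep D f x s s') : lift h (dilInv D) = s' := by
  simp [lift, dilInv]

variable (D) in
theorem isPoincareRep : IsPoincareRep D (rot D) (p D) (dil D) (dilInv D) where
  dil_mul_inv := by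
    simpa [dil, dilInv] using RingQuot.mkAlgHom_rel k (PoincareRel.dil_mul_inv (D := D))
  dil_inv_mul := by
    simpa [dil, dilInv] using RingQuot.mkAlgHom_rel k (PoincareRel.dil_inv_mul (D := D))
  mom_mom i j := by
    simpa [p] using RingQuot.mkAlgHom_rel k (PoincareRel.mom_mom (D := D) i j)
  lp_mom j i m := by
    simpa [p, rot, Data.braidPlus, Finset.smul_sum, smul_smul, flip21] using
      RingQuot.mkAlgHom_rel k (PoincareRel.lp_mom (D := D) i j m)
  lm_mom j i m := by
    simpa [p, rot, Data.braidMinus, Finset.smul_sum, smul_smul] using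
      RingQuot.mkAlgHom_rel k (PoincareRel.lm_mom (D := D) i j m)
  dil_mom i := by
    simpa [p, dil] using RingQuot.mkAlgHom_rel k (PoincareRel.dil_mom (D := D) i)
  lp_dil i j := by
    simpa [dil, rot, Commute, SemiconjBy] using
      RingQuot.mkAlgHom_rel k (PoincareRel.lp_dil (D := D) i j)
  lm_dil i j := by
    simpa [dil, rot, Commute, SemiconjBy] using
      RingQuot.mkAlgHom_rel k (PoincareRel.lm_dil (D := D) i j)

/-- The generators of the extended `q`-Poincaré algebra. -/
def generators (D : Data k n H) : Set (Poincare D) :=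
  Set.range (rot D) ∪ Set.range (p D) ∪ {dil D, dilInv D}

variable (D) in
theorem adjoin_generators : Algebra.adjoin k (generators D) = ⊤ := by
  have h := congrArg (Subalgebra.map (RingQuot.mkAlgHom k (PoincareRel D)))
    (FreeExt.adjoin_eq_top (k := k) (A := H) (X := PoincareGen n))
  rw [AlgHom.map_adjoin, Algebra.map_top,
    (AlgHom.range_eq_top _).2 (RingQuot.mkAlgHom_surjective k _)] at h
  rw [eq_top_iff, ← h]
  apply Algebra.adjoin_mono
  rintro _ ⟨_, ⟨a, rfl⟩ | ⟨i | _ | _, rfl⟩, rfl⟩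
  · exact Or.inl (Or.inl ⟨a, rfl⟩)
  · exact Or.inl (Or.inr ⟨i, rfl⟩)
  · exact Or.inr (Or.inl rfl)
  · exact Or.inr (Or.inr rfl)

end Poincare

theorem IsPoincareRep.map {F : Type*} [Ring F] [Algebra k F] (h : IsPoincareRep D f x s s')
    (g : E →ₐ[k] F) : IsPoincareRep D (g.comp f) (fun i => g (x i)) (g s) (g s') where
  dil_mul_inv := by rw [← map_mul, h.dil_mul_inv, map_one]
  dil_inv_mul := by rw [← map_mul, h.dil_inv_mul, map_one]
  mom_mom := h.mom_mom.map g
  lp_mom j := (h.lp_mom j).map g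
  lm_mom j := (h.lm_mom j).map g
  dil_mom i := by rw [← map_mul, h.dil_mom, map_smul, map_mul]
  lp_dil i j := (h.lp_dil i j).map g
  lm_dil i j := (h.lm_dil i j).map g

namespace IsPoincareRep

/-- The presentation makes `ς` commute with the `l^±` only; generation of `H` as a Hopf algebra
extends this to all of `H`. -/
theorem commute_dil (h : IsPoincareRep D f x s s') (hD : D.IsRegular) (a : H) :
    Commute (f a) s :=
  hD.commute f s h.lp_dil h.lm_dil a

theorem commute_dilInv (h : IsPoincareRep D f x s s') (hD : D.IsRegular) (a : H) :
    Commute (f a) s' := by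
  have : Commute (f a) (⟨s, s', h.dil_mul_inv, h.dil_inv_mul⟩ : Eˣ) := h.commute_dil hD a
  exact this.units_inv_right

theorem mom_dilInv (h : IsPoincareRep D f x s s') (i : Fin n) :
    x i * s' = D.lam⁻¹ • (s' * x i) := by
  calc x i * s' = s' * (s * x i) * s' := by rw [← mul_assoc, h.dil_inv_mul, one_mul]
    _ = _ := by
      rw [h.dil_mom, mul_smul_comm, smul_mul_assoc, mul_assoc, mul_assoc, h.dil_mul_inv, mul_one]

theorem mom_dil (h : IsPoincareRep D f x s s') (hD : D.IsRegular) (i : Fin n) :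
    x i * s = D.lam • (s * x i) := by
  rw [h.dil_mom, smul_smul, mul_inv_cancel₀ hD.lam_ne_zero, one_smul]

/-- The role of the dilaton: its `lam⁻¹` cancels the `lam` from `l⁻`, leaving the matrix `R` for
which braided addition works. -/
theorem dil_lm_mom (h : IsPoincareRep D f x s s') (hD : D.IsRegular) (j : Fin n) :
    BraidRel D.R (fun i => s * f (D.lm i j)) x := by
  have := (h.lm_mom j).mul_left h.dil_mom
  rwa [Data.braidMinus, smul_smul, inv_mul_cancel₀ hD.lam_ne_zero, one_smul] at this

/-- The matrix `ς l⁻`. -/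
theorem matRel_dil_lm {X : Mat2 n k} {l : Matrix (Fin n) (Fin n) H} (h : IsPoincareRep D f x s s')
    (hD : D.IsRegular) (hX : MatRel X l D.lm) :
    MatRel X (l.map f) (Matrix.of fun i j => s * f (D.lm i j)) :=
  (hX.map f).mul_left_right fun _ _ => (h.commute_dil hD _).symm

/-- The coproduct satisfies the relations of the extended `q`-Poincaré algebra. -/
theorem comul {F : Type*} [Ring F] [Algebra k F] {g : H →ₐ[k] F} {y : Fin n → F} {t t' : F}
    (h : IsPoincareRep D f x s s') (h' : IsPoincareRep D g y t t') (hD : D.IsRegular) :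
    IsPoincareRep D ((Algebra.TensorProduct.map f g).comp (Bialgebra.comulAlgHom k H))
      (fun i => x i ⊗ₜ[k] (1 : F) + ∑ a, (s * f (D.lm i a)) ⊗ₜ[k] y a) (s ⊗ₜ t) (s' ⊗ₜ t') := by
  -- With the two commuting inclusions, the image of `p` becomes `L x + G (R y)`, where `G` is the
  -- matrix `ς l⁻` in the first factor.
  let L : E →ₐ[k] E ⊗[k] F := Algebra.TensorProduct.includeLeft
  let R : F →ₐ[k] E ⊗[k] F := Algebra.TensorProduct.includeRight
  have hLR : ∀ a b, Commute (L a) (R b) := fun a b => by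
    simp [L, R, Commute, SemiconjBy]
  have hL := h.map L
  have hR := h'.map R
  let G : Matrix (Fin n) (Fin n) (E ⊗[k] F) := Matrix.of fun i a => L s * L (f (D.lm i a))
  have hGR : ∀ i a b, Commute (G i a) (R b) := fun i a b => (hLR _ _).mul_left (hLR _ _)
  have hx : (fun i => x i ⊗ₜ[k] (1 : F) + ∑ a, (s * f (D.lm i a)) ⊗ₜ[k] y a) =
      (fun i => L (x i)) + G.mulVec fun a => R (y a) := by
    ext i
    simp [L, R, G, Matrix.mulVec, dotProduct]
  have hlp : ∀ j, (fun i => ((Algebra.TensorProduct.map f g).comp (Bialgebra.comulAlgHom k H))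
      (D.lp i j)) = (D.lp.map (L.comp f)).mulVec fun a => R (g (D.lp a j)) := by
    intro j
    ext i
    simp [L, R, Matrix.mulVec, dotProduct, hD.comul_lp]
  have hlm : ∀ j, (fun i => ((Algebra.TensorProduct.map f g).comp (Bialgebra.comulAlgHom k H))
      (D.lm i j)) = (D.lm.map (L.comp f)).mulVec fun a => R (g (D.lm a j)) := by
    intro j
    ext i
    simp [L, R, Matrix.mulVec, dotProduct, hD.comul_lm]
  have hst : s ⊗ₜ[k] t = L s * R t := by simp [L, R]
  rw [hx]
  refine ⟨?_, ?_, ?_, ?_, ?_, ?_, ?_, ?_⟩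
  · simp [h.dil_mul_inv, h'.dil_mul_inv, Algebra.TensorProduct.one_def]
  · simp [h.dil_inv_mul, h'.dil_inv_mul, Algebra.TensorProduct.one_def]
  -- Braided addition: `ς l⁻ ⊗ p` is a quantum plane by covariance, and has statistics `R` with `p ⊗
  -- 1`.
  · refine BraidRel.add_self hD.braidedPair.coaddition_R hL.mom_mom ?_ ?_
    · refine BraidRel.mulVec ?_ hR.mom_mom (fun a j b => (hGR _ _ _).symm) fun i a b => hGR _ _ _
      exact (hL.matRel_dil_lm hD ((matRel_iff _ _ _).2 hD.covariant_minus)).mul_left_left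
        fun i j => ((Commute.refl _).mul_right (hL.commute_dil hD _).symm)
    · exact BraidRel.mulVec_left (fun a => hL.dil_lm_mom hD a) fun a j => (hLR _ _).symm
  -- With `p ⊗ 1` only the first tensor factor of `Δl⁺` matters; with `ς l⁻ ⊗ p` the relation of the
  -- second factor is transported by covariance.
  · intro j
    rw [hlp]
    refine BraidRel.add_right ?_ ?_
    · exact BraidRel.mulVec_left (fun a => hL.lp_mom a) fun a j => (hLR _ _).symm
    · exact BraidRel.mulVec (hL.matRel_dil_lm hD hD.matRel_lp_lm) (hR.lp_mom j)
        (fun a j b => (hGR _ _ _).symm) fun i a b => hLR _ _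
  · intro j
    rw [hlm]
    refine BraidRel.add_right ?_ ?_
    · exact BraidRel.mulVec_left (fun a => hL.lm_mom a) fun a j => (hLR _ _).symm
    · exact BraidRel.mulVec (hL.matRel_dil_lm hD hD.matRel_lm_lm) (hR.lm_mom j)
        (fun a j b => (hGR _ _ _).symm) fun i a b => hLR _ _
  · intro i
    rw [← congrFun hx i]
    simp only [mul_add, add_mul, Finset.mul_sum, Finset.sum_mul,
      Algebra.TensorProduct.tmul_mul_tmul, h.dil_mom, h'.dil_mom, mul_one, one_mul, smul_add,
      Finset.smul_sum, TensorProduct.smul_tmul', TensorProduct.tmul_smul, mul_assoc,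
      (h.commute_dil hD _).eq]
  · intro i j
    rw [congrFun (hlp j) i, hst]
    simp only [Matrix.mulVec, dotProduct]
    refine Commute.sum_left _ _ _ fun a _ => ?_
    exact ((((h.lp_dil i a).map L).mul_right (hLR _ _))).mul_left
      ((hLR _ _).symm.mul_right ((h'.lp_dil a j).map R))
  · intro i j
    rw [congrFun (hlm j) i, hst]
    simp only [Matrix.mulVec, dotProduct]
    refine Commute.sum_left _ _ _ fun a _ => ?_
    exact ((((h.lm_dil i a).map L).mul_right (hLR _ _))).mul_left
      ((hLR _ _).symm.mul_right ((h'.lm_dil a j).map R))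

end IsPoincareRep

theorem BraidRel.zero_right {X : Mat2 n k} {y : Fin n → E} : BraidRel X y 0 := by
  intro i j; simp

/-- The counit satisfies the relations of the extended `q`-Poincaré algebra. -/
theorem isPoincareRep_counit : IsPoincareRep D (Bialgebra.counitAlgHom k H) 0 1 1 where
  dil_mul_inv := one_mul 1
  dil_inv_mul := one_mul 1
  mom_mom := BraidRel.zero_right
  lp_mom _ := BraidRel.zero_right
  lm_mom _ := BraidRel.zero_right
  dil_mom _ := by simp
  lp_dil _ _ := Commute.all _ _
  lm_dil _ _ := Commute.all _ _

/-- The antipode of `H` followed by an algebra map, as an algebra map to the opposite algebra. -/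
def antipodeOp (f : H →ₐ[k] E) : H →ₐ[k] Eᵐᵒᵖ :=
  (AlgHom.op f).comp (HopfAlgebra.antipodeAlgHomOp k H)

@[simp] theorem antipodeOp_apply (f : H →ₐ[k] E) (a : H) :
    antipodeOp f a = MulOpposite.op (f (HopfAlgebra.antipode k a)) := rfl

theorem matAntipode_map_mul (f : H →ₐ[k] E) {M : Matrix (Fin n) (Fin n) H}
    (h : Data.matAntipode k M * M = 1) : (Data.matAntipode k M).map f * M.map f = 1 := by
  rw [← Matrix.map_mul, h, Matrix.map_one _ (map_zero f) (map_one f)]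

theorem mul_matAntipode_map (f : H →ₐ[k] E) {M : Matrix (Fin n) (Fin n) H}
    (h : M * Data.matAntipode k M = 1) : M.map f * (Data.matAntipode k M).map f = 1 := by
  rw [← Matrix.map_mul, h, Matrix.map_one _ (map_zero f) (map_one f)]

namespace IsPoincareRep

theorem invRel_lp (h : IsPoincareRep D f x s s') (hD : D.IsRegular) :
    InvRel D.braidPlus ((Data.matAntipode k D.lp).map f) x :=
  invRel_of_braidRel (G := D.lp.map f) h.lp_mom
    (mul_matAntipode_map f (Data.mul_matAntipode hD.comul_lp hD.counit_lp))
    (matAntipode_map_mul f (Data.matAntipode_mul hD.comul_lp hD.counit_lp))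

theorem invRel_lm (h : IsPoincareRep D f x s s') (hD : D.IsRegular) :
    InvRel D.braidMinus ((Data.matAntipode k D.lm).map f) x :=
  invRel_of_braidRel (G := D.lm.map f) h.lm_mom
    (mul_matAntipode_map f (Data.mul_matAntipode hD.comul_lm hD.counit_lm))
    (matAntipode_map_mul f (Data.matAntipode_mul hD.comul_lm hD.counit_lm))

theorem opMatRel_antipode {X : Mat2 n k} {l : Matrix (Fin n) (Fin n) H}
    (h : IsPoincareRep D f x s s') (hD : D.IsRegular) (hX : MatRel X l D.lm) :
    OpMatRel X ((Data.matAntipode k l).map f)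
      (Matrix.of fun i j => s' * (Data.matAntipode k D.lm).map f i j) :=
  ((Data.matRel_matAntipode hX).map f).mul_left_right fun _ _ => (h.commute_dilInv hD _).symm

/-- The antipode satisfies the relations of the extended `q`-Poincaré algebra. -/
theorem antipode (h : IsPoincareRep D f x s s') (hD : D.IsRegular) :
    IsPoincareRep D (antipodeOp f) (fun i => MulOpposite.op
      (-∑ a, f (HopfAlgebra.antipode k (D.lm i a)) * s' * x a))
      (MulOpposite.op s') (MulOpposite.op s) := by
  -- The inverse of the matrix `ς l⁻`, so that the proposed antipode of `p` is `-G p`.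
  let G : Matrix (Fin n) (Fin n) E :=
    Matrix.of fun i j => s' * (Data.matAntipode k D.lm).map f i j
  have hx : (fun i => MulOpposite.op (-∑ a, f (HopfAlgebra.antipode k (D.lm i a)) * s' * x a)) =
      fun i => -MulOpposite.op (G.mulVec x i) := by
    ext i
    simp only [MulOpposite.op_neg, (h.commute_dilInv hD _).eq]
    rfl
  -- The powers of `lam` cancel as in the coproduct.
  have hG : InvRel D.R G x := by
    have := (h.invRel_lm hD).mul_left h.mom_dilInv
    rwa [Data.braidMinus, smul_smul, inv_mul_cancel₀ hD.lam_ne_zero, one_smul] at this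
  rw [hx]
  refine ⟨?_, ?_, ?_, ?_, ?_, ?_, ?_, ?_⟩
  · rw [← MulOpposite.op_mul, h.dil_mul_inv, MulOpposite.op_one]
  · rw [← MulOpposite.op_mul, h.dil_inv_mul, MulOpposite.op_one]
  · intro i j
    have := congrArg MulOpposite.op (InvRel.mulVec_self hD.braidedPair.exchange' h.mom_mom hG
      ((h.opMatRel_antipode hD ((matRel_iff _ _ _).2 hD.covariant_minus)).mul_left_left
        fun i j => (Commute.refl _).mul_right (h.commute_dilInv hD _).symm) i j)
    simpa only [Finset.op_sum, MulOpposite.op_smul, MulOpposite.op_mul, neg_mul_neg] using this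
  · intro j i m
    have := congrArg (fun a => -MulOpposite.op a)
      ((h.invRel_lp hD).mulVec (h.opMatRel_antipode hD hD.matRel_lp_lm) i j m)
    simp only [Finset.op_sum, MulOpposite.op_smul, MulOpposite.op_mul] at this
    simp only [neg_mul, mul_neg, smul_neg, Finset.sum_neg_distrib]
    exact this
  · intro j i m
    have := congrArg (fun a => -MulOpposite.op a)
      ((h.invRel_lm hD).mulVec (h.opMatRel_antipode hD hD.matRel_lm_lm) i j m)
    simp only [Finset.op_sum, MulOpposite.op_smul, MulOpposite.op_mul] at this
    simp only [neg_mul, mul_neg, smul_neg, Finset.sum_neg_distrib]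
    exact this
  · intro i
    rw [mul_neg, neg_mul, ← MulOpposite.op_mul, ← MulOpposite.op_mul, smul_neg,
      ← MulOpposite.op_smul]
    congr 2
    simp only [Matrix.mulVec, dotProduct, Finset.sum_mul, Finset.mul_sum, Finset.smul_sum, mul_assoc,
      h.mom_dilInv, mul_smul_comm, G, Matrix.of_apply, Matrix.map_apply]
    refine Finset.sum_congr rfl fun a _ => ?_
    rw [← mul_assoc (f _) s', (h.commute_dilInv hD _).eq, mul_assoc]
  · intro i j
    exact (h.commute_dilInv hD _).op
  · intro i j
    exact (h.commute_dilInv hD _).op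

end IsPoincareRep

end Poincare

/-! ### Transport of the Hopf algebra axioms along a map -/

section Transport

variable {k : Type*} [CommRing k] {A B : Type*} [Ring A] [Algebra k A] [Ring B] [Algebra k B]
  {f : A →ₐ[k] B} {ΔA : A →ₐ[k] A ⊗[k] A} {ΔB : B →ₐ[k] B ⊗[k] B}
  {SA : A →ₗ[k] A} {SB : B →ₗ[k] B}

/-- By naturality, coassociativity on the image of `f` is inherited from `A`. With the lemmas that
follow it leaves only the newly adjoined generators to be checked, over `H` and later over the
`q`-Poincaré algebra. -/
theorem coassoc_of_comul_comp (h : ∀ x, ΔB (f x) = Algebra.TensorProduct.map f f (ΔA x)) {x : A}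
    (hx : Algebra.TensorProduct.assoc k k k A A A (Algebra.TensorProduct.map ΔA (.id k A) (ΔA x)) =
      Algebra.TensorProduct.map (.id k A) ΔA (ΔA x)) :
    Algebra.TensorProduct.assoc k k k B B B
      (Algebra.TensorProduct.map ΔB (.id k B) (ΔB (f x))) =
      Algebra.TensorProduct.map (.id k B) ΔB (ΔB (f x)) := by
  have e1 : ∀ t : A ⊗[k] A, Algebra.TensorProduct.assoc k k k B B B
      (Algebra.TensorProduct.map ΔB (.id k B) (Algebra.TensorProduct.map f f t)) =
      Algebra.TensorProduct.map f (Algebra.TensorProduct.map f f)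
        (Algebra.TensorProduct.assoc k k k A A A (Algebra.TensorProduct.map ΔA (.id k A) t)) := by
    intro t
    induction t with
    | zero => simp only [map_zero]
    | add s t hs ht => simp only [map_add, hs, ht]
    | tmul a b =>
      simp only [Algebra.TensorProduct.map_tmul, h, AlgHom.id_apply]
      generalize ΔA a = u
      induction u with
      | zero => simp only [map_zero, TensorProduct.zero_tmul]
      | add s t hs ht => simp only [map_add, TensorProduct.add_tmul, hs, ht]
      | tmul a b => simp
  have e2 : ∀ t : A ⊗[k] A,
      Algebra.TensorProduct.map (.id k B) ΔB (Algebra.TensorProduct.map f f t) =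
      Algebra.TensorProduct.map f (Algebra.TensorProduct.map f f)
        (Algebra.TensorProduct.map (.id k A) ΔA t) := by
    intro t
    induction t with
    | zero => simp only [map_zero]
    | add s t hs ht => simp only [map_add, hs, ht]
    | tmul a b => simp [h]
  rw [h, e1, hx, e2]

theorem map_map_left {f' : A →ₐ[k] k} {g' : B →ₐ[k] k} (h : ∀ x, g' (f x) = f' x) {x : A}
    (h' : ∀ x, ΔB (f x) = Algebra.TensorProduct.map f f (ΔA x))
    (hx : Algebra.TensorProduct.map f' (.id k A) (ΔA x) = 1 ⊗ₜ x) :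
    Algebra.TensorProduct.map g' (.id k B) (ΔB (f x)) = 1 ⊗ₜ f x := by
  have : ∀ t : A ⊗[k] A, Algebra.TensorProduct.map g' (.id k B) (Algebra.TensorProduct.map f f t) =
      Algebra.TensorProduct.map (.id k k) f (Algebra.TensorProduct.map f' (.id k A) t) := by
    intro t
    induction t with
    | zero => simp only [map_zero]
    | add s t hs ht => simp only [map_add, hs, ht]
    | tmul a b => simp [h]
  rw [h', this, hx]
  simp

theorem map_map_right {f' : A →ₐ[k] k} {g' : B →ₐ[k] k} (h : ∀ x, g' (f x) = f' x) {x : A}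
    (h' : ∀ x, ΔB (f x) = Algebra.TensorProduct.map f f (ΔA x))
    (hx : Algebra.TensorProduct.map (.id k A) f' (ΔA x) = x ⊗ₜ 1) :
    Algebra.TensorProduct.map (.id k B) g' (ΔB (f x)) = f x ⊗ₜ 1 := by
  have : ∀ t : A ⊗[k] A, Algebra.TensorProduct.map (.id k B) g' (Algebra.TensorProduct.map f f t) =
      Algebra.TensorProduct.map f (.id k k) (Algebra.TensorProduct.map (.id k A) f' t) := by
    intro t
    induction t with
    | zero => simp only [map_zero]
    | add s t hs ht => simp only [map_add, hs, ht]
    | tmul a b => simp [h]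
  rw [h', this, hx]
  simp

theorem mul_rTensor_comp (h : ∀ x, SB (f x) = f (SA x)) (t : A ⊗[k] A) :
    LinearMap.mul' k B (SB.rTensor B (Algebra.TensorProduct.map f f t)) =
      f (LinearMap.mul' k A (SA.rTensor A t)) := by
  induction t with
  | zero => simp only [map_zero]
  | add s t hs ht => simp only [map_add, hs, ht]
  | tmul a b => simp [h]

theorem mul_lTensor_comp (h : ∀ x, SB (f x) = f (SA x)) (t : A ⊗[k] A) :
    LinearMap.mul' k B (SB.lTensor B (Algebra.TensorProduct.map f f t)) =
      f (LinearMap.mul' k A (SA.lTensor A t)) := by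
  induction t with
  | zero => simp only [map_zero]
  | add s t hs ht => simp only [map_add, hs, ht]
  | tmul a b => simp [h]

end Transport

/-! ### The Hopf algebra structure of the extended `q`-Poincaré algebra. -/

section Poincare

variable {k : Type*} [Field k] {n : ℕ} {H : Type*} [Ring H] [HopfAlgebra k H] {D : Data k n H}
  {E : Type*} [Ring E] [Algebra k E] {f : H →ₐ[k] E} {x : Fin n → E} {s s' : E}

section Sums

variable (f : H →ₐ[k] E) (i j : Fin n)

theorem sum_lm_mul_antipode (hD : D.IsRegular) :
    ∑ a, f (D.lm i a) * f (HopfAlgebra.antipode k (D.lm a j)) = if i = j then 1 else 0 := by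
  rw [← Matrix.one_apply, ← mul_matAntipode_map f
    (Data.mul_matAntipode hD.comul_lm hD.counit_lm), Matrix.mul_apply]
  rfl

theorem sum_antipode_mul_lm (hD : D.IsRegular) :
    ∑ a, f (HopfAlgebra.antipode k (D.lm i a)) * f (D.lm a j) = if i = j then 1 else 0 := by
  rw [← Matrix.one_apply, ← matAntipode_map_mul f
    (Data.matAntipode_mul hD.comul_lm hD.counit_lm), Matrix.mul_apply]
  rfl

theorem sum_lp_mul_antipode (hD : D.IsRegular) :
    ∑ a, f (D.lp i a) * f (HopfAlgebra.antipode k (D.lp a j)) = if i = j then 1 else 0 := by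
  rw [← Matrix.one_apply, ← mul_matAntipode_map f
    (Data.mul_matAntipode hD.comul_lp hD.counit_lp), Matrix.mul_apply]
  rfl

theorem sum_antipode_mul_lp (hD : D.IsRegular) :
    ∑ a, f (HopfAlgebra.antipode k (D.lp i a)) * f (D.lp a j) = if i = j then 1 else 0 := by
  rw [← Matrix.one_apply, ← matAntipode_map_mul f
    (Data.matAntipode_mul hD.comul_lp hD.counit_lp), Matrix.mul_apply]
  rfl

end Sums

theorem assoc_map_comul (a : H) : Algebra.TensorProduct.assoc k k k H H H
    (Algebra.TensorProduct.map (Bialgebra.comulAlgHom k H) (.id k H)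
      (Bialgebra.comulAlgHom k H a)) =
    Algebra.TensorProduct.map (.id k H) (Bialgebra.comulAlgHom k H)
      (Bialgebra.comulAlgHom k H a) := Coalgebra.coassoc_apply a

theorem map_counit_comul (a : H) : Algebra.TensorProduct.map (Bialgebra.counitAlgHom k H) (.id k H)
    (Bialgebra.comulAlgHom k H a) = 1 ⊗ₜ a := Coalgebra.rTensor_counit_comul a

theorem map_comul_counit (a : H) : Algebra.TensorProduct.map (.id k H) (Bialgebra.counitAlgHom k H)
    (Bialgebra.comulAlgHom k H a) = a ⊗ₜ 1 := Coalgebra.lTensor_counit_comul a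

/-- The Hopf algebra structure on an algebra generated by a representation of the relations of the
extended `q`-Poincaré algebra. -/
def IsPoincareRep.hopfStructure (h : IsPoincareRep D f x s s') (hD : D.IsRegular)
    (hgen : Algebra.adjoin k (Set.range f ∪ Set.range x ∪ {s, s'}) = ⊤)
    (Δ : E →ₐ[k] E ⊗[k] E) (ε : E →ₐ[k] k) (S : E →ₐ[k] Eᵐᵒᵖ)
    (Δ_f : ∀ a, Δ (f a) = Algebra.TensorProduct.map f f (Bialgebra.comulAlgHom k H a))
    (Δ_x : ∀ i, Δ (x i) = x i ⊗ₜ[k] 1 + ∑ a, (s * f (D.lm i a)) ⊗ₜ[k] x a)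
    (Δ_s : Δ s = s ⊗ₜ[k] s) (Δ_s' : Δ s' = s' ⊗ₜ[k] s')
    (ε_f : ∀ a, ε (f a) = Coalgebra.counit (R := k) a) (ε_x : ∀ i, ε (x i) = 0)
    (ε_s : ε s = 1) (ε_s' : ε s' = 1)
    (S_f : ∀ a, S (f a) = MulOpposite.op (f (HopfAlgebra.antipode k a)))
    (S_x : ∀ i, S (x i) = MulOpposite.op
      (-∑ a, f (HopfAlgebra.antipode k (D.lm i a)) * s' * x a))
    (S_s : S s = MulOpposite.op s') (S_s' : S s' = MulOpposite.op s) : HopfStructure k E :=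
  have Δ_lm : ∀ i j, Δ (f (D.lm i j)) = ∑ a, f (D.lm i a) ⊗ₜ[k] f (D.lm a j) := fun i j => by
    simp [Δ_f, hD.comul_lm]
  .ofGenerators Δ ε S _ hgen
    (by
      rintro _ ((⟨a, rfl⟩ | ⟨i, rfl⟩) | rfl | rfl)
      · exact coassoc_of_comul_comp Δ_f (assoc_map_comul a)
      · simp only [Δ_x, map_add, map_sum, Algebra.TensorProduct.map_tmul, map_mul, Δ_s,
          Δ_lm, AlgHom.id_apply, map_one, TensorProduct.add_tmul, TensorProduct.sum_tmul,
          Finset.mul_sum, Algebra.TensorProduct.tmul_mul_tmul, TensorProduct.tmul_add,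
          TensorProduct.tmul_sum, Algebra.TensorProduct.assoc_tmul,
          Algebra.TensorProduct.one_def, Finset.sum_add_distrib, add_assoc]
        rw [Finset.sum_comm]
      · simp [Δ_s]
      · simp [Δ_s'])
    (by
      rintro _ ((⟨a, rfl⟩ | ⟨i, rfl⟩) | rfl | rfl)
      · exact map_map_left (f' := Bialgebra.counitAlgHom k H) ε_f Δ_f (map_counit_comul a)
      · simp [Δ_x, ε_x, ε_s, ε_f, hD.counit_lm, TensorProduct.ite_tmul]
      · simp [Δ_s, ε_s]
      · simp [Δ_s', ε_s'])
    (by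
      rintro _ ((⟨a, rfl⟩ | ⟨i, rfl⟩) | rfl | rfl)
      · exact map_map_right (f' := Bialgebra.counitAlgHom k H) ε_f Δ_f (map_comul_counit a)
      · simp [Δ_x, ε_x]
      · simp [Δ_s, ε_s]
      · simp [Δ_s', ε_s'])
    (by
      rintro _ ((⟨a, rfl⟩ | ⟨i, rfl⟩) | rfl | rfl)
      · rw [Δ_f, mul_rTensor_comp (SA := HopfAlgebra.antipode k), ε_f]
        · exact (congrArg f (HopfAlgebra.mul_antipode_rTensor_comul_apply a)).trans
            (AlgHom.commutes _ _)
        · intro a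
          simp [S_f]
      · simp [Δ_x, ε_x, S_x, S_s, S_f]
      · simp [Δ_s, ε_s, S_s, h.dil_inv_mul]
      · simp [Δ_s', ε_s', S_s', h.dil_mul_inv])
    (by
      rintro _ ((⟨a, rfl⟩ | ⟨i, rfl⟩) | rfl | rfl)
      · rw [Δ_f, mul_lTensor_comp (SA := HopfAlgebra.antipode k), ε_f]
        · exact (congrArg f (HopfAlgebra.mul_antipode_lTensor_comul_apply a)).trans
            (AlgHom.commutes _ _)
        · intro a
          simp [S_f]
      -- The product of `ς l⁻` with `S(l⁻) ς⁻¹ p` collapses to `p`, which cancels the term from `p ⊗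
      -- 1`. On the other side the axiom is the very formula for `Sp`.
      · have : ∑ a, ∑ b, s * f (D.lm i a) * (f (HopfAlgebra.antipode k (D.lm a b)) *
            s' * x b) = x i := by
          rw [Finset.sum_comm]
          calc _ = ∑ b, s * (∑ a, f (D.lm i a) * f (HopfAlgebra.antipode k (D.lm a b))) *
                s' * x b := by
                simp only [Finset.mul_sum, Finset.sum_mul, mul_assoc]
            _ = _ := by simp [sum_lm_mul_antipode f _ _ hD, h.dil_mul_inv]
        simp [Δ_x, ε_x, S_x, this, Finset.mul_sum]
      · simp [Δ_s, ε_s, S_s, h.dil_mul_inv]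
      · simp [Δ_s', ε_s', S_s', h.dil_inv_mul])

namespace Poincare

/-- The Hopf algebra structure of the extended `q`-Poincaré algebra. -/
def hopfStructure (hD : D.IsRegular) : HopfStructure k (Poincare D) :=
  (isPoincareRep D).hopfStructure hD (adjoin_generators D)
    (lift ((isPoincareRep D).comul (isPoincareRep D) hD)) (lift isPoincareRep_counit)
    (lift ((isPoincareRep D).antipode hD))
    (lift_rot _) (lift_p _) (lift_dil _) (lift_dilInv _)
    (lift_rot _) (lift_p _) (lift_dil _) (lift_dilInv _)
    (lift_rot _) (lift_p _) (lift_dil _) (lift_dilInv _)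

theorem hopfStructure_antipode (hD : D.IsRegular) (x : Poincare D) :
    (hopfStructure hD).antipode x = (lift ((isPoincareRep D).antipode hD) x).unop := rfl

theorem isPoincareHopf (hD : D.IsRegular) : IsPoincareHopf D (hopfStructure hD) where
  comul_rot := lift_rot ((isPoincareRep D).comul (isPoincareRep D) hD)
  counit_rot := lift_rot isPoincareRep_counit
  antipode_rot a := by rw [hopfStructure_antipode, lift_rot]; rfl
  comul_dil := lift_dil ((isPoincareRep D).comul (isPoincareRep D) hD)
  counit_dil := lift_dil isPoincareRep_counit
  antipode_dil := by rw [hopfStructure_antipode, lift_dil]; rfl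
  comul_p := lift_p ((isPoincareRep D).comul (isPoincareRep D) hD)
  counit_p := lift_p isPoincareRep_counit
  antipode_p i := by
    rw [hopfStructure_antipode, lift_p, MulOpposite.unop_op]
    simp only [lm, hopfStructure_antipode, lift_rot, antipodeOp_apply, MulOpposite.unop_op]

end Poincare

end Poincare

/-! ### The `q`-conformal algebra -/

section Conformal

open MulOpposite (op unop)

variable {k : Type*} [Field k] {n : ℕ} {H : Type*} [Ring H] [HopfAlgebra k H] {D : Data k n H}
  {q : k} {E : Type*} [Ring E] [Algebra k E] {f : H →ₐ[k] E} {x c : Fin n → E} {s s' : E}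

/-- The relations of the `q`-conformal algebra, in an algebra `E` over `H`. -/
structure IsConformalRep (D : Data k n H) (q : k) (f : H →ₐ[k] E) (x : Fin n → E) (s s' : E)
    (c : Fin n → E) : Prop extends IsPoincareRep D f x s s' where
  conf_conf : BraidRel D.R'.transpose (fun i => op (c i)) (fun i => op (c i))
  lp_conf : ∀ i, BraidRel D.braidPlus.transpose (fun j => op (f (D.lp i j))) (fun i => op (c i))
  lm_conf : ∀ i, BraidRel D.braidMinus.transpose (fun j => op (f (D.lm i j))) (fun i => op (c i))
  dil_conf : ∀ i, s * c i = D.lam • (c i * s)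
  mom_conf : ∀ i j, x i * c j - c j * x i =
    (q - q⁻¹)⁻¹ • (f (D.lp i j) * s' - f (D.lm i j) * s)

/-- Read in the opposite algebra, the stated relation moves `c` past `l⁺` with matrix `lam Rᵀ`. The
form with `l⁺` first, parallel to the one for `p`, results from inverting this matrix with
`BraidRel.symm`. -/
theorem braidPlus_op_iff (hD : D.IsRegular) (l c : Fin n → E) :
    BraidRel D.braidPlus.transpose (fun j => op (l j)) (fun i => op (c i)) ↔
      ∀ j m, l j * c m = D.lam • ∑ a, ∑ b, D.R (b, a) (m, j) • (c b * l a) := by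
  have e1 : (D.lam • D.R.transpose) * (D.lam⁻¹ • D.R⁻¹.transpose) = 1 := by
    rw [Matrix.smul_mul, Matrix.mul_smul, smul_smul, mul_inv_cancel₀ hD.lam_ne_zero, one_smul,
      ← Matrix.transpose_mul, hD.braidedPair.inv_mul_cancel, Matrix.transpose_one]
  have e2 : (D.lam⁻¹ • D.R⁻¹.transpose) * (D.lam • D.R.transpose) = 1 := by
    rw [Matrix.smul_mul, Matrix.mul_smul, smul_smul, inv_mul_cancel₀ hD.lam_ne_zero, one_smul,
      ← Matrix.transpose_mul, hD.braidedPair.mul_inv_cancel, Matrix.transpose_one]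
  have e3 : flip21 (D.lam • D.R.transpose) * D.braidPlus.transpose = 1 :=
    (flip21_mul _ _).symm.trans ((congrArg flip21 e1).trans flip21_one)
  have key : BraidRel (D.lam • D.R.transpose) (fun i => op (c i)) (fun j => op (l j)) ↔
      ∀ j m, l j * c m = D.lam • ∑ a, ∑ b, D.R (b, a) (m, j) • (c b * l a) := by
    constructor
    · intro h j m
      have := congrArg unop (h m j)
      simp only [← MulOpposite.op_mul, MulOpposite.unop_op, Finset.unop_sum,
        MulOpposite.unop_smul] at this
      rw [this, Finset.sum_comm]
      simp [Finset.smul_sum, smul_smul]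
    · intro h m j
      have := congrArg op (h j m)
      rw [Finset.sum_comm] at this
      simp only [← MulOpposite.op_mul, this]
      simp [Finset.smul_sum, smul_smul]
  rw [← key]
  exact ⟨fun h => h.symm e3, fun h => h.symm e2⟩

theorem braidMinus_op_iff (hD : D.IsRegular) (l c : Fin n → E) :
    BraidRel D.braidMinus.transpose (fun j => op (l j)) (fun i => op (c i)) ↔
      ∀ j m, l j * c m = D.lam⁻¹ • ∑ a, ∑ b, D.R⁻¹ (a, b) (j, m) • (c b * l a) := by
  have e1 : (D.lam • D.R.transpose) * (D.lam⁻¹ • D.R⁻¹.transpose) = 1 := by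
    rw [Matrix.smul_mul, Matrix.mul_smul, smul_smul, mul_inv_cancel₀ hD.lam_ne_zero, one_smul,
      ← Matrix.transpose_mul, hD.braidedPair.inv_mul_cancel, Matrix.transpose_one]
  have e2 : (D.lam⁻¹ • D.R⁻¹.transpose) * (D.lam • D.R.transpose) = 1 := by
    rw [Matrix.smul_mul, Matrix.mul_smul, smul_smul, inv_mul_cancel₀ hD.lam_ne_zero, one_smul,
      ← Matrix.transpose_mul, hD.braidedPair.mul_inv_cancel, Matrix.transpose_one]
  have e3 : flip21 (D.lam • D.R.transpose) * flip21 (D.lam⁻¹ • D.R⁻¹.transpose) = 1 :=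
    (flip21_mul _ _).symm.trans ((congrArg flip21 e1).trans flip21_one)
  have key : BraidRel (flip21 (D.lam⁻¹ • D.R⁻¹.transpose)) (fun i => op (c i))
      (fun j => op (l j)) ↔
      ∀ j m, l j * c m = D.lam⁻¹ • ∑ a, ∑ b, D.R⁻¹ (a, b) (j, m) • (c b * l a) := by
    constructor
    · intro h j m
      have := congrArg unop (h m j)
      simp only [← MulOpposite.op_mul, MulOpposite.unop_op, Finset.unop_sum,
        MulOpposite.unop_smul] at this
      rw [this, Finset.sum_comm]
      simp [Finset.smul_sum, smul_smul, flip21]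
    · intro h m j
      have := congrArg op (h j m)
      rw [Finset.sum_comm] at this
      simp only [← MulOpposite.op_mul, this]
      simp [Finset.smul_sum, smul_smul, flip21]
  rw [← key]
  exact ⟨fun h => h.symm e2, fun h => h.symm e3⟩

theorem conf_conf_iff (c : Fin n → E) :
    BraidRel D.R'.transpose (fun i => op (c i)) (fun i => op (c i)) ↔
      ∀ i j, c j * c i = ∑ a, ∑ b, D.R' (a, b) (i, j) • (c a * c b) := by
  refine forall₂_congr fun i j => ?_
  rw [← (MulOpposite.op_injective (α := E)).eq_iff]
  simp only [Finset.op_sum, MulOpposite.op_smul, MulOpposite.op_mul, Matrix.transpose_apply]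

namespace Conformal

variable {g : Poincare D →ₐ[k] E}

/-- The universal property of the `q`-conformal algebra. -/
def lift (hD : D.IsRegular) (h : IsConformalRep D q (g.comp (Poincare.rot D))
    (fun i => g (Poincare.p D i)) (g (Poincare.dil D)) (g (Poincare.dilInv D)) c) :
    Conformal D q →ₐ[k] E :=
  RingQuot.liftAlgHom k ⟨FreeExt.lift g c, by
    intro a b hab
    cases hab with
    | conf_conf i j => simpa using (conf_conf_iff _).1 h.conf_conf i j
    | lp_conf i j m =>
      simpa [Poincare.lp] using (braidPlus_op_iff hD _ _).1 (h.lp_conf i) j m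
    | lm_conf i j m =>
      simpa [Poincare.lm] using (braidMinus_op_iff hD _ _).1 (h.lm_conf i) j m
    | dil_conf i => simpa using h.dil_conf i
    | mom_conf i j =>
      have e : g (Poincare.lp D i j * Poincare.dilInv D - Poincare.lm D i j * Poincare.dil D) =
          g (Poincare.lp D i j) * g (Poincare.dilInv D) - g (Poincare.lm D i j) *
            g (Poincare.dil D) :=
        (map_sub g _ _).trans (congrArg₂ _ (map_mul g _ _) (map_mul g _ _))
      simp only [map_sub, map_mul, map_smul, FreeExt.lift_base, FreeExt.lift_gen]
      rw [e]
      exact h.mom_conf i j⟩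

@[simp] theorem lift_ofPoincare (hD : D.IsRegular) (h : IsConformalRep D q
    (g.comp (Poincare.rot D)) (fun i => g (Poincare.p D i)) (g (Poincare.dil D))
    (g (Poincare.dilInv D)) c) (a : Poincare D) : lift hD h (ofPoincare D q a) = g a := by
  simp [lift, ofPoincare]

@[simp] theorem lift_c (hD : D.IsRegular) (h : IsConformalRep D q
    (g.comp (Poincare.rot D)) (fun i => g (Poincare.p D i)) (g (Poincare.dil D))
    (g (Poincare.dilInv D)) c) (i : Fin n) : lift hD h (Conformal.c D q i) = c i := by
  simp [lift, Conformal.c]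

variable (q) in
theorem isConformalRep (hD : D.IsRegular) : IsConformalRep D q
    ((ofPoincare D q).comp (Poincare.rot D)) (fun i => ofPoincare D q (Poincare.p D i))
    (ofPoincare D q (Poincare.dil D)) (ofPoincare D q (Poincare.dilInv D))
    (Conformal.c D q) where
  toIsPoincareRep := (Poincare.isPoincareRep D).map (F := Conformal D q) (ofPoincare D q)
  conf_conf := (conf_conf_iff _).2 fun i j => by
    simpa [Conformal.c] using RingQuot.mkAlgHom_rel k (ConformalRel.conf_conf (D := D) (q := q) i j)
  lp_conf i := (braidPlus_op_iff hD _ _).2 fun j m => by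
    simpa [Conformal.c, ofPoincare, Poincare.lp] using
      RingQuot.mkAlgHom_rel k (ConformalRel.lp_conf (D := D) (q := q) i j m)
  lm_conf i := (braidMinus_op_iff hD _ _).2 fun j m => by
    simpa [Conformal.c, ofPoincare, Poincare.lm] using
      RingQuot.mkAlgHom_rel k (ConformalRel.lm_conf (D := D) (q := q) i j m)
  dil_conf i := by
    simpa [Conformal.c, ofPoincare] using
      RingQuot.mkAlgHom_rel k (ConformalRel.dil_conf (D := D) (q := q) i)
  mom_conf i j := by
    have e : ofPoincare D q
        (Poincare.lp D i j * Poincare.dilInv D - Poincare.lm D i j * Poincare.dil D) =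
        ofPoincare D q (Poincare.lp D i j) * ofPoincare D q (Poincare.dilInv D) -
          ofPoincare D q (Poincare.lm D i j) * ofPoincare D q (Poincare.dil D) :=
      (map_sub (ofPoincare D q) _ _).trans (congrArg₂ _ (map_mul _ _ _) (map_mul _ _ _))
    have h := RingQuot.mkAlgHom_rel k (ConformalRel.mom_conf (D := D) (q := q) i j)
    simp only [map_sub, map_mul, map_smul] at h
    exact h.trans (congrArg _ e)

variable (D q) in
theorem adjoin_generators :
    Algebra.adjoin k (Set.range (ofPoincare D q) ∪ Set.range (Conformal.c D q)) = ⊤ := by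
  have h := congrArg (Subalgebra.map (RingQuot.mkAlgHom k (ConformalRel D q)))
    (FreeExt.adjoin_eq_top (k := k) (A := Poincare D) (X := Fin n))
  rw [AlgHom.map_adjoin, Algebra.map_top,
    (AlgHom.range_eq_top _).2 (RingQuot.mkAlgHom_surjective k _)] at h
  rw [eq_top_iff, ← h]
  apply Algebra.adjoin_mono
  rintro _ ⟨_, ⟨a, rfl⟩ | ⟨i, rfl⟩, rfl⟩
  · exact Or.inl ⟨a, rfl⟩
  · exact Or.inr ⟨i, rfl⟩

end Conformal

end Conformal

/-! ### Coproduct and counit on the relations of the `q`-conformal algebra. -/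

section Conformal

open MulOpposite (op unop)

variable {k : Type*} [Field k] {n : ℕ} {H : Type*} [Ring H] [HopfAlgebra k H] {D : Data k n H}
  {q : k} {E : Type*} [Ring E] [Algebra k E] {f : H →ₐ[k] E} {x c : Fin n → E} {s s' : E}

theorem BraidRel.op_map {F : Type*} [Ring F] [Algebra k F] {X : Mat2 n k} {y x : Fin n → E}
    (h : BraidRel X (fun i => op (y i)) (fun i => op (x i))) (g : E →ₐ[k] F) :
    BraidRel X (fun i => op (g (y i))) (fun i => op (g (x i))) :=
  h.map (AlgHom.op g)

/-- A row times `X` against `Y` times a column: the mechanism by which `R` and `R⁻¹` cancel in `[Δp,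
Δc]`. -/
theorem sum_smul_mul_sum_smul {X Y : Mat2 n k} (hXY : X * Y = 1) (α β : Fin n × Fin n → E) :
    ∑ p, (∑ q, X q p • α q) * (∑ r, Y p r • β r) = ∑ p, α p * β p := by
  have h1 : ∀ p, ∑ q, X q p • α q = Matrix.vecMul α (X.map (algebraMap k E)) p := fun p => by
    simp only [Matrix.vecMul, dotProduct, Matrix.map_apply, Algebra.smul_def, Algebra.commutes]
  have h2 : ∀ p, ∑ r, Y p r • β r = (Y.map (algebraMap k E)).mulVec β p := fun p => by
    simp only [Matrix.mulVec, dotProduct, Matrix.map_apply, Algebra.smul_def]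
  simp only [h1, h2]
  change Matrix.vecMul α _ ⬝ᵥ Matrix.mulVec _ β = α ⬝ᵥ β
  rw [Matrix.dotProduct_mulVec, Matrix.vecMul_vecMul, ← map_algebraMap_mul, hXY,
    map_algebraMap_one, Matrix.vecMul_one]

theorem sum_smul_sum_smul {X Y : Mat2 n k} (hXY : X * Y = 1) (β : Fin n × Fin n → E)
    (p : Fin n × Fin n) : ∑ q, X p q • ∑ r, Y q r • β r = β p := by
  have h2 : ∀ (X : Mat2 n k) (β : Fin n × Fin n → E) p,
      ∑ r, X p r • β r = (X.map (algebraMap k E)).mulVec β p := fun X β p => by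
    simp only [Matrix.mulVec, dotProduct, Matrix.map_apply, Algebra.smul_def]
  simp only [h2]
  rw [Matrix.mulVec_mulVec, ← map_algebraMap_mul, hXY, map_algebraMap_one, Matrix.one_mulVec]

theorem IsConformalRep.map {F : Type*} [Ring F] [Algebra k F] (h : IsConformalRep D q f x s s' c)
    (g : E →ₐ[k] F) :
    IsConformalRep D q (g.comp f) (fun i => g (x i)) (g s) (g s') (fun i => g (c i)) where
  toIsPoincareRep := h.toIsPoincareRep.map g
  conf_conf := h.conf_conf.op_map g
  lp_conf i := (h.lp_conf i).op_map g
  lm_conf i := (h.lm_conf i).op_map g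
  dil_conf i := by rw [← map_mul, h.dil_conf, map_smul, map_mul]
  mom_conf i j := by
    rw [← map_mul, ← map_mul, ← map_sub, h.mom_conf, map_smul, map_sub, map_mul, map_mul]; rfl

theorem opT_map_opMul (G K : Matrix (Fin n) (Fin n) E) : opT G * opT K = opT (K * G) := by
  ext i j
  simp [opT, Matrix.mul_apply, Finset.op_sum]

theorem opT_one : opT (1 : Matrix (Fin n) (Fin n) E) = 1 := by
  ext i j
  simp [opT, Matrix.one_apply, apply_ite op, eq_comm]

namespace IsConformalRep

theorem conf_dil (h : IsConformalRep D q f x s s' c) (hD : D.IsRegular) (i : Fin n) :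
    c i * s = D.lam⁻¹ • (s * c i) := by
  rw [h.dil_conf, smul_smul, inv_mul_cancel₀ hD.lam_ne_zero, one_smul]

theorem conf_dilInv (h : IsConformalRep D q f x s s' c) (i : Fin n) :
    c i * s' = D.lam • (s' * c i) := by
  calc c i * s' = s' * (s * c i) * s' := by rw [← mul_assoc, h.dil_inv_mul, one_mul]
    _ = _ := by
      rw [h.dil_conf, mul_smul_comm, smul_mul_assoc, mul_assoc, mul_assoc, h.dil_mul_inv, mul_one]

/-- The counterpart of `dil_lm_mom`: the powers of `lam` cancel, and the statistics matrix of the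
`c`'s in the opposite algebra is the transpose of `R₂₁⁻¹`. -/
theorem dilInv_lp_conf (h : IsConformalRep D q f x s s' c) (hD : D.IsRegular) (i : Fin n) :
    BraidRel (flip21 D.R⁻¹).transpose (fun j => op s' * op (f (D.lp i j)))
      (fun i => op (c i)) := by
  have := (h.lp_conf i).mul_left (g := op s') (μ := D.lam) fun j => by
    rw [← MulOpposite.op_mul, h.conf_dilInv]; rfl
  rwa [Data.braidPlus, Matrix.transpose_smul, smul_smul, mul_inv_cancel₀ hD.lam_ne_zero,
    one_smul] at this

theorem matRel_dilInv_lp {X : Mat2 n k} {l : Matrix (Fin n) (Fin n) H}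
    (h : IsConformalRep D q f x s s' c) (hD : D.IsRegular) (hX : MatRel X l D.lp) :
    MatRel X.transpose (opT (l.map f))
      (Matrix.of fun i j => op s' * opT (D.lp.map f) i j) :=
  (hX.map f).opT.mul_left_right fun _ _ => (h.commute_dilInv hD _).symm.op

/-- The `R` produced here, in the first tensor factor, is to cancel the `R⁻¹` that
`lp_dilInv_mul_mom` produces in the second. -/
theorem conf_mul_dil_lm (h : IsConformalRep D q f x s s' c) (hD : D.IsRegular) (i a b : Fin n) :
    c b * (s * f (D.lm i a)) =
      ∑ p : Fin n × Fin n, D.R p (a, b) • (s * f (D.lm i p.1) * c p.2) := by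
  have := congrArg unop (h.lm_conf i a b)
  simp only [← MulOpposite.op_mul, MulOpposite.unop_op, Finset.unop_sum,
    MulOpposite.unop_smul] at this
  rw [← mul_assoc, h.conf_dil hD, smul_mul_assoc, mul_assoc, this, Fintype.sum_prod_type]
  simp only [Finset.mul_sum, Finset.smul_sum, mul_smul_comm, smul_smul, Data.braidMinus,
    Matrix.transpose_apply, Matrix.smul_apply, smul_eq_mul, mul_assoc]
  simp only [← mul_assoc D.lam⁻¹, inv_mul_cancel₀ hD.lam_ne_zero, one_mul]

end IsConformalRep

theorem IsPoincareRep.lp_dilInv_mul_mom (h : IsPoincareRep D f x s s') (hD : D.IsRegular)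
    (b j a : Fin n) : f (D.lp b j) * s' * x a =
      ∑ p : Fin n × Fin n, D.R⁻¹ (a, b) p • (x p.1 * (f (D.lp p.2 j) * s')) := by
  have e : s' * x a = D.lam • (x a * s') := by
    rw [h.mom_dilInv, smul_smul, mul_inv_cancel₀ hD.lam_ne_zero, one_smul]
  rw [mul_assoc, e, mul_smul_comm, ← mul_assoc, h.lp_mom j b a, Fintype.sum_prod_type,
    Finset.sum_comm]
  simp only [Finset.sum_mul, Finset.smul_sum, smul_mul_assoc, smul_smul, Data.braidPlus,
    Matrix.smul_apply, smul_eq_mul, mul_assoc, flip21]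
  simp only [← mul_assoc D.lam, mul_inv_cancel₀ hD.lam_ne_zero, one_mul]

namespace IsConformalRep

/-- The coproduct satisfies the relations of the `q`-conformal algebra. -/
theorem comul {F : Type*} [Ring F] [Algebra k F] {g : H →ₐ[k] F} {y d : Fin n → F} {t t' : F}
    (h : IsConformalRep D q f x s s' c) (h' : IsConformalRep D q g y t t' d) (hD : D.IsRegular) :
    IsConformalRep D q ((Algebra.TensorProduct.map f g).comp (Bialgebra.comulAlgHom k H))
      (fun i => x i ⊗ₜ[k] (1 : F) + ∑ a, (s * f (D.lm i a)) ⊗ₜ[k] y a) (s ⊗ₜ t) (s' ⊗ₜ t')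
      (fun i => ∑ a, c a ⊗ₜ[k] (g (D.lp a i) * t') + (1 : E) ⊗ₜ[k] d i) := by
  let L : E →ₐ[k] E ⊗[k] F := Algebra.TensorProduct.includeLeft
  let R : F →ₐ[k] E ⊗[k] F := Algebra.TensorProduct.includeRight
  have hLR : ∀ a b, Commute (L a) (R b) := fun a b => by
    simp [L, R, Commute, SemiconjBy]
  have hL := h.map L
  have hR := h'.map R
  let K : Matrix (Fin n) (Fin n) (E ⊗[k] F)ᵐᵒᵖ :=
    Matrix.of fun i a => op (R t') * opT (D.lp.map (R.comp g)) i a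
  have hKL : ∀ i a b, Commute (K i a) (op (L b)) := fun i a b =>
    ((hLR _ _).symm.op).mul_left ((hLR _ _).symm.op)
  have hc : (fun i => op (∑ a, c a ⊗ₜ[k] (g (D.lp a i) * t') + (1 : E) ⊗ₜ[k] d i)) =
      (fun i => op (R (d i))) + K.mulVec fun a => op (L (c a)) := by
    ext i
    rw [add_comm]
    simp [L, R, K, Matrix.mulVec, dotProduct, opT, Finset.op_sum, ← MulOpposite.op_mul]
  have hlp : ∀ i, (fun j => op (((Algebra.TensorProduct.map f g).comp (Bialgebra.comulAlgHom k H))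
      (D.lp i j))) = (opT (D.lp.map (R.comp g))).mulVec fun a => op (L (f (D.lp i a))) := by
    intro j
    ext i
    simp [L, R, Matrix.mulVec, dotProduct, hD.comul_lp, opT, Finset.op_sum, ← MulOpposite.op_mul]
  have hlm : ∀ i, (fun j => op (((Algebra.TensorProduct.map f g).comp (Bialgebra.comulAlgHom k H))
      (D.lm i j))) = (opT (D.lm.map (R.comp g))).mulVec fun a => op (L (f (D.lm i a))) := by
    intro j
    ext i
    simp [L, R, Matrix.mulVec, dotProduct, hD.comul_lm, opT, Finset.op_sum, ← MulOpposite.op_mul]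
  refine ⟨h.toIsPoincareRep.comul h'.toIsPoincareRep hD, ?_, ?_, ?_, ?_, ?_⟩
  -- Braided addition again, in the opposite algebra: `1 ⊗ c` plays the part of the first plane and
  -- `c ⊗ l⁺ς⁻¹` that of the second.
  · rw [hc]
    refine BraidRel.add_self hD.braidedPair.coaddition_transpose hR.conf_conf ?_ ?_
    · refine BraidRel.mulVec ?_ hL.conf_conf (fun a j b => (hKL _ _ _).symm)
        fun i a b => hKL _ _ _
      exact (hR.matRel_dilInv_lp hD ((matRel_iff _ _ _).2 hD.covariant_plus)).mul_left_left
        fun i j => ((Commute.refl _).mul_right (hR.commute_dilInv hD _).symm.op)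
    · exact BraidRel.mulVec_left (fun a => hR.dilInv_lp_conf hD a) fun a j => (hLR _ _).op
  · intro i
    rw [hc, hlp]
    refine BraidRel.add_right ?_ ?_
    · exact BraidRel.mulVec_left (fun a => hR.lp_conf a) fun a j => (hLR _ _).op
    · exact BraidRel.mulVec (hR.matRel_dilInv_lp hD hD.matRel_lp_lp) (hL.lp_conf i)
        (fun a j b => (hKL _ _ _).symm) fun i a b => (hLR _ _).symm.op
  · intro i
    rw [hc, hlm]
    refine BraidRel.add_right ?_ ?_
    · exact BraidRel.mulVec_left (fun a => hR.lm_conf a) fun a j => (hLR _ _).op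
    · exact BraidRel.mulVec (hR.matRel_dilInv_lp hD hD.matRel_lm_lp) (hL.lm_conf i)
        (fun a j b => (hKL _ _ _).symm) fun i a b => (hLR _ _).symm.op
  · intro i
    have e : ∀ a, t * (g (D.lp a i) * t') = g (D.lp a i) * t' * t := fun a => by
      rw [← mul_assoc, (h'.commute_dil hD _).symm.eq, mul_assoc, mul_assoc, h'.dil_mul_inv,
        h'.dil_inv_mul]
    simp only [mul_add, add_mul, Finset.mul_sum, Finset.sum_mul,
      Algebra.TensorProduct.tmul_mul_tmul, h.dil_conf, h'.dil_conf, mul_one, one_mul, smul_add,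
      Finset.smul_sum, ← TensorProduct.smul_tmul', TensorProduct.tmul_smul, e]
  · intro i j
    let G : Fin n → E ⊗[k] F := fun a => L (s * f (D.lm i a))
    let M : Fin n → E ⊗[k] F := fun a => R (g (D.lp a j) * t')
    have e1 : x i ⊗ₜ[k] (1 : F) + ∑ a, (s * f (D.lm i a)) ⊗ₜ[k] y a =
        L (x i) + ∑ a, G a * R (y a) := by
      simp [L, R, G]
    have e2 : ∑ a, c a ⊗ₜ[k] (g (D.lp a j) * t') + (1 : E) ⊗ₜ[k] d j =
        ∑ b, L (c b) * M b + R (d j) := by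
      simp [L, R, M]
    -- The sums of `ς l⁻ ⊗ p` and of `c ⊗ l⁺ς⁻¹` commute: reordering costs `R` in one factor and
    -- `R⁻¹` in the other.
    have e3 : ∑ p : Fin n × Fin n, G p.1 * L (c p.2) * (R (y p.1) * M p.2) =
        ∑ p : Fin n × Fin n, L (c p.2) * G p.1 * (M p.2 * R (y p.1)) := by
      have g1 : ∀ p : Fin n × Fin n, L (c p.2) * G p.1 =
          ∑ p' : Fin n × Fin n, D.R p' p • (G p'.1 * L (c p'.2)) := fun p => by
        simp only [G, ← map_mul, ← map_smul, ← map_sum]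
        exact congrArg L (h.conf_mul_dil_lm hD i p.1 p.2)
      have g2 : ∀ p : Fin n × Fin n, M p.2 * R (y p.1) =
          ∑ p' : Fin n × Fin n, D.R⁻¹ p p' • (R (y p'.1) * M p'.2) := fun p => by
        simp only [M, ← map_mul, ← map_smul, ← map_sum]
        exact congrArg R (h'.lp_dilInv_mul_mom hD p.2 j p.1)
      simp only [g1, g2]
      exact (sum_smul_mul_sum_smul hD.braidedPair.mul_inv_cancel _ _).symm
    have e4 : ∑ a, ∑ b, (G a * R (y a)) * (L (c b) * M b) =
        ∑ b, ∑ a, (L (c b) * M b) * (G a * R (y a)) := by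
      rw [Finset.sum_comm (γ := Fin n) (f := fun b a => (L (c b) * M b) * (G a * R (y a)))]
      simp only [Fintype.sum_prod_type] at e3
      refine Eq.trans ?_ (e3.trans ?_) <;>
      refine Finset.sum_congr rfl fun a _ => Finset.sum_congr rfl fun b _ => ?_
      · rw [mul_assoc, mul_assoc, ← mul_assoc (R _), (hLR (c b) (y a)).symm.eq, mul_assoc]
      · rw [mul_assoc, mul_assoc, ← mul_assoc (G a), (hLR _ _ : Commute (G a) (M b)).eq, mul_assoc]
    have e5 : L (x i) * ∑ b, L (c b) * M b - (∑ b, L (c b) * M b) * L (x i) =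
        (q - q⁻¹)⁻¹ • ∑ b, L (f (D.lp i b) * s' - f (D.lm i b) * s) * M b := by
      simp only [Finset.mul_sum, Finset.sum_mul, Finset.smul_sum, ← Finset.sum_sub_distrib]
      refine Finset.sum_congr rfl fun b _ => ?_
      rw [mul_assoc, ← (hLR (x i) _ : Commute (L (x i)) (M b)).eq, ← mul_assoc, ← mul_assoc,
        ← sub_mul, ← map_mul, ← map_mul, ← map_sub, h.mom_conf, map_smul, smul_mul_assoc]
    have e6 : (∑ a, G a * R (y a)) * R (d j) - R (d j) * ∑ a, G a * R (y a) =
        (q - q⁻¹)⁻¹ • ∑ a, G a * R (g (D.lp a j) * t' - g (D.lm a j) * t) := by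
      simp only [Finset.mul_sum, Finset.sum_mul, Finset.smul_sum, ← Finset.sum_sub_distrib]
      refine Finset.sum_congr rfl fun a _ => ?_
      rw [mul_assoc, ← mul_assoc (R _), ← (hLR _ (d j) : Commute (G a) (R (d j))).eq, mul_assoc,
        ← mul_sub, ← map_mul, ← map_mul, ← map_sub, h'.mom_conf, map_smul, mul_smul_comm]
    have e7 : (x i ⊗ₜ[k] (1 : F) + ∑ a, (s * f (D.lm i a)) ⊗ₜ[k] y a) *
        (∑ a, c a ⊗ₜ[k] (g (D.lp a j) * t') + (1 : E) ⊗ₜ[k] d j) -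
        (∑ a, c a ⊗ₜ[k] (g (D.lp a j) * t') + (1 : E) ⊗ₜ[k] d j) *
        (x i ⊗ₜ[k] (1 : F) + ∑ a, (s * f (D.lm i a)) ⊗ₜ[k] y a) =
        (L (x i) * ∑ b, L (c b) * M b - (∑ b, L (c b) * M b) * L (x i)) +
        ((∑ a, G a * R (y a)) * R (d j) - R (d j) * ∑ a, G a * R (y a)) := by
      rw [e1, e2]
      have e4' : (∑ a, G a * R (y a)) * (∑ b, L (c b) * M b) =
          (∑ b, L (c b) * M b) * ∑ a, G a * R (y a) := by
        rw [Finset.sum_mul_sum, Finset.sum_mul_sum, e4]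
      rw [add_mul, add_mul, mul_add, mul_add, mul_add, mul_add, e4', (hLR (x i) (d j)).eq]
      abel
    -- The surviving commutators give `(l⁺ς⁻¹ - l⁻ς) ⊗ l⁺ς⁻¹ + ς l⁻ ⊗ (l⁺ς⁻¹ - l⁻ς)`; the mixed
    -- terms cancel, leaving `Δ(l⁺ς⁻¹) - Δ(l⁻ς)`.
    rw [e7, e5, e6, ← smul_add, ← Finset.sum_add_distrib]
    congr 1
    simp only [AlgHom.comp_apply, Bialgebra.comulAlgHom_apply, hD.comul_lp, hD.comul_lm, map_sum,
      Algebra.TensorProduct.map_tmul, Finset.sum_mul, ← Finset.sum_sub_distrib]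
    refine Finset.sum_congr rfl fun b _ => ?_
    simp only [L, R, G, M, Algebra.TensorProduct.includeLeft_apply,
      Algebra.TensorProduct.includeRight_apply, Algebra.TensorProduct.tmul_mul_tmul, mul_one,
      one_mul, TensorProduct.sub_tmul, TensorProduct.tmul_sub, sub_mul, mul_sub,
      (h.commute_dil hD _).eq]
    abel

/-- The counit satisfies the relations of the `q`-conformal algebra. -/
theorem _root_.QConformal.isConformalRep_counit (hD : D.IsRegular) :
    IsConformalRep D q (Bialgebra.counitAlgHom k H) 0 1 1 0 where
  toIsPoincareRep := isPoincareRep_counit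
  conf_conf := BraidRel.zero_right
  lp_conf _ := BraidRel.zero_right
  lm_conf _ := BraidRel.zero_right
  dil_conf _ := by simp
  mom_conf _ _ := by simp [hD.counit_lp, hD.counit_lm]

end IsConformalRep

end Conformal

/-! ### The antipode on the relations of the `q`-conformal algebra. -/

section Conformal

open MulOpposite (op unop)

variable {k : Type*} [Field k] {n : ℕ} {H : Type*} [Ring H] [HopfAlgebra k H] {D : Data k n H}
  {q : k} {E : Type*} [Ring E] [Algebra k E] {f : H →ₐ[k] E} {x c : Fin n → E} {s s' : E}

theorem OpMatRel.smul {X : Mat2 n k} {G K : Matrix (Fin n) (Fin n) E} (h : OpMatRel X G K) (r : k) :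
    OpMatRel (r • X) G K := by
  intro i j c d
  simpa only [Finset.smul_sum, smul_smul, Matrix.smul_apply, smul_eq_mul] using
    congrArg (r • ·) (h i j c d)

theorem BraidRel.op_op {X : Mat2 n k} {y x : Fin n → E} (h : BraidRel X y x) :
    BraidRel X (fun i => op (op (y i))) (fun i => op (op (x i))) := by
  intro i j
  have := congrArg (fun a => op (op a)) (h i j)
  simpa only [Finset.op_sum, MulOpposite.op_smul, MulOpposite.op_mul] using this

namespace IsConformalRep

theorem invRel_lp_op (h : IsConformalRep D q f x s s' c) (hD : D.IsRegular) :
    InvRel D.braidPlus.transpose (opT ((Data.matAntipode k D.lp).map f)) (fun i => op (c i)) :=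
  invRel_of_braidRel (G := opT (D.lp.map f)) h.lp_conf
    (by rw [opT_map_opMul, matAntipode_map_mul f (Data.matAntipode_mul hD.comul_lp hD.counit_lp),
      opT_one])
    (by rw [opT_map_opMul, mul_matAntipode_map f (Data.mul_matAntipode hD.comul_lp hD.counit_lp),
      opT_one])

theorem invRel_lm_op (h : IsConformalRep D q f x s s' c) (hD : D.IsRegular) :
    InvRel D.braidMinus.transpose (opT ((Data.matAntipode k D.lm).map f)) (fun i => op (c i)) :=
  invRel_of_braidRel (G := opT (D.lm.map f)) h.lm_conf
    (by rw [opT_map_opMul, matAntipode_map_mul f (Data.matAntipode_mul hD.comul_lm hD.counit_lm),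
      opT_one])
    (by rw [opT_map_opMul, mul_matAntipode_map f (Data.mul_matAntipode hD.comul_lm hD.counit_lm),
      opT_one])

theorem opMatRel_antipode_op {X : Mat2 n k} {l : Matrix (Fin n) (Fin n) H}
    (h : IsConformalRep D q f x s s' c) (hD : D.IsRegular) (hX : MatRel X l D.lp) :
    OpMatRel X.transpose (opT ((Data.matAntipode k l).map f))
      (Matrix.of fun i j => op s * opT ((Data.matAntipode k D.lp).map f) i j) :=
  ((Data.matRel_matAntipode hX).map f).opT.mul_left_right
    fun _ _ => (h.commute_dil hD _).symm.op

/-- `(S l⁻)₁ ς⁻¹ c₂` in terms of `c₂ (S l⁻)₁ ς⁻¹`. -/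
theorem antipode_lm_mul_conf (h : IsConformalRep D q f x s s' c) (hD : D.IsRegular)
    (i a b : Fin n) : s' * f (HopfAlgebra.antipode k (D.lm i a)) * c b =
      ∑ i', ∑ e, D.R (i, e) (i', b) • (c e * (s' * f (HopfAlgebra.antipode k (D.lm i' a)))) := by
  have := congrArg unop (h.invRel_lm_op hD a i b)
  simp only [opT, Matrix.of_apply, ← MulOpposite.op_mul, MulOpposite.unop_op, Finset.unop_sum,
    MulOpposite.unop_smul, Data.matAntipode, Matrix.map_apply] at this
  have e : ∀ e, s' * c e = D.lam⁻¹ • (c e * s') := fun e => by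
    rw [h.conf_dilInv, smul_smul, inv_mul_cancel₀ hD.lam_ne_zero, one_smul]
  rw [mul_assoc, this]
  simp only [Finset.mul_sum, mul_smul_comm, Data.braidMinus, Matrix.transpose_apply,
    Matrix.smul_apply, smul_eq_mul, ← mul_assoc, e, smul_mul_assoc, smul_smul]
  simp only [mul_right_comm D.lam, mul_inv_cancel₀ hD.lam_ne_zero, one_mul]

/-- With `G = ς⁻¹S(l⁻)` and `K = ς S(l⁺)`, the antipodes are `-Gp` and `-cK`. Splitting off `G [p,
c] K`, the rest `G c p K - cK Gp` vanishes, again because an `R` meets an `R⁻¹`. -/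
theorem antipode_mom_conf (h : IsConformalRep D q f x s s' c) (hD : D.IsRegular) (i j : Fin n) :
    op (-∑ a, f (HopfAlgebra.antipode k (D.lm i a)) * s' * x a) *
        op (-∑ a, c a * s * f (HopfAlgebra.antipode k (D.lp a j))) -
      op (-∑ a, c a * s * f (HopfAlgebra.antipode k (D.lp a j))) *
        op (-∑ a, f (HopfAlgebra.antipode k (D.lm i a)) * s' * x a) =
      (q - q⁻¹)⁻¹ • (antipodeOp f (D.lp i j) * op s - antipodeOp f (D.lm i j) * op s') := by
  let G : Matrix (Fin n) (Fin n) E :=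
    Matrix.of fun i j => s' * (Data.matAntipode k D.lm).map f i j
  let K : Matrix (Fin n) (Fin n) E :=
    Matrix.of fun i j => s * (Data.matAntipode k D.lp).map f i j
  have hx : ∑ a, f (HopfAlgebra.antipode k (D.lm i a)) * s' * x a = G.mulVec x i := by
    simp only [(h.commute_dilInv hD _).eq]
    rfl
  have hc : ∑ a, c a * s * f (HopfAlgebra.antipode k (D.lp a j)) = ∑ b, c b * K b j := by
    simp only [mul_assoc]
    rfl
  have hK : InvRel (flip21 D.R⁻¹) K x := by
    have := (h.invRel_lp hD).mul_left (h.mom_dil hD)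
    rwa [Data.braidPlus, smul_smul, mul_inv_cancel₀ hD.lam_ne_zero, one_smul] at this
  have hX : OpMatRel (flip21 D.R⁻¹) K G := by
    have := ((h.opMatRel_antipode hD hD.matRel_lp_lm).smul D.lam).mul_left_left (g := s)
      fun i j => Commute.mul_right
        (show s * s' = s' * s by rw [h.dil_mul_inv, h.dil_inv_mul]) (h.commute_dil hD _).symm
    rwa [Data.braidPlus, smul_smul, mul_inv_cancel₀ hD.lam_ne_zero, one_smul] at this
  have hw : ∀ p : Fin n × Fin n, G.mulVec x p.1 * K p.2 j =
      ∑ r : Fin n × Fin n, D.R⁻¹ p r • (K r.2 j * G.mulVec x r.1) := fun p => by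
    rw [hK.mulVec hX, Fintype.sum_prod_type, Finset.sum_comm]
    rfl
  -- Moving `c` to the left past `G` gives `R`; moving `Gp` to the right past `K` gives `R⁻¹`.
  have hcross : ∑ b, ∑ a, G i a * c b * x a * K b j = ∑ e, c e * K e j * G.mulVec x i := by
    calc ∑ b, ∑ a, G i a * c b * x a * K b j =
        ∑ b, ∑ a, ∑ f, ∑ e, D.R (i, e) (f, b) • (c e * (G f a * x a) * K b j) := by
          refine Finset.sum_congr rfl fun b _ => Finset.sum_congr rfl fun a _ => ?_
          have : G i a * c b = ∑ f, ∑ e, D.R (i, e) (f, b) • (c e * G f a) :=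
            h.antipode_lm_mul_conf hD i a b
          simp only [this, Finset.sum_mul, smul_mul_assoc, mul_assoc]
      _ = ∑ b, ∑ f, ∑ e, D.R (i, e) (f, b) • (c e * G.mulVec x f * K b j) := by
          refine Finset.sum_congr rfl fun b _ => ?_
          rw [Finset.sum_comm]
          refine Finset.sum_congr rfl fun f _ => ?_
          rw [Finset.sum_comm]
          simp only [Matrix.mulVec, dotProduct, Finset.mul_sum, Finset.sum_mul, Finset.smul_sum]
      _ = ∑ e, c e * ∑ p : Fin n × Fin n, D.R (i, e) p • (G.mulVec x p.1 * K p.2 j) := by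
          simp only [Fintype.sum_prod_type, Finset.mul_sum, mul_smul_comm, mul_assoc]
          rw [Finset.sum_comm]
          simp only [Finset.sum_comm (f := fun b e => D.R (i, e) (_, b) • _)]
          rw [Finset.sum_comm]
      _ = _ := by
          simp only [hw, sum_smul_sum_smul hD.braidedPair.mul_inv_cancel, mul_assoc]
  -- In each of the two terms one of `S(l⁻)`, `S(l⁺)` meets its inverse. The order of the terms is
  -- reversed, which the reversed product in the opposite algebra compensates.
  have hcomm : ∑ a, ∑ b, G i a * (f (D.lp a b) * s' - f (D.lm a b) * s) * K b j =
      s' * f (HopfAlgebra.antipode k (D.lm i j)) - s * f (HopfAlgebra.antipode k (D.lp i j)) := by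
    have h1 : ∑ a, ∑ b, G i a * (f (D.lp a b) * s') * K b j =
        s' * f (HopfAlgebra.antipode k (D.lm i j)) := by
      calc _ = ∑ a, s' * f (HopfAlgebra.antipode k (D.lm i a)) *
            ∑ b, f (D.lp a b) * f (HopfAlgebra.antipode k (D.lp b j)) := by
            refine Finset.sum_congr rfl fun a _ => ?_
            rw [Finset.mul_sum]
            refine Finset.sum_congr rfl fun b _ => ?_
            change s' * f _ * (f (D.lp a b) * s') * (s * f _) = _
            rw [mul_assoc, mul_assoc (f (D.lp a b)), ← mul_assoc s' s, h.dil_inv_mul, one_mul]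
            rfl
        _ = _ := by simp [sum_lp_mul_antipode f _ _ hD]
    have h2 : ∑ a, ∑ b, G i a * (f (D.lm a b) * s) * K b j =
        s * f (HopfAlgebra.antipode k (D.lp i j)) := by
      rw [Finset.sum_comm]
      calc _ = ∑ b, s' * (∑ a, f (HopfAlgebra.antipode k (D.lm i a)) * f (D.lm a b)) * s *
            (s * f (HopfAlgebra.antipode k (D.lp b j))) := by
            refine Finset.sum_congr rfl fun b _ => ?_
            rw [Finset.mul_sum, Finset.sum_mul, Finset.sum_mul]
            refine Finset.sum_congr rfl fun a _ => ?_
            change s' * f _ * (f (D.lm a b) * s) * (s * f _) = _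
            simp only [mul_assoc]
            rfl
        _ = _ := by simp [sum_antipode_mul_lm f _ _ hD, h.dil_inv_mul]
    simp only [mul_sub, sub_mul, Finset.sum_sub_distrib, h1, h2]
  have hmain : G.mulVec x i * ∑ b, c b * K b j - (∑ b, c b * K b j) * G.mulVec x i =
      (q - q⁻¹)⁻¹ • (s' * f (HopfAlgebra.antipode k (D.lm i j)) -
        s * f (HopfAlgebra.antipode k (D.lp i j))) := by
    rw [← hcomm, Finset.sum_mul (s := Finset.univ) (f := fun b => c b * K b j), ← hcross]
    simp only [Matrix.mulVec, dotProduct, Finset.sum_mul_sum, Finset.smul_sum]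
    rw [Finset.sum_comm (γ := Fin n) (f := fun b a => G i a * c b * x a * K b j)]
    simp only [← Finset.sum_sub_distrib]
    refine Finset.sum_congr rfl fun a _ => Finset.sum_congr rfl fun b _ => ?_
    rw [← smul_mul_assoc, ← mul_smul_comm, ← h.mom_conf a b]
    noncomm_ring
  rw [hx, hc, ← MulOpposite.op_mul, ← MulOpposite.op_mul, ← MulOpposite.op_sub, neg_mul_neg,
    neg_mul_neg, ← neg_sub, hmain, antipodeOp_apply, antipodeOp_apply, ← MulOpposite.op_mul,
    ← MulOpposite.op_mul, ← MulOpposite.op_sub, ← MulOpposite.op_smul, ← smul_neg, neg_sub]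

/-- The antipode satisfies the relations of the `q`-conformal algebra. -/
theorem antipode (h : IsConformalRep D q f x s s' c) (hD : D.IsRegular) :
    IsConformalRep D q (antipodeOp f)
      (fun i => op (-∑ a, f (HopfAlgebra.antipode k (D.lm i a)) * s' * x a)) (op s') (op s)
      (fun i => op (-∑ a, c a * s * f (HopfAlgebra.antipode k (D.lp a i)))) := by
  let G : Matrix (Fin n) (Fin n) Eᵐᵒᵖ :=
    Matrix.of fun i j => op s * opT ((Data.matAntipode k D.lp).map f) i j
  have hc : ∀ i, op (-∑ a, c a * s * f (HopfAlgebra.antipode k (D.lp a i))) =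
      -G.mulVec (fun i => op (c i)) i := by
    intro i
    simp only [MulOpposite.op_neg, G, Matrix.mulVec, dotProduct, Finset.op_sum, Matrix.of_apply,
      opT, ← MulOpposite.op_mul, Matrix.map_apply, Data.matAntipode, mul_assoc,
      (h.commute_dil hD _).eq]
  have hG : InvRel (flip21 D.R⁻¹).transpose G (fun i => op (c i)) := by
    have := (h.invRel_lp_op hD).mul_left (g := op s) (μ := D.lam) fun j => by
      rw [← MulOpposite.op_mul, h.dil_conf]; rfl
    rwa [Data.braidPlus, Matrix.transpose_smul, smul_smul, mul_inv_cancel₀ hD.lam_ne_zero,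
      one_smul] at this
  refine ⟨h.toIsPoincareRep.antipode hD, ?_, ?_, ?_, ?_, ?_⟩
  -- The relations of the `c`'s are stated in the opposite of the target algebra; the target being
  -- opposite already, they amount to relations in `E`.
  · refine BraidRel.op_op fun i j => ?_
    have := congrArg unop (InvRel.mulVec_self hD.braidedPair.exchange_transpose h.conf_conf hG
      ((h.opMatRel_antipode_op hD ((matRel_iff _ _ _).2 hD.covariant_plus)).mul_left_left
        fun i j => (Commute.refl _).mul_right (h.commute_dil hD _).symm.op) i j)
    have hc' : ∀ i, -∑ a, c a * s * f (HopfAlgebra.antipode k (D.lp a i)) =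
      -unop (G.mulVec (fun i => op (c i)) i) := fun i => congrArg unop (hc i)
    simp only [hc', neg_mul_neg]
    simpa only [Finset.unop_sum, MulOpposite.unop_smul, MulOpposite.unop_mul] using this
  · intro r
    refine BraidRel.op_op fun i m => ?_
    have := congrArg (fun a => -unop a)
      ((h.invRel_lp_op hD).mulVec (h.opMatRel_antipode_op hD hD.matRel_lp_lp) i r m)
    have hc' : ∀ i, -∑ a, c a * s * f (HopfAlgebra.antipode k (D.lp a i)) =
      -unop (G.mulVec (fun i => op (c i)) i) := fun i => congrArg unop (hc i)
    simp only [hc', neg_mul, mul_neg, smul_neg, Finset.sum_neg_distrib]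
    simp only [Finset.unop_sum, MulOpposite.unop_smul, MulOpposite.unop_mul] at this
    exact this
  · intro r
    refine BraidRel.op_op fun i m => ?_
    have := congrArg (fun a => -unop a)
      ((h.invRel_lm_op hD).mulVec (h.opMatRel_antipode_op hD hD.matRel_lm_lp) i r m)
    have hc' : ∀ i, -∑ a, c a * s * f (HopfAlgebra.antipode k (D.lp a i)) =
      -unop (G.mulVec (fun i => op (c i)) i) := fun i => congrArg unop (hc i)
    simp only [hc', neg_mul, mul_neg, smul_neg, Finset.sum_neg_distrib]
    simp only [Finset.unop_sum, MulOpposite.unop_smul, MulOpposite.unop_mul] at this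
    exact this
  · intro i
    rw [← MulOpposite.op_mul, ← MulOpposite.op_mul, ← MulOpposite.op_smul]
    congr 1
    rw [neg_mul, mul_neg, smul_neg, Finset.sum_mul, Finset.mul_sum, Finset.smul_sum]
    congr 1
    refine Finset.sum_congr rfl fun a _ => ?_
    rw [← mul_assoc s', ← mul_assoc s', ← smul_mul_assoc, ← smul_mul_assoc, ← h.conf_dilInv,
      mul_assoc (c a) s', h.dil_inv_mul, mul_one, mul_assoc, (h.commute_dilInv hD _).eq, mul_assoc,
      ← mul_assoc s, h.dil_mul_inv, one_mul]
  · exact h.antipode_mom_conf hD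

end IsConformalRep

end Conformal

/-! ### The commutation rules of the special conformal generators, as an algebra map -/

section Commutation

variable {k : Type*} [Field k] {n : ℕ} {H : Type*} [Ring H] [HopfAlgebra k H] {D : Data k n H}
  {E : Type*} [Ring E] [Algebra k E] {f : H →ₐ[k] E} {x : Fin n → E} {s s' : E}

/-- The algebra map `h ↦ h₁ ρ(h₂)`. -/
def Data.tau (D : Data k n H) : H →ₐ[k] Matrix (Fin n) (Fin n) H :=
  (matrixEquivTensor (Fin n) k H).symm.toAlgHom.restrictScalars k |>.comp
    ((Algebra.TensorProduct.map (.id k H) D.rho).comp (Bialgebra.comulAlgHom k H))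

theorem Data.tau_apply {M : Matrix (Fin n) (Fin n) H} (i j a b : Fin n)
    (hM : Coalgebra.comul (R := k) (M i j) = ∑ a, M i a ⊗ₜ[k] M a j) :
    D.tau (M i j) a b = ∑ c, D.rho (M c j) a b • M i c := by
  simp [Data.tau, hM, Matrix.sum_apply, Algebra.smul_def, Algebra.commutes]

/-- Block diagonal matrices of algebra maps. -/
def blockHom {A : Type*} [Ring A] [Algebra k A] (σ : A →ₐ[k] Matrix (Fin n) (Fin n) E)
    (f : A →ₐ[k] E) : A →ₐ[k] Matrix (Fin n ⊕ Unit) (Fin n ⊕ Unit) E where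
  toFun a := Matrix.fromBlocks (σ a) 0 0 (Matrix.of fun _ _ => f a)
  map_one' := by
    rw [map_one, map_one, ← Matrix.fromBlocks_one]
    congr 1
  map_mul' a b := by
    rw [Matrix.fromBlocks_multiply, map_mul, map_mul]
    congr 1 <;> ext i j <;> simp [Matrix.mul_apply]
  map_zero' := by
    rw [map_zero, map_zero, ← Matrix.fromBlocks_zero]
    rfl
  map_add' a b := by
    rw [Matrix.fromBlocks_add, map_add, map_add]
    congr 1 <;> ext i j <;> simp
  commutes' r := by
    ext (i | i) (j | j) <;> simp [Matrix.algebraMap_matrix_apply]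

/-- Constant diagonal matrices. -/
def diagHom (k : Type*) [Field k] (n : ℕ) (E : Type*) [Ring E] [Algebra k E] :
    E →ₐ[k] Matrix (Fin n ⊕ Unit) (Fin n ⊕ Unit) E :=
  (Matrix.diagonalAlgHom k).comp (Pi.constAlgHom k (Fin n ⊕ Unit) E)

theorem diagHom_apply (a : E) : diagHom k n E a = Matrix.diagonal fun _ => a := rfl

/-- The matrix whose only nonzero entries are those of the lower left block `r`. -/
def low (r : Fin n → E) : Matrix (Fin n ⊕ Unit) (Fin n ⊕ Unit) E :=
  Matrix.fromBlocks 0 0 (Matrix.of fun _ => r) 0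

/-- Consequently the lower left parts satisfy every quadratic relation among themselves. -/
theorem low_mul_low (r r' : Fin n → E) : low r * low r' = 0 := by
  simp [low, Matrix.fromBlocks_multiply]

theorem low_mul_diagHom (r : Fin n → E) (a : E) :
    low r * diagHom k n E a = low fun m => r m * a := by
  ext (i | i) (j | j) <;> simp [low, diagHom_apply, Matrix.mul_diagonal]

theorem diagHom_mul_low (r : Fin n → E) (a : E) :
    diagHom k n E a * low r = low fun m => a * r m := by
  ext (i | i) (j | j) <;> simp [low, diagHom_apply, Matrix.diagonal_mul]

theorem low_smul (μ : k) (r : Fin n → E) : low (fun m => μ • r m) = μ • low r := by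
  ext (i | i) (j | j) <;> simp [low]

theorem low_sum {ι : Type*} (t : Finset ι) (r : ι → Fin n → E) :
    low (fun m => ∑ a ∈ t, r a m) = ∑ a ∈ t, low (r a) := by
  ext (i | i) (j | j) <;> simp [low, Matrix.sum_apply]

theorem BraidRel.low_low {X : Mat2 n k} (w w' : Fin n → Fin n → E) :
    BraidRel X (fun i => low (w i)) (fun i => low (w' i)) := by
  intro i j
  simp [low_mul_low]

theorem BraidRel.low_diagHom {X : Mat2 n k} {w : Matrix (Fin n) (Fin n) E}
    (h : ∀ m, BraidRel X (fun i => w i m) x) :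
    BraidRel X (fun i => low (w i)) (fun i => diagHom k n E (x i)) := by
  intro i j
  simp only [low_mul_diagHom, diagHom_mul_low]
  simp only [← low_smul, ← low_sum]
  congr 1
  ext m
  exact h m i j

/-- `G₁K₂ = X K₂G₁ Y`, with `Y` kept on the right, where `ρ` will provide it. -/
theorem MatRel.mul_eq {X Y : Mat2 n k} {G K : Matrix (Fin n) (Fin n) E} (h : MatRel X G K)
    (hXY : X * Y = 1) (i m j m' : Fin n) : G i j * K m m' =
      ∑ a, ∑ b, X (i, m) (a, b) • ∑ c, ∑ t, Y (c, t) (j, m') • (K b t * G a c) := by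
  rw [matRel_iff] at h
  have h1 := congrArg (· * Y.map (algebraMap k E)) h
  simp only [Matrix.mul_assoc, ← map_algebraMap_mul, hXY, map_algebraMap_one, Matrix.mul_one] at h1
  have h2 := congrFun (congrFun h1 (i, m)) (j, m')
  rw [leg1_mul_leg2_apply] at h2
  rw [h2, ← Matrix.mul_assoc (leg2 K), Matrix.mul_apply, Fintype.sum_prod_type]
  simp only [Matrix.mul_apply (M := leg2 K * leg1 G), Fintype.sum_prod_type, Matrix.map_apply,
    leg2_mul_leg1_apply, Algebra.smul_def, Algebra.commutes]

/-- `blockHom` on the entries of a matrix with the matrix coproduct. -/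
theorem blockHom_tau_apply {M : Matrix (Fin n) (Fin n) H} (i j : Fin n)
    (hM : Coalgebra.comul (R := k) (M i j) = ∑ a, M i a ⊗ₜ[k] M a j) :
    blockHom (f.mapMatrix.comp D.tau) f (M i j) = ∑ a, diagHom k n E (f (M i a)) *
      Matrix.fromBlocks ((D.rho (M a j)).map (algebraMap k E)) 0 0
        (Matrix.of fun _ _ => if a = j then 1 else 0) := by
  have : f (M i j) = ∑ a, f (M i a) * if a = j then 1 else 0 := by simp
  ext (a | a) (b | b)
  · simp [blockHom, Data.tau_apply _ _ _ _ hM, Matrix.sum_apply, diagHom_apply,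
      Matrix.diagonal_mul, Algebra.smul_def, Algebra.commutes]
  · simp [blockHom, Matrix.sum_apply, diagHom_apply, Matrix.diagonal_mul]
  · simp [blockHom, Matrix.sum_apply, diagHom_apply, Matrix.diagonal_mul]
  · simp [blockHom, Matrix.sum_apply, diagHom_apply, Matrix.diagonal_mul]

/-- By the matrix coproduct, the block matrix of `M i j` is a sum of diagonal matrices with entry `M
i a` times scalar matrices. The latter commute with `diagHom`, so the relation for the columns of
`M` suffices. -/
theorem BraidRel.blockHom_diagHom {X : Mat2 n k} {M : Matrix (Fin n) (Fin n) H}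
    (hM : ∀ i j, Coalgebra.comul (R := k) (M i j) = ∑ a, M i a ⊗ₜ[k] M a j)
    (h : ∀ j, BraidRel X (fun i => f (M i j)) x) (j : Fin n) :
    BraidRel X (fun i => blockHom (f.mapMatrix.comp D.tau) f (M i j))
      (fun i => diagHom k n E (x i)) := by
  have e : (fun i => blockHom (f.mapMatrix.comp D.tau) f (M i j)) =
      (M.map ((diagHom k n E).comp f)).mulVec fun a =>
        Matrix.fromBlocks ((D.rho (M a j)).map (algebraMap k E)) 0 0
          (Matrix.of fun _ _ => if a = j then 1 else 0) := by
    ext1 i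
    rw [blockHom_tau_apply i j (hM i j)]
    rfl
  rw [e]
  refine BraidRel.mulVec_left (fun a => (h a).map (diagHom k n E)) fun a m => ?_
  rw [Commute, SemiconjBy, diagHom_apply]
  ext (b | b) (d | d) <;> simp [Matrix.mul_diagonal, Matrix.diagonal_mul, Algebra.commutes]

/-- Multiplying `low w` by the block matrix of `M` on the right inserts `ρ(M) = Y`, whereas on the
left `M` acts plainly. The relation thus reads `M₁w₂ = X w₂M₁ Y`, which is why `ρ(l^±)` must be
inverse to the braid matrix. -/
theorem BraidRel.blockHom_low {X Y : Mat2 n k} {M : Matrix (Fin n) (Fin n) H}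
    {w : Matrix (Fin n) (Fin n) E}
    (hM : ∀ i j, Coalgebra.comul (R := k) (M i j) = ∑ a, M i a ⊗ₜ[k] M a j)
    (hXY : X * Y = 1) (hY : ∀ i j a b, D.rho (M i j) a b = Y (i, a) (j, b))
    (h : MatRel X (M.map f) w) (j : Fin n) :
    BraidRel X (fun i => blockHom (f.mapMatrix.comp D.tau) f (M i j)) (fun i => low (w i)) := by
  intro i m
  have e1 : blockHom (f.mapMatrix.comp D.tau) f (M i j) * low (w m) =
      low fun m' => f (M i j) * w m m' := by
    ext (b | b) (d | d) <;> simp [blockHom, low, Matrix.mul_apply]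
  have e2 : ∀ a b, low (w b) * blockHom (f.mapMatrix.comp D.tau) f (M a j) =
      low fun m' => ∑ c, ∑ t, Y (c, t) (j, m') • (w b t * f (M a c)) := by
    intro a b
    ext (b | b) (d | d)
    · simp [blockHom, low, Matrix.mul_apply]
    · simp [blockHom, low, Matrix.mul_apply]
    · simp only [blockHom, low, Matrix.mul_apply, AlgHom.coe_mk, RingHom.coe_mk, MonoidHom.coe_mk,
        OneHom.coe_mk, Fintype.sum_sum_type, Matrix.fromBlocks_apply₂₁, Matrix.fromBlocks_apply₁₁,
        Matrix.fromBlocks_apply₂₂, Matrix.zero_apply, zero_mul, Finset.sum_const_zero, add_zero,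
        Matrix.of_apply, AlgHom.comp_apply, AlgHom.mapMatrix_apply, Matrix.map_apply,
        Data.tau_apply _ _ _ _ (hM a j), map_sum, map_smul, Finset.mul_sum, mul_smul_comm, hY]
      rw [Finset.sum_comm]
    · simp [blockHom, low, Matrix.mul_apply]
  simp only [e1, e2]
  simp only [← low_smul, ← low_sum]
  congr 1
  ext m'
  exact h.mul_eq hXY i m j m'

namespace IsPoincareRep

/-- The commutation rules of the generators of the extended `q`-Poincaré algebra with the `c_j`,
with coefficients `g⁺, g⁻` of `l⁺ ς⁻¹` and `l⁻ ς` in the commutator of `p^i` and `c_j`. -/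
theorem commutation (h : IsPoincareRep D f x s s') (hD : D.IsRegular) (μ ν : k) :
    IsPoincareRep D (blockHom (f.mapMatrix.comp D.tau) f)
      (fun i => diagHom k n E (x i) + low (fun j => (μ • s') * f (D.lp i j)) +
        low (fun j => (ν • s) * f (D.lm i j)))
      (Matrix.diagonal (Sum.elim (fun _ => D.lam • s) fun _ => s))
      (Matrix.diagonal (Sum.elim (fun _ => D.lam⁻¹ • s') fun _ => s')) := by
  have hl := hD.lam_ne_zero
  have hp : ∀ m, BraidRel (flip21 D.R⁻¹) (fun i => (μ • s') * f (D.lp i m)) x := fun m => by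
    have := (h.lp_mom m).mul_left (g := μ • s') (μ := D.lam) fun j => by
      rw [smul_mul_assoc, mul_smul_comm, h.mom_dilInv, smul_comm μ, smul_smul,
        mul_inv_cancel₀ hl, one_smul]
    rwa [Data.braidPlus, smul_smul, mul_inv_cancel₀ hl, one_smul] at this
  have hm : ∀ m, BraidRel D.R (fun i => (ν • s) * f (D.lm i m)) x := fun m => by
    have := (h.lm_mom m).mul_left (g := ν • s) (μ := D.lam⁻¹) fun j => by
      rw [smul_mul_assoc, mul_smul_comm, h.dil_mom, smul_comm ν]
    rwa [Data.braidMinus, smul_smul, inv_mul_cancel₀ hl, one_smul] at this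
  have cp : ∀ a, Commute (μ • s') (f a) := fun a => ((h.commute_dilInv hD a).symm).smul_left μ
  have cm : ∀ a, Commute (ν • s) (f a) := fun a => ((h.commute_dil hD a).symm).smul_left ν
  have hYp : D.braidPlus * (D.lam • flip21 D.R) = 1 := by
    rw [Data.braidPlus, Matrix.smul_mul, Matrix.mul_smul, smul_smul, inv_mul_cancel₀ hl, one_smul,
      ← flip21_mul, hD.braidedPair.inv_mul_cancel, flip21_one]
  have hYm : D.braidMinus * (D.lam⁻¹ • D.R⁻¹) = 1 := by
    rw [Data.braidMinus, Matrix.smul_mul, Matrix.mul_smul, smul_smul, mul_inv_cancel₀ hl, one_smul,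
      hD.braidedPair.mul_inv_cancel]
  have hblock : ∀ a, Commute s (f a) → (∀ i j, Commute s (f (D.tau a i j))) →
      Commute (blockHom (f.mapMatrix.comp D.tau) f a)
        (Matrix.diagonal (Sum.elim (fun _ => D.lam • s) fun _ => s)) := by
    intro a ha ha'
    rw [Commute, SemiconjBy]
    ext (b | b) (d | d) <;>
      simp [Matrix.mul_diagonal, Matrix.diagonal_mul, blockHom, ha.eq, (ha' _ _).eq]
  have hs : ∀ a, Commute s (f a) := fun a => (h.commute_dil hD a).symm
  refine ⟨?_, ?_, ?_, ?_, ?_, ?_, ?_, ?_⟩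
  · rw [Matrix.diagonal_mul_diagonal, ← Matrix.diagonal_one]
    congr 1
    ext (i | i) <;> simp [smul_smul, hl, h.dil_mul_inv]
  · rw [Matrix.diagonal_mul_diagonal, ← Matrix.diagonal_one]
    congr 1
    ext (i | i) <;> simp [smul_smul, hl, h.dil_inv_mul]
  -- Two braided additions to `p`: first of the `ς⁻¹l⁺` part, whose statistics with `p` are `R₂₁⁻¹`,
  -- then of the `ς l⁻` part, with statistics `R`.
  · refine BraidRel.add_self (R := D.R) hD.braidedPair.coaddition_R ?_ (.low_low _ _) ?_
    · exact BraidRel.add_self hD.braidedPair.coaddition_R_inv (h.mom_mom.map (diagHom k n E))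
        (.low_low _ _) (.low_diagHom (w := Matrix.of fun i j => (μ • s') * f (D.lp i j)) hp)
    · exact BraidRel.add_right
        (.low_diagHom (w := Matrix.of fun i j => (ν • s) * f (D.lm i j)) hm) (.low_low _ _)
  · intro j
    refine BraidRel.add_right (BraidRel.add_right (.blockHom_diagHom hD.comul_lp h.lp_mom j) ?_) ?_
    · exact BraidRel.blockHom_low (w := Matrix.of fun i j => (μ • s') * f (D.lp i j)) hD.comul_lp hYp
        (fun i j a b => by rw [hD.rho_lp]; rfl)
        ((hD.matRel_lp_lp.map f).mul_left_right fun _ _ => cp _) j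
    · exact BraidRel.blockHom_low (w := Matrix.of fun i j => (ν • s) * f (D.lm i j)) hD.comul_lp hYp
        (fun i j a b => by rw [hD.rho_lp]; rfl)
        ((hD.matRel_lp_lm.map f).mul_left_right fun _ _ => cm _) j
  · intro j
    refine BraidRel.add_right (BraidRel.add_right (.blockHom_diagHom hD.comul_lm h.lm_mom j) ?_) ?_
    · exact BraidRel.blockHom_low (w := Matrix.of fun i j => (μ • s') * f (D.lp i j)) hD.comul_lm hYm
        (fun i j a b => by rw [hD.rho_lm]; rfl)
        ((hD.matRel_lm_lp.map f).mul_left_right fun _ _ => cp _) j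
    · exact BraidRel.blockHom_low (w := Matrix.of fun i j => (ν • s) * f (D.lm i j)) hD.comul_lm hYm
        (fun i j a b => by rw [hD.rho_lm]; rfl)
        ((hD.matRel_lm_lm.map f).mul_left_right fun _ _ => cm _) j
  -- In the lower left block, the factor `lam` in the upper block of `ς` offsets the `lam⁻¹` of the
  -- relation.
  · intro i
    ext (b | b) (d | d)
    · by_cases hbd : b = d
      · simp [Matrix.mul_diagonal, Matrix.diagonal_mul, diagHom_apply, low, hbd, h.dil_mom]
        rw [smul_comm]
      · simp [Matrix.mul_diagonal, Matrix.diagonal_mul, diagHom_apply, low, hbd]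
    · simp [Matrix.mul_diagonal, Matrix.diagonal_mul, diagHom_apply, low]
    · simp [Matrix.mul_diagonal, Matrix.diagonal_mul, diagHom_apply, low, mul_add, add_mul, hl,
        smul_smul, mul_assoc, ← (hs _).eq]
      simp only [← mul_assoc, h.dil_mul_inv, h.dil_inv_mul]
    · simp [Matrix.mul_diagonal, Matrix.diagonal_mul, diagHom_apply, low, h.dil_mom]
  · exact fun i j => hblock _ (hs _) fun _ _ => hs _
  · exact fun i j => hblock _ (hs _) fun _ _ => hs _

end IsPoincareRep

end Commutation

/-! ### The right action of the `q`-conformal algebra on the extended `q`-Poincaré algebra -/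

section Legs3

variable {A : Type*} [Semiring A] {n : ℕ}

theorem on12_mul (X Y : Mat2 n A) : on12 (X * Y) = on12 X * on12 Y := by
  ext ⟨a, b, c⟩ ⟨a', b', c'⟩
  by_cases h : c = c' <;>
    simp [on12, Matrix.mul_apply, Fintype.sum_prod_type, h]

theorem on13_mul (X Y : Mat2 n A) : on13 (X * Y) = on13 X * on13 Y := by
  ext ⟨a, b, c⟩ ⟨a', b', c'⟩
  by_cases h : b = b' <;>
    simp [on13, Matrix.mul_apply, Fintype.sum_prod_type, h, Finset.sum_ite_irrel]

theorem on12_one : on12 (1 : Mat2 n A) = 1 := by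
  ext ⟨a, b, c⟩ ⟨a', b', c'⟩
  simp only [on12, Matrix.one_apply, Prod.mk.injEq, ← ite_and]
  congr 1
  simp only [eq_iff_iff]
  tauto

theorem on13_one : on13 (1 : Mat2 n A) = 1 := by
  ext ⟨a, b, c⟩ ⟨a', b', c'⟩
  simp only [on13, Matrix.one_apply, Prod.mk.injEq, ← ite_and]
  congr 1
  simp only [eq_iff_iff]
  tauto

end Legs3

namespace IsBraidedPair

variable {k : Type*} [Field k] {n : ℕ} {R' R : Mat2 n k}

/-- `mixed_left` multiplied by `(R₁₂R₁₃)⁻¹` on the left and `(R₁₃R₁₂)⁻¹` on the right. -/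
theorem mixed_left_inv (h : IsBraidedPair R' R) :
    on13 R⁻¹ * on12 R⁻¹ * on23 R' = on23 R' * on12 R⁻¹ * on13 R⁻¹ := by
  have a1 : on12 R⁻¹ * on12 R = 1 := by rw [← on12_mul, h.inv_mul_cancel, on12_one]
  have a2 : on12 R * on12 R⁻¹ = 1 := by rw [← on12_mul, h.mul_inv_cancel, on12_one]
  have b1 : on13 R⁻¹ * on13 R = 1 := by rw [← on13_mul, h.inv_mul_cancel, on13_one]
  have b2 : on13 R * on13 R⁻¹ = 1 := by rw [← on13_mul, h.mul_inv_cancel, on13_one]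
  calc on13 R⁻¹ * on12 R⁻¹ * on23 R'
      = on13 R⁻¹ * on12 R⁻¹ * (on23 R' * on13 R * (on12 R * on12 R⁻¹) * on13 R⁻¹) := by
        rw [a2, mul_one, mul_assoc (on23 R'), b2, mul_one]
    _ = on13 R⁻¹ * on12 R⁻¹ * (on23 R' * on13 R * on12 R) * on12 R⁻¹ * on13 R⁻¹ := by
        simp only [mul_assoc]
    _ = on13 R⁻¹ * (on12 R⁻¹ * on12 R) * on13 R * on23 R' * on12 R⁻¹ * on13 R⁻¹ := by
        rw [← h.mixed_left]; simp only [mul_assoc]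
    _ = _ := by rw [a1, mul_one, b1, one_mul]

/-- `R' P` commutes with the action of `l⁺` on two copies of the fundamental representation. -/
theorem commute_plus (h : IsBraidedPair R' R) (u s : Fin n) :
    (Matrix.of fun (p p' : Fin n × Fin n) => ∑ v, R (p.1, v) (p'.1, s) * R (p.2, u) (p'.2, v)) *
      (R' * perm n k) = (R' * perm n k) *
    (Matrix.of fun (p p' : Fin n × Fin n) => ∑ v, R (p.1, v) (p'.1, s) * R (p.2, u) (p'.2, v)) := by
  have e : ∀ a b i j t t', (on23 R * on13 R) (a, b, t) (i, j, t') =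
      ∑ v, R (a, v) (i, t') * R (b, t) (j, v) := by
    intro a b i j t t'
    simp [on23, on13, Matrix.mul_apply, Fintype.sum_prod_type, mul_comm]
  have e' : ∀ a b i j t t', (on13 R * on23 R) (a, b, t) (i, j, t') =
      ∑ v, R (b, v) (j, t') * R (a, t) (i, v) := by
    intro a b i j t t'
    simp [on23, on13, Matrix.mul_apply, Fintype.sum_prod_type, mul_comm]
  rw [← Matrix.mul_assoc]
  ext ⟨a, b⟩ ⟨i, j⟩
  rw [mul_perm_apply]
  -- The third leg carries the indices `u, s` of `l⁺`; the columns `j, i` are swapped on account of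
  -- the factor `P`.
  have := congrFun (congrFun h.mixed_right (a, b, u)) (j, i, s)
  rw [mul_assoc (on12 R'), Matrix.mul_apply, Matrix.mul_apply] at this
  simp only [Fintype.sum_prod_type, on12, mul_ite, ite_mul, mul_zero, zero_mul, e, e',
    Finset.sum_ite_eq, Finset.sum_ite_eq', Finset.mem_univ, if_true] at this
  simp only [Matrix.mul_apply (M := Matrix.of _), Matrix.mul_apply (N := Matrix.of _),
    Matrix.of_apply, Fintype.sum_prod_type, mul_perm_apply, Prod.swap]
  rw [this, Finset.sum_comm]

/-- `R' P` commutes with the action of `l⁻` on two copies of the fundamental representation. -/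
theorem commute_minus (h : IsBraidedPair R' R) (u s : Fin n) :
    (Matrix.of fun (p p' : Fin n × Fin n) =>
        ∑ v, R⁻¹ (v, p.1) (s, p'.1) * R⁻¹ (u, p.2) (v, p'.2)) *
      (R' * perm n k) = (R' * perm n k) *
    (Matrix.of fun (p p' : Fin n × Fin n) =>
        ∑ v, R⁻¹ (v, p.1) (s, p'.1) * R⁻¹ (u, p.2) (v, p'.2)) := by
  have e : ∀ a b i j t t', (on13 R⁻¹ * on12 R⁻¹) (t, a, b) (t', i, j) =
      ∑ v, R⁻¹ (v, a) (t', i) * R⁻¹ (t, b) (v, j) := by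
    intro a b i j t t'
    simp [on12, on13, Matrix.mul_apply, Fintype.sum_prod_type, mul_comm]
  have e' : ∀ a b i j t t', (on12 R⁻¹ * on13 R⁻¹) (t, a, b) (t', i, j) =
      ∑ v, R⁻¹ (v, b) (t', j) * R⁻¹ (t, a) (v, i) := by
    intro a b i j t t'
    simp [on12, on13, Matrix.mul_apply, Fintype.sum_prod_type, mul_comm]
  rw [← Matrix.mul_assoc]
  ext ⟨a, b⟩ ⟨i, j⟩
  rw [mul_perm_apply]
  have := congrFun (congrFun h.mixed_left_inv (u, a, b)) (s, j, i)
  rw [mul_assoc (on23 R'), Matrix.mul_apply, Matrix.mul_apply] at this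
  simp only [Fintype.sum_prod_type, on23, mul_ite, ite_mul, mul_zero, zero_mul, e, e',
    Finset.sum_ite_irrel, Finset.sum_const_zero,
    Finset.sum_ite_eq, Finset.sum_ite_eq', Finset.mem_univ, if_true] at this
  simp only [Matrix.mul_apply (M := Matrix.of _), Matrix.mul_apply (N := Matrix.of _),
    Matrix.of_apply, Fintype.sum_prod_type, mul_perm_apply, Prod.swap]
  rw [this, Finset.sum_comm]

/-- The rows of `1 + RP` are fixed by `R'P`. Such rows are the coefficients of the mixed terms when
two `δ`'s act on a product ending in `p`. -/
theorem one_add_mul (h : IsBraidedPair R' R) :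
    (1 + R * perm n k) * (R' * perm n k) = 1 + R * perm n k := by
  rw [add_mul, one_mul, ← Matrix.mul_assoc, ← add_mul, h.add_exchange, add_mul, perm_mul_perm]

theorem one_add_flip_mul (h : IsBraidedPair R' R) :
    (1 + flip21 R⁻¹ * perm n k) * (R' * perm n k) = 1 + flip21 R⁻¹ * perm n k := by
  rw [add_mul, one_mul, ← Matrix.mul_assoc, ← add_mul, h.add_exchange_flip, add_mul, perm_mul_perm]

end IsBraidedPair

/-! ### Skew derivations, their quadratic relation, and the resulting right module. -/

section SkewDerivation

variable {k : Type*} [Field k] {n : ℕ} {H : Type*} [Ring H] [HopfAlgebra k H] {D : Data k n H}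
  {E : Type*} [Ring E] [Algebra k E] {f : H →ₐ[k] E} {x : Fin n → E} {s s' : E} {μ ν : k}
  {σ : E →ₐ[k] Matrix (Fin n) (Fin n) E} {δ : Fin n → E →ₗ[k] E}

/-- The skew derivations `δ_j` of the extended `q`-Poincaré algebra with
`a c_j = ∑ m, c_m σ(a)_mj + δ_j a`. -/
structure IsSkewDerivation (D : Data k n H) (f : H →ₐ[k] E) (x : Fin n → E) (s s' : E) (μ ν : k)
    (σ : E →ₐ[k] Matrix (Fin n) (Fin n) E) (δ : Fin n → E →ₗ[k] E) : Prop where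
  leibniz : ∀ m y a, δ m (y * a) = ∑ l, δ l y * σ a l m + y * δ m a
  auto_rot : ∀ h, σ (f h) = (D.tau h).map f
  auto_mom : ∀ m, σ (x m) = Matrix.diagonal fun _ => x m
  auto_dil : σ s = Matrix.diagonal fun _ => D.lam • s
  auto_dilInv : σ s' = Matrix.diagonal fun _ => D.lam⁻¹ • s'
  der_rot : ∀ m h, δ m (f h) = 0
  der_dil : ∀ m, δ m s = 0
  der_dilInv : ∀ m, δ m s' = 0
  der_mom : ∀ m j, δ j (x m) = (μ • s') * f (D.lp m j) + (ν • s) * f (D.lm m j)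

namespace IsSkewDerivation

theorem der_one (h : IsSkewDerivation D f x s s' μ ν σ δ) (m : Fin n) : δ m 1 = 0 := by
  rw [← map_one f, h.der_rot]

/-- The second derivatives. -/
def second (δ : Fin n → E →ₗ[k] E) (y : E) : Fin n × Fin n → E := fun p => δ p.2 (δ p.1 y)

/-- The composite of the automorphism `σ` with itself. -/
def autoAuto (σ : E →ₐ[k] Matrix (Fin n) (Fin n) E) : E →ₐ[k] Mat2 n E :=
  (Matrix.compAlgEquiv (Fin n) (Fin n) E k).toAlgHom.comp (σ.mapMatrix.comp σ)

theorem autoAuto_apply (a : E) (p p' : Fin n × Fin n) :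
    autoAuto σ a p p' = σ (σ a p.1 p'.1) p.2 p'.2 := rfl

theorem second_mul (h : IsSkewDerivation D f x s s' μ ν σ δ) (y a : E) :
    second δ (y * a) = Matrix.vecMul (second δ y) (autoAuto σ a) +
      ∑ l, δ l y • (fun p : Fin n × Fin n => δ p.2 (σ a l p.1) + σ (δ p.1 a) l p.2) +
      y • second δ a := by
  ext ⟨i, j⟩
  simp only [second, h.leibniz, map_add, map_sum, Pi.add_apply, Finset.sum_apply, Pi.smul_apply,
    smul_eq_mul, mul_add, Finset.sum_add_distrib, Matrix.vecMul, dotProduct, autoAuto_apply,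
    Fintype.sum_prod_type]
  abel

/-- The three terms of the twofold Leibniz rule are fixed by `Z` for separate reasons: `Z` commutes
past `σσ(a)`, it fixes the mixed terms, and the last term is zero. -/
theorem second_mul_of_commute (h : IsSkewDerivation D f x s s' μ ν σ δ) {Z : Mat2 n E} {y a : E}
    (hy : Matrix.vecMul (second δ y) Z = second δ y) (h1 : Commute (autoAuto σ a) Z)
    (h2 : ∀ l, Matrix.vecMul (fun p : Fin n × Fin n => δ p.2 (σ a l p.1) + σ (δ p.1 a) l p.2) Z =
      fun p : Fin n × Fin n => δ p.2 (σ a l p.1) + σ (δ p.1 a) l p.2)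
    (h3 : second δ a = 0) :
    Matrix.vecMul (second δ (y * a)) Z = second δ (y * a) := by
  rw [h.second_mul, h3, smul_zero, add_zero, Matrix.add_vecMul, Matrix.vecMul_vecMul, h1.eq,
    ← Matrix.vecMul_vecMul, hy, Matrix.sum_vecMul]
  congr 1
  refine Finset.sum_congr rfl fun l _ => ?_
  rw [Matrix.smul_vecMul, h2]

theorem autoAuto_rot (h : IsSkewDerivation D f x s s' μ ν σ δ) {M : Matrix (Fin n) (Fin n) H}
    (hM : ∀ i j, Coalgebra.comul (R := k) (M i j) = ∑ a, M i a ⊗ₜ[k] M a j) (i j : Fin n) :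
    autoAuto σ (f (M i j)) = ∑ u, (Matrix.diagonal fun _ => f (M i u)) *
      (Matrix.of fun (p p' : Fin n × Fin n) =>
        ∑ v, D.rho (M v j) p.1 p'.1 * D.rho (M u v) p.2 p'.2).map (algebraMap k E) := by
  ext ⟨a, b⟩ ⟨c, d⟩
  simp only [autoAuto_apply, h.auto_rot, Matrix.map_apply, Data.tau_apply _ _ _ _ (hM _ _),
    map_sum, map_smul, Matrix.sum_apply, Matrix.smul_apply, Matrix.diagonal_mul, Matrix.of_apply,
    Finset.mul_sum, Finset.smul_sum, smul_smul, map_mul]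
  rw [Finset.sum_comm]
  refine Finset.sum_congr rfl fun u _ => Finset.sum_congr rfl fun v _ => ?_
  rw [Algebra.smul_def, Algebra.commutes, map_mul]

theorem commute_diagonal_map (a : E) (Z : Mat2 n k) :
    Commute (Matrix.diagonal fun _ => a) (Z.map (algebraMap k E)) := by
  rw [Commute, SemiconjBy]
  ext p p'
  simp [Matrix.mul_diagonal, Matrix.diagonal_mul, Algebra.commutes]

theorem commute_autoAuto_rot (h : IsSkewDerivation D f x s s' μ ν σ δ)
    {M : Matrix (Fin n) (Fin n) H} {Z : Mat2 n k}
    (hM : ∀ i j, Coalgebra.comul (R := k) (M i j) = ∑ a, M i a ⊗ₜ[k] M a j) (i j : Fin n)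
    (hZ : ∀ u, Commute (Matrix.of fun (p p' : Fin n × Fin n) =>
      ∑ v, D.rho (M v j) p.1 p'.1 * D.rho (M u v) p.2 p'.2) Z) :
    Commute (autoAuto σ (f (M i j))) (Z.map (algebraMap k E)) := by
  rw [h.autoAuto_rot hM]
  refine Commute.sum_left _ _ _ fun u _ => (commute_diagonal_map _ _).mul_left ?_
  have := congrArg (·.map (algebraMap k E)) (hZ u).eq
  rw [map_algebraMap_mul, map_algebraMap_mul] at this
  exact this

/-- On `l^±` the twofold `σ` is an iterated coproduct with `ρ ⊗ ρ` applied to two factors, and the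
claim becomes a mixed Yang–Baxter equation. `IsRegular.commute` extends it to `H`. -/
theorem commute_autoAuto (h : IsSkewDerivation D f x s s' μ ν σ δ) (hD : D.IsRegular) (a : H) :
    Commute (autoAuto σ (f a)) ((D.R' * perm n k).map (algebraMap k E)) := by
  refine hD.commute ((autoAuto σ).comp f) _ (fun i j => ?_) (fun i j => ?_) a
  · refine h.commute_autoAuto_rot hD.comul_lp i j fun u => ?_
    have : (Matrix.of fun (p p' : Fin n × Fin n) =>
        ∑ v, D.rho (D.lp v j) p.1 p'.1 * D.rho (D.lp u v) p.2 p'.2) = (D.lam * D.lam) •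
        Matrix.of fun (p p' : Fin n × Fin n) =>
          ∑ v, D.R (p.1, v) (p'.1, j) * D.R (p.2, u) (p'.2, v) := by
      ext p p'
      simp only [Matrix.of_apply, hD.rho_lp, Matrix.smul_apply, smul_eq_mul, Finset.mul_sum]
      exact Finset.sum_congr rfl fun _ _ => mul_mul_mul_comm _ _ _ _
    rw [this]
    exact Commute.smul_left (hD.braidedPair.commute_plus u j) _
  · refine h.commute_autoAuto_rot hD.comul_lm i j fun u => ?_
    have : (Matrix.of fun (p p' : Fin n × Fin n) =>
        ∑ v, D.rho (D.lm v j) p.1 p'.1 * D.rho (D.lm u v) p.2 p'.2) = (D.lam⁻¹ * D.lam⁻¹) •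
        Matrix.of fun (p p' : Fin n × Fin n) =>
          ∑ v, D.R⁻¹ (v, p.1) (j, p'.1) * D.R⁻¹ (u, p.2) (v, p'.2) := by
      ext p p'
      simp only [Matrix.of_apply, hD.rho_lm, Matrix.smul_apply, smul_eq_mul, Finset.mul_sum]
      exact Finset.sum_congr rfl fun _ _ => mul_mul_mul_comm _ _ _ _
    rw [this]
    exact Commute.smul_left (hD.braidedPair.commute_minus u j) _

/-- The derivatives of `x m` and their transforms. -/
theorem der_auto_mom (h : IsSkewDerivation D f x s s' μ ν σ δ) (hD : D.IsRegular) (m l : Fin n) :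
    (fun p : Fin n × Fin n => δ p.2 (σ (x m) l p.1) + σ (δ p.1 (x m)) l p.2) =
      ∑ a, (((μ • s') * f (D.lp m a)) •
          (fun p => (1 + D.R * perm n k).map (algebraMap k E) (l, a) p) +
        ((ν • s) * f (D.lm m a)) •
          fun p => (1 + flip21 D.R⁻¹ * perm n k).map (algebraMap k E) (l, a) p) := by
  have hl := hD.lam_ne_zero
  have e1 : ∀ i j, δ j (σ (x m) l i) = ∑ a, ((μ • s') * f (D.lp m a) + (ν • s) * f (D.lm m a)) *
      (if l = i ∧ a = j then 1 else 0) := by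
    intro i j
    rw [h.auto_mom, Matrix.diagonal_apply]
    split_ifs with hi
    · simp [hi, h.der_mom]
    · simp [hi]
  -- The `lam⁻¹` in `σ(ς⁻¹)` cancels the `lam` in `ρ(l⁺)`, leaving a bare `R`.
  have e2 : ∀ i j, σ ((μ • s') * f (D.lp m i)) l j =
      ∑ a, ((μ • s') * f (D.lp m a)) * algebraMap k E (D.R (l, a) (j, i)) := by
    intro i j
    rw [map_mul, map_smul, h.auto_dilInv, h.auto_rot, Matrix.smul_mul, Matrix.smul_apply,
      Matrix.diagonal_mul, Matrix.map_apply, Data.tau_apply _ _ _ _ (hD.comul_lp _ _), map_sum,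
      Finset.mul_sum, Finset.smul_sum]
    refine Finset.sum_congr rfl fun a _ => ?_
    rw [hD.rho_lp, map_smul, smul_mul_smul_comm, ← mul_assoc, inv_mul_cancel₀ hl, one_mul,
      ← Algebra.commutes, ← Algebra.smul_def, smul_mul_assoc, smul_comm]
  have e3 : ∀ i j, σ ((ν • s) * f (D.lm m i)) l j =
      ∑ a, ((ν • s) * f (D.lm m a)) * algebraMap k E (D.R⁻¹ (a, l) (i, j)) := by
    intro i j
    rw [map_mul, map_smul, h.auto_dil, h.auto_rot, Matrix.smul_mul, Matrix.smul_apply,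
      Matrix.diagonal_mul, Matrix.map_apply, Data.tau_apply _ _ _ _ (hD.comul_lm _ _), map_sum,
      Finset.mul_sum, Finset.smul_sum]
    refine Finset.sum_congr rfl fun a _ => ?_
    rw [hD.rho_lm, map_smul, smul_mul_smul_comm, ← mul_assoc, mul_inv_cancel₀ hl, one_mul,
      ← Algebra.commutes, ← Algebra.smul_def, smul_mul_assoc, smul_comm]
  ext ⟨i, j⟩
  rw [Finset.sum_apply]
  simp only [h.der_mom, map_add, Matrix.add_apply, e1, e2, e3, Pi.add_apply, Pi.smul_apply,
    smul_eq_mul, Matrix.map_apply, mul_perm_apply, Prod.swap, flip21, Matrix.one_apply,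
    Prod.mk.injEq, apply_ite (algebraMap k E), map_one, map_zero, ← Finset.sum_add_distrib]
  refine Finset.sum_congr rfl fun a _ => ?_
  rw [mul_add, mul_add, add_mul]
  abel

/-- This is `c₂c₁ = c₁c₂R'` for the operators `δ`, written as invariance of the row of second
derivatives under `R'P`. -/
theorem second_eq (h : IsSkewDerivation D f x s s' μ ν σ δ) (hD : D.IsRegular)
    (hgen : Algebra.adjoin k (Set.range f ∪ Set.range x ∪ {s, s'}) = ⊤) (y : E) :
    Matrix.vecMul (second δ y) ((D.R' * perm n k).map (algebraMap k E)) = second δ y := by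
  set Z := (D.R' * perm n k).map (algebraMap k E) with hZ
  have hrow : ∀ (N : Mat2 n k) (p : Fin n × Fin n), N * (D.R' * perm n k) = N →
      Matrix.vecMul (fun p' => N.map (algebraMap k E) p p') Z =
        fun p' => N.map (algebraMap k E) p p' := by
    intro N p hN
    ext p'
    have := congrFun (congrFun (congrArg (·.map (algebraMap k E)) hN) p) p'
    rw [map_algebraMap_mul] at this
    exact this
  -- Membership of `a` means that right multiplication by `a` preserves the identity, not that the
  -- identity holds at `a`; only the former is evidently closed under products. The result follows
  -- by starting from `y = 1`.
  let B : Subalgebra k E :=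
    { carrier := {a | ∀ y, Matrix.vecMul (second δ y) Z = second δ y →
        Matrix.vecMul (second δ (y * a)) Z = second δ (y * a)}
      mul_mem' := fun {a b} ha hb y hy => by
        rw [← mul_assoc]
        exact hb _ (ha _ hy)
      add_mem' := fun {a b} ha hb y hy => by
        have : second δ (y * (a + b)) = second δ (y * a) + second δ (y * b) := by
          ext p; simp [second, mul_add]
        rw [this, Matrix.add_vecMul, ha _ hy, hb _ hy]
      algebraMap_mem' := fun r y hy => by
        have : second δ (y * algebraMap k E r) = r • second δ y := by
          ext p; simp [second, ← Algebra.commutes, ← Algebra.smul_def]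
        rw [this, Matrix.smul_vecMul, hy] }
  have hB : B = ⊤ := by
    rw [eq_top_iff, ← hgen, Algebra.adjoin_le_iff]
    have hdiag : ∀ (a : E) (r : k), σ a = Matrix.diagonal (fun _ => r • a) →
        Commute (autoAuto σ a) Z := by
      intro a r ha
      have : autoAuto σ a = Matrix.diagonal fun _ => r • r • a := by
        ext ⟨i, j⟩ ⟨i', j'⟩
        rw [autoAuto_apply, ha, Matrix.diagonal_apply, Matrix.diagonal_apply]
        by_cases h1 : i = i' <;> by_cases h2 : j = j' <;> simp [h1, h2, ha]
      rw [this]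
      exact commute_diagonal_map _ _
    have hconst : ∀ (a : E) (r : k), σ a = Matrix.diagonal (fun _ => r • a) → (∀ m, δ m a = 0) →
        a ∈ B := by
      intro a r ha hδ y hy
      refine h.second_mul_of_commute hy (hdiag a r ha) (fun l => ?_) ?_
      · have : (fun p : Fin n × Fin n => δ p.2 (σ a l p.1) + σ (δ p.1 a) l p.2) = 0 := by
          ext p
          rw [ha, Matrix.diagonal_apply, hδ]
          split_ifs <;> simp [hδ]
        rw [this, Matrix.zero_vecMul]
      · ext p; simp [second, hδ]
    rintro _ ((⟨a, rfl⟩ | ⟨m, rfl⟩) | rfl | rfl)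
    · intro y hy
      refine h.second_mul_of_commute hy (h.commute_autoAuto hD a) (fun l => ?_) ?_
      · have : (fun p : Fin n × Fin n => δ p.2 (σ (f a) l p.1) + σ (δ p.1 (f a)) l p.2) = 0 := by
          ext p; simp [h.auto_rot, h.der_rot]
        rw [this, Matrix.zero_vecMul]
      · ext p; simp [second, h.der_rot]
    · intro y hy
      refine h.second_mul_of_commute hy (hdiag (x m) 1 (by simp [h.auto_mom])) (fun l => ?_) ?_
      · rw [h.der_auto_mom hD, Matrix.sum_vecMul]
        refine Finset.sum_congr rfl fun a _ => ?_
        rw [Matrix.add_vecMul, Matrix.smul_vecMul, Matrix.smul_vecMul,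
          hrow _ _ hD.braidedPair.one_add_mul, hrow _ _ hD.braidedPair.one_add_flip_mul]
      · ext p
        simp [second, h.der_mom, h.leibniz, h.der_rot, h.der_dil, h.der_dilInv]
    · exact hconst _ _ h.auto_dil h.der_dil
    · exact hconst _ _ h.auto_dilInv h.der_dilInv
  have hy : y ∈ B := hB ▸ Algebra.mem_top
  have h1 : second δ (1 : E) = 0 := by ext p; simp [second, h.der_one]
  simpa using hy 1 (by rw [h1, Matrix.zero_vecMul])

/-- Right multiplication as an algebra map. -/
def mulRightHom (k E : Type*) [Field k] [Ring E] [Algebra k E] :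
    E →ₐ[k] (Module.End k E)ᵐᵒᵖ where
  toFun a := MulOpposite.op (LinearMap.mulRight k a)
  map_one' := by rw [LinearMap.mulRight_one]; rfl
  map_mul' a b := by rw [LinearMap.mulRight_mul]; rfl
  map_zero' := by rw [LinearMap.mulRight_zero_eq_zero]; rfl
  map_add' a b := by
    rw [← MulOpposite.op_add]
    congr 1
    ext y
    simp [mul_add]
  commutes' r := by
    refine congrArg MulOpposite.op ?_
    ext y
    simp [← Algebra.commutes, ← Algebra.smul_def]

theorem unop_mulRightHom (a y : E) : (mulRightHom k E a).unop y = y * a := rfl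

theorem mulRightHom_injective : Function.Injective (mulRightHom k E) := fun a b hab => by
  have := congrArg (fun g => g.unop 1) hab
  simpa [unop_mulRightHom] using this

/-- The right module: products in the opposite of `Module.End k E` are compositions from left to
right. Relations between a `c` and a generator `a` are the Leibniz rule for `y * a`; relations
between two `c`'s are `second_eq`. -/
theorem isConformalRep (h : IsSkewDerivation D f x s s' μ (-μ) σ δ) (hD : D.IsRegular)
    {q : k} (hμ : (q - q⁻¹)⁻¹ = μ) (hx : IsPoincareRep D f x s s')
    (hgen : Algebra.adjoin k (Set.range f ∪ Set.range x ∪ {s, s'}) = ⊤) :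
    IsConformalRep D q ((mulRightHom k E).comp f) (fun i => mulRightHom k E (x i))
      (mulRightHom k E s) (mulRightHom k E s') (fun j => MulOpposite.op (δ j)) where
  toIsPoincareRep := hx.map (mulRightHom k E)
  conf_conf := (conf_conf_iff _).2 fun j i => by
    apply MulOpposite.unop_injective
    refine LinearMap.ext fun y => ?_
    have := congrFun (h.second_eq hD hgen y) (i, j)
    simp only [second, Matrix.vecMul, dotProduct, Fintype.sum_prod_type, Matrix.map_apply,
      mul_perm_apply, Prod.swap, ← Algebra.commutes, ← Algebra.smul_def] at this
    simp only [MulOpposite.unop_mul, MulOpposite.unop_op, Finset.unop_sum, MulOpposite.unop_smul,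
      Module.End.mul_apply, LinearMap.sum_apply, LinearMap.smul_apply]
    exact this.symm
  lp_conf i := (braidPlus_op_iff hD _ _).2 fun j m => by
    apply MulOpposite.unop_injective
    refine LinearMap.ext fun y => ?_
    simp only [MulOpposite.unop_mul, MulOpposite.unop_op, Finset.unop_sum, MulOpposite.unop_smul,
      Module.End.mul_apply, LinearMap.sum_apply, LinearMap.smul_apply, AlgHom.comp_apply,
      unop_mulRightHom, h.leibniz, h.der_rot, mul_zero, add_zero, h.auto_rot, Matrix.map_apply,
      Data.tau_apply _ _ _ _ (hD.comul_lp _ _), map_sum, map_smul, hD.rho_lp, Finset.mul_sum,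
      Finset.smul_sum, smul_smul, mul_smul_comm]
    rw [Finset.sum_comm]
  lm_conf i := (braidMinus_op_iff hD _ _).2 fun j m => by
    apply MulOpposite.unop_injective
    refine LinearMap.ext fun y => ?_
    simp only [MulOpposite.unop_mul, MulOpposite.unop_op, Finset.unop_sum, MulOpposite.unop_smul,
      Module.End.mul_apply, LinearMap.sum_apply, LinearMap.smul_apply, AlgHom.comp_apply,
      unop_mulRightHom, h.leibniz, h.der_rot, mul_zero, add_zero, h.auto_rot, Matrix.map_apply,
      Data.tau_apply _ _ _ _ (hD.comul_lm _ _), map_sum, map_smul, hD.rho_lm, Finset.mul_sum,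
      Finset.smul_sum, smul_smul, mul_smul_comm]
    rw [Finset.sum_comm]
  dil_conf i := by
    apply MulOpposite.unop_injective
    refine LinearMap.ext fun y => ?_
    simp [unop_mulRightHom, h.leibniz, h.auto_dil, h.der_dil, Matrix.diagonal_apply]
  mom_conf i j := by
    apply MulOpposite.unop_injective
    refine LinearMap.ext fun y => ?_
    simp only [MulOpposite.unop_mul, MulOpposite.unop_op, MulOpposite.unop_sub,
      MulOpposite.unop_smul, Module.End.mul_apply, LinearMap.sub_apply, LinearMap.smul_apply,
      AlgHom.comp_apply, unop_mulRightHom, h.leibniz, h.auto_mom, Matrix.diagonal_apply, mul_ite,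
      mul_zero, Finset.sum_ite_eq', Finset.mem_univ, if_true, add_sub_cancel_left, h.der_mom, hμ,
      mul_assoc, (hx.commute_dilInv hD _).eq, (hx.commute_dil hD _).eq, mul_add, smul_sub,
      smul_mul_assoc, mul_smul_comm, neg_smul]
    rw [neg_mul, mul_neg, smul_mul_assoc, mul_smul_comm, sub_eq_add_neg]

end IsSkewDerivation

end SkewDerivation

/-! ### Injectivity of the map to the `q`-conformal algebra -/

section BlockTriangular

variable {k : Type*} [Field k] {n : ℕ} {H : Type*} [Ring H] [HopfAlgebra k H] {D : Data k n H}
  {E : Type*} [Ring E] [Algebra k E] {f : H →ₐ[k] E} {x : Fin n → E} {s s' : E} {μ ν : k}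
  {Φ : E →ₐ[k] Matrix (Fin n ⊕ Unit) (Fin n ⊕ Unit) E}

/-- Algebra maps to block lower triangular matrices, the last diagonal entry being the argument. -/
def IsBlockTriangular (Φ : E →ₐ[k] Matrix (Fin n ⊕ Unit) (Fin n ⊕ Unit) E) : Prop :=
  ∀ a, (∀ l, Φ a (Sum.inl l) (Sum.inr ()) = 0) ∧ Φ a (Sum.inr ()) (Sum.inr ()) = a

theorem isBlockTriangular_of_adjoin {t : Set E} (ht : Algebra.adjoin k t = ⊤)
    (h : ∀ a ∈ t, (∀ l, Φ a (Sum.inl l) (Sum.inr ()) = 0) ∧ Φ a (Sum.inr ()) (Sum.inr ()) = a) :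
    IsBlockTriangular Φ := by
  intro a
  have ha : a ∈ Algebra.adjoin k t := ht ▸ Algebra.mem_top
  induction ha using Algebra.adjoin_induction with
  | mem a ha => exact h a ha
  | algebraMap r => simp [AlgHom.commutes, Matrix.algebraMap_matrix_apply]
  | add a b _ _ ha hb => simp [ha.1, hb.1, ha.2, hb.2]
  | mul a b _ _ ha hb => simp [Matrix.mul_apply, ha.1, hb.1, ha.2, hb.2]

namespace IsBlockTriangular

/-- The upper left block. -/
def auto (h : IsBlockTriangular Φ) : E →ₐ[k] Matrix (Fin n) (Fin n) E where
  toFun a := (Φ a).toBlocks₁₁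
  map_one' := by ext i j; simp [Matrix.toBlocks₁₁, Matrix.one_apply]
  map_mul' a b := by ext i j; simp [Matrix.toBlocks₁₁, Matrix.mul_apply, (h a).1]
  map_zero' := by ext i j; simp [Matrix.toBlocks₁₁]
  map_add' a b := by ext i j; simp [Matrix.toBlocks₁₁]
  commutes' r := by ext i j; simp [Matrix.toBlocks₁₁, Matrix.algebraMap_matrix_apply]

theorem auto_apply (h : IsBlockTriangular Φ) (a : E) (i j : Fin n) :
    h.auto a i j = Φ a (Sum.inl i) (Sum.inl j) := rfl

/-- The entries of the last row. -/
def der (Φ : E →ₐ[k] Matrix (Fin n ⊕ Unit) (Fin n ⊕ Unit) E) (j : Fin n) : E →ₗ[k] E :=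
  Matrix.entryLinearMap k E (Sum.inr ()) (Sum.inl j) ∘ₗ Φ.toLinearMap

theorem der_apply (a : E) (j : Fin n) : der Φ j a = Φ a (Sum.inr ()) (Sum.inl j) := rfl

/-- Multiplying block triangular matrices, the last row of the product is the twisted Leibniz rule.
-/
theorem isSkewDerivation (h : IsBlockTriangular Φ)
    (hrot : ∀ a, Φ (f a) = blockHom (f.mapMatrix.comp D.tau) f a)
    (hmom : ∀ i, Φ (x i) = diagHom k n E (x i) + low (fun j => (μ • s') * f (D.lp i j)) +
        low (fun j => (ν • s) * f (D.lm i j)))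
    (hdil : Φ s = Matrix.diagonal (Sum.elim (fun _ => D.lam • s) fun _ => s))
    (hdilInv : Φ s' = Matrix.diagonal (Sum.elim (fun _ => D.lam⁻¹ • s') fun _ => s')) :
    IsSkewDerivation D f x s s' μ ν h.auto (der Φ) where
  leibniz m y a := by
    simp [der_apply, auto_apply, Matrix.mul_apply, (h y).2]
  auto_rot a := by
    ext i j
    rw [auto_apply, hrot]
    rfl
  auto_mom m := by
    ext i j
    simp [auto_apply, hmom, low, diagHom_apply, Matrix.diagonal_apply]
  auto_dil := by
    ext i j
    simp [auto_apply, hdil, Matrix.diagonal_apply]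
  auto_dilInv := by
    ext i j
    simp [auto_apply, hdilInv, Matrix.diagonal_apply]
  der_rot m a := by
    rw [der_apply, hrot]
    rfl
  der_dil m := by simp [der_apply, hdil]
  der_dilInv m := by simp [der_apply, hdilInv]
  der_mom m j := by simp [der_apply, hmom, low, diagHom_apply]

end IsBlockTriangular

theorem isBlockTriangular_of_generators
    (hgen : Algebra.adjoin k (Set.range f ∪ Set.range x ∪ {s, s'}) = ⊤)
    (hrot : ∀ a, Φ (f a) = blockHom (f.mapMatrix.comp D.tau) f a)
    (hmom : ∀ i, Φ (x i) = diagHom k n E (x i) + low (fun j => (μ • s') * f (D.lp i j)) +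
        low (fun j => (ν • s) * f (D.lm i j)))
    (hdil : Φ s = Matrix.diagonal (Sum.elim (fun _ => D.lam • s) fun _ => s))
    (hdilInv : Φ s' = Matrix.diagonal (Sum.elim (fun _ => D.lam⁻¹ • s') fun _ => s')) :
    IsBlockTriangular Φ := by
  refine isBlockTriangular_of_adjoin hgen ?_
  rintro _ ((⟨a, rfl⟩ | ⟨m, rfl⟩) | rfl | rfl)
  · rw [hrot]
    exact ⟨fun _ => rfl, rfl⟩
  · simp [hmom, low, diagHom_apply]
  · simp [hdil]
  · simp [hdilInv]

end BlockTriangular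

section Injective

variable {k : Type*} [Field k] {n : ℕ} {H : Type*} [Ring H] [HopfAlgebra k H] (D : Data k n H)

theorem exists_isSkewDerivation {D : Data k n H} {E : Type*} [Ring E] [Algebra k E]
    {f : H →ₐ[k] E} {x : Fin n → E} {s s' : E} (hD : D.IsRegular) (hx : IsPoincareRep D f x s s')
    (hgen : Algebra.adjoin k (Set.range f ∪ Set.range x ∪ {s, s'}) = ⊤)
    (hlift : ∀ (g : H →ₐ[k] Matrix (Fin n ⊕ Unit) (Fin n ⊕ Unit) E) y t t',
      IsPoincareRep D g y t t' → ∃ Φ : E →ₐ[k] Matrix (Fin n ⊕ Unit) (Fin n ⊕ Unit) E,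
        (∀ a, Φ (f a) = g a) ∧ (∀ i, Φ (x i) = y i) ∧ Φ s = t ∧ Φ s' = t') (μ ν : k) :
    ∃ σ δ, IsSkewDerivation D f x s s' μ ν σ δ := by
  obtain ⟨Φ, h1, h2, h3, h4⟩ := hlift _ _ _ _ (hx.commutation hD μ ν)
  exact ⟨_, _, (isBlockTriangular_of_generators hgen h1 h2 h3 h4).isSkewDerivation h1 h2 h3 h4⟩

/-- The skew derivations of the extended `q`-Poincaré algebra. -/
theorem Poincare.exists_isSkewDerivation (hD : D.IsRegular) (μ ν : k) :
    ∃ σ δ, IsSkewDerivation D (rot D) (p D) (dil D) (dilInv D) μ ν σ δ :=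
  QConformal.exists_isSkewDerivation (E := Poincare D) hD (isPoincareRep D) (adjoin_generators D)
    (fun _ _ _ _ h => ⟨lift h, lift_rot h, lift_p h, lift_dil h, lift_dilInv h⟩) μ ν

/-- The action of `Poincare D` on `E` factors through `ofPoincare`, and it is faithful, since the
image of `1` under `a` is `e a`. -/
theorem Conformal.ofPoincare_injective_of_isSkewDerivation {D : Data k n H} {E : Type*} [Ring E]
    [Algebra k E] {f : H →ₐ[k] E} {x : Fin n → E} {s s' : E} (hD : D.IsRegular) {q : k}
    {σ : E →ₐ[k] Matrix (Fin n) (Fin n) E} {δ : Fin n → E →ₗ[k] E}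
    (h : IsSkewDerivation D f x s s' (q - q⁻¹)⁻¹ (-(q - q⁻¹)⁻¹) σ δ)
    (hx : IsPoincareRep D f x s s')
    (hgen : Algebra.adjoin k (Set.range f ∪ Set.range x ∪ {s, s'}) = ⊤)
    (e : Poincare D →ₐ[k] E) (he : Function.Injective e)
    (he_rot : ∀ a, e (Poincare.rot D a) = f a) (he_p : ∀ i, e (Poincare.p D i) = x i)
    (he_dil : e (Poincare.dil D) = s) (he_dilInv : e (Poincare.dilInv D) = s') :
    Function.Injective (ofPoincare D q) := by
  obtain rfl : e.comp (Poincare.rot D) = f := AlgHom.ext he_rot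
  obtain rfl : (fun i => e (Poincare.p D i)) = x := funext he_p
  subst he_dil he_dilInv
  have hc := h.isConformalRep hD rfl hx hgen
  intro a b hab
  apply he
  apply IsSkewDerivation.mulRightHom_injective (k := k)
  have ha := lift_ofPoincare (g := (IsSkewDerivation.mulRightHom k E).comp e) hD hc a
  have hb := lift_ofPoincare (g := (IsSkewDerivation.mulRightHom k E).comp e) hD hc b
  rw [hab] at ha
  exact ha.symm.trans hb

theorem Conformal.ofPoincare_injective (hD : D.IsRegular) (q : k) :
    Function.Injective (ofPoincare D q) := by
  -- The two coefficients are those of `l⁺ς⁻¹` and `l⁻ς` in `[p, c]`.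
  obtain ⟨σ, δ, h⟩ := Poincare.exists_isSkewDerivation D hD (q - q⁻¹)⁻¹ (-(q - q⁻¹)⁻¹)
  exact ofPoincare_injective_of_isSkewDerivation hD h (Poincare.isPoincareRep D)
    (Poincare.adjoin_generators D) (AlgHom.id k (Poincare D)) Function.injective_id (fun _ => rfl)
    (fun _ => rfl) rfl rfl

end Injective

/-! ### The Hopf algebra structure of the `q`-conformal algebra -/

section ConformalHopf

variable {k : Type*} [Field k] {n : ℕ} {H : Type*} [Ring H] [HopfAlgebra k H] {D : Data k n H}
  {q : k} {E : Type*} [Ring E] [Algebra k E] {f : H →ₐ[k] E} {x c : Fin n → E} {s s' : E}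

namespace HopfStructure

variable {A : Type*} [Ring A] [Algebra k A] (SA : HopfStructure k A)

theorem coassoc_apply (a : A) : Algebra.TensorProduct.assoc k k k A A A
    (Algebra.TensorProduct.map SA.comul (.id k A) (SA.comul a)) =
      Algebra.TensorProduct.map (.id k A) SA.comul (SA.comul a) :=
  DFunLike.congr_fun SA.coassoc a

theorem counit_left_apply (a : A) :
    Algebra.TensorProduct.map SA.counit (.id k A) (SA.comul a) = 1 ⊗ₜ a :=
  DFunLike.congr_fun SA.counit_left a

theorem counit_right_apply (a : A) :
    Algebra.TensorProduct.map (.id k A) SA.counit (SA.comul a) = a ⊗ₜ 1 :=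
  DFunLike.congr_fun SA.counit_right a

theorem antipode_left_apply (a : A) :
    LinearMap.mul' k A (SA.antipode.rTensor A (SA.comul a)) = algebraMap k A (SA.counit a) :=
  DFunLike.congr_fun SA.antipode_left a

theorem antipode_right_apply (a : A) :
    LinearMap.mul' k A (SA.antipode.lTensor A (SA.comul a)) = algebraMap k A (SA.counit a) :=
  DFunLike.congr_fun SA.antipode_right a

end HopfStructure

/-- The Hopf algebra structure on an extension of a Hopf algebra `A` by generators `c` with the
coproduct of the special conformal generators. -/
def IsConformalRep.hopfStructure (h : IsConformalRep D q f x s s' c) (hD : D.IsRegular)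
    {A : Type*} [Ring A] [Algebra k A] (SA : HopfStructure k A) (e : A →ₐ[k] E)
    (hgen : Algebra.adjoin k (Set.range e ∪ Set.range c) = ⊤)
    (Δ : E →ₐ[k] E ⊗[k] E) (ε : E →ₐ[k] k) (S : E →ₐ[k] Eᵐᵒᵖ)
    (Δ_e : ∀ a, Δ (e a) = Algebra.TensorProduct.map e e (SA.comul a))
    (ε_e : ∀ a, ε (e a) = SA.counit a) (S_e : ∀ a, S (e a) = MulOpposite.op (e (SA.antipode a)))
    (Δ_f : ∀ a, Δ (f a) = Algebra.TensorProduct.map f f (Bialgebra.comulAlgHom k H a))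
    (Δ_s' : Δ s' = s' ⊗ₜ[k] s')
    (ε_f : ∀ a, ε (f a) = Coalgebra.counit (R := k) a) (ε_s' : ε s' = 1)
    (S_f : ∀ a, S (f a) = MulOpposite.op (f (HopfAlgebra.antipode k a)))
    (S_s' : S s' = MulOpposite.op s)
    (Δ_c : ∀ i, Δ (c i) = ∑ a, c a ⊗ₜ[k] (f (D.lp a i) * s') + 1 ⊗ₜ[k] c i)
    (ε_c : ∀ i, ε (c i) = 0)
    (S_c : ∀ i, S (c i) = MulOpposite.op
      (-∑ a, c a * s * f (HopfAlgebra.antipode k (D.lp a i)))) : HopfStructure k E :=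
  have Δ_lp : ∀ i j, Δ (f (D.lp i j)) = ∑ a, f (D.lp i a) ⊗ₜ[k] f (D.lp a j) := fun i j => by
    simp [Δ_f, hD.comul_lp]
  have S_e' : ∀ a, ((MulOpposite.opLinearEquiv k).symm.toLinearMap ∘ₗ S.toLinearMap) (e a) =
      e (SA.antipode a) := fun a => by simp [S_e]
  .ofGenerators Δ ε S _ hgen
    (by
      rintro _ (⟨a, rfl⟩ | ⟨i, rfl⟩)
      · exact coassoc_of_comul_comp Δ_e (SA.coassoc_apply a)
      · simp only [Δ_c, map_add, map_sum, Algebra.TensorProduct.map_tmul, map_mul, Δ_s',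
          Δ_lp, AlgHom.id_apply, map_one, TensorProduct.add_tmul, TensorProduct.sum_tmul,
          Finset.sum_mul, Algebra.TensorProduct.tmul_mul_tmul, TensorProduct.tmul_add,
          TensorProduct.tmul_sum, Algebra.TensorProduct.assoc_tmul,
          Algebra.TensorProduct.one_def, Finset.sum_add_distrib, ← add_assoc]
        rw [Finset.sum_comm])
    (by
      rintro _ (⟨a, rfl⟩ | ⟨i, rfl⟩)
      · exact map_map_left ε_e Δ_e (SA.counit_left_apply a)
      · simp [Δ_c, ε_c])
    (by
      rintro _ (⟨a, rfl⟩ | ⟨i, rfl⟩)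
      · exact map_map_right ε_e Δ_e (SA.counit_right_apply a)
      · simp [Δ_c, ε_c, ε_s', ε_f, hD.counit_lp, TensorProduct.tmul_ite])
    (by
      rintro _ (⟨a, rfl⟩ | ⟨i, rfl⟩)
      · rw [Δ_e, mul_rTensor_comp S_e', ε_e, SA.antipode_left_apply, AlgHom.commutes]
      -- The factors `ς S(l⁺)` and `l⁺ς⁻¹` collapse, leaving `c`, which cancels the term from `1 ⊗
      -- c`. On the other side the axiom is the formula for `Sc`.
      · have : ∑ a, ∑ b, c b * s * f (HopfAlgebra.antipode k (D.lp b a)) *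
            (f (D.lp a i) * s') = c i := by
          rw [Finset.sum_comm]
          calc _ = ∑ b, c b * s * (∑ a, f (HopfAlgebra.antipode k (D.lp b a)) * f (D.lp a i)) *
                s' := by
                simp only [Finset.mul_sum, Finset.sum_mul, mul_assoc]
            _ = _ := by simp [sum_antipode_mul_lp f _ _ hD, mul_assoc, h.dil_mul_inv]
        simp [Δ_c, ε_c, S_c, this, Finset.sum_mul])
    (by
      rintro _ (⟨a, rfl⟩ | ⟨i, rfl⟩)
      · rw [Δ_e, mul_lTensor_comp S_e', ε_e, SA.antipode_right_apply, AlgHom.commutes]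
      · simp [Δ_c, ε_c, S_c, S_f, S_s', mul_assoc])

theorem IsConformalRep.congr {f' : H →ₐ[k] E} {x' : Fin n → E} {t t' : E}
    (h : IsConformalRep D q f x s s' c) (hf : ∀ a, f' a = f a) (hx : ∀ i, x' i = x i) (hs : t = s)
    (hs' : t' = s') : IsConformalRep D q f' x' t t' c := by
  obtain rfl : f' = f := AlgHom.ext hf
  obtain rfl : x' = x := funext hx
  rwa [hs, hs']

/-- The structure maps of `E` are lifts of those of `A` followed by `e`, so compatibility with `e`
is automatic. Of the universal property, only the targets `E ⊗ E`, `k` and the opposite of `E` are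
needed. -/
theorem IsConformalRep.exists_hopfStructure {A : Type*} [Ring A] [Algebra k A]
    {f : H →ₐ[k] A} {x : Fin n → A} {s s' : A} {e : A →ₐ[k] E}
    (h : IsConformalRep D q (e.comp f) (fun i => e (x i)) (e s) (e s') c) (hD : D.IsRegular)
    (hgen : Algebra.adjoin k (Set.range e ∪ Set.range c) = ⊤)
    (lift_tensor : ∀ (g : A →ₐ[k] E ⊗[k] E) d,
      IsConformalRep D q (g.comp f) (fun i => g (x i)) (g s) (g s') d →
        ∃ G : E →ₐ[k] E ⊗[k] E, (∀ a, G (e a) = g a) ∧ ∀ i, G (c i) = d i)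
    (lift_base : ∀ (g : A →ₐ[k] k) d,
      IsConformalRep D q (g.comp f) (fun i => g (x i)) (g s) (g s') d →
        ∃ G : E →ₐ[k] k, (∀ a, G (e a) = g a) ∧ ∀ i, G (c i) = d i)
    (lift_op : ∀ (g : A →ₐ[k] Eᵐᵒᵖ) d,
      IsConformalRep D q (g.comp f) (fun i => g (x i)) (g s) (g s') d →
        ∃ G : E →ₐ[k] Eᵐᵒᵖ, (∀ a, G (e a) = g a) ∧ ∀ i, G (c i) = d i)
    (SA : HopfStructure k A) (S : A →ₐ[k] Aᵐᵒᵖ) (hS : ∀ a, S a = MulOpposite.op (SA.antipode a))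
    (comul_f : ∀ a, SA.comul (f a) = Algebra.TensorProduct.map f f (Bialgebra.comulAlgHom k H a))
    (comul_x : ∀ i, SA.comul (x i) = x i ⊗ₜ[k] 1 + ∑ a, (s * f (D.lm i a)) ⊗ₜ[k] x a)
    (comul_s : SA.comul s = s ⊗ₜ[k] s) (comul_s' : SA.comul s' = s' ⊗ₜ[k] s')
    (counit_f : ∀ a, SA.counit (f a) = Coalgebra.counit (R := k) a)
    (counit_x : ∀ i, SA.counit (x i) = 0) (counit_s : SA.counit s = 1) (counit_s' : SA.counit s' = 1)
    (S_f : ∀ a, S (f a) = MulOpposite.op (f (HopfAlgebra.antipode k a)))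
    (S_x : ∀ i, S (x i) = MulOpposite.op
      (-∑ a, f (HopfAlgebra.antipode k (D.lm i a)) * s' * x a))
    (S_s : S s = MulOpposite.op s') (S_s' : S s' = MulOpposite.op s) :
    ∃ SC : HopfStructure k E,
      (∀ a, SC.comul (e a) = Algebra.TensorProduct.map e e (SA.comul a)) ∧
      (∀ a, SC.counit (e a) = SA.counit a) ∧
      (∀ a, SC.antipode (e a) = e (SA.antipode a)) ∧
      (∀ i, SC.comul (c i) = ∑ a, c a ⊗ₜ[k] (e (f (D.lp a i)) * e s') + 1 ⊗ₜ[k] c i) ∧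
      (∀ i, SC.counit (c i) = 0) ∧
      (∀ i, SC.antipode (c i) = -∑ a, c a * e s * SC.antipode (e (f (D.lp a i)))) := by
  have map_map : ∀ t : H ⊗[k] H, Algebra.TensorProduct.map e e (Algebra.TensorProduct.map f f t) =
      Algebra.TensorProduct.map (e.comp f) (e.comp f) t := fun t => by
    rw [Algebra.TensorProduct.map_comp]; rfl
  obtain ⟨Δ, Δ_e, Δ_c⟩ := lift_tensor ((Algebra.TensorProduct.map e e).comp SA.comul) _
    ((h.comul h hD).congr (fun a => by simp only [AlgHom.comp_apply, comul_f, map_map])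
      (fun i => by simp [comul_x]) (by simp [comul_s]) (by simp [comul_s']))
  obtain ⟨ε, ε_e, ε_c⟩ := lift_base SA.counit 0
    ((isConformalRep_counit hD).congr counit_f counit_x counit_s counit_s')
  obtain ⟨T, T_e, T_c⟩ := lift_op ((AlgHom.op e).comp S) _
    ((h.antipode hD).congr (fun a => by simp [S_f]) (fun i => by simp [S_x]) (by simp [S_s])
      (by simp [S_s']))
  refine ⟨h.hopfStructure hD SA e hgen Δ ε T Δ_e ε_e (fun a => ?_) (fun a => ?_) ?_ (fun a => ?_)
    ?_ (fun a => ?_) ?_ Δ_c ε_c T_c, Δ_e, ε_e, ?_, Δ_c, ε_c, ?_⟩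
  · simp [T_e, hS]
  · simp only [AlgHom.comp_apply, Δ_e, comul_f, map_map]
  · simp [Δ_e, comul_s']
  · simp [ε_e, counit_f]
  · rw [ε_e, counit_s']
  · simp [T_e, S_f]
  · simp [T_e, S_s']
  · intro a
    change (T (e a)).unop = _
    simp [T_e, hS]
  · intro i
    change (T (c i)).unop = -∑ a, c a * e s * (T (e (f (D.lp a i)))).unop
    simp [T_e, T_c, S_f]

theorem Conformal.exists_lift (hD : D.IsRegular) (g : Poincare D →ₐ[k] E) (d : Fin n → E)
    (h : IsConformalRep D q (g.comp (Poincare.rot D)) (fun i => g (Poincare.p D i))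
      (g (Poincare.dil D)) (g (Poincare.dilInv D)) d) :
    ∃ G : Conformal D q →ₐ[k] E, (∀ a, G (ofPoincare D q a) = g a) ∧
      ∀ i, G (Conformal.c D q i) = d i :=
  ⟨lift hD h, lift_ofPoincare hD h, lift_c hD h⟩

end ConformalHopf

end QConformal

end

open scoped TensorProduct in
open QConformal in
theorem proposition2p1 {k : Type*} [Field k] {n : ℕ} {H : Type*} [Ring H] [HopfAlgebra k H]
    (D : Data k n H) (hD : D.IsRegular) (q : k) (hq0 : q ≠ 0) (hq : q - q⁻¹ ≠ 0) :
    ∃ (SP : HopfStructure k (Poincare D)) (SC : HopfStructure k (Conformal D q)),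
      IsPoincareHopf D SP ∧
      -- the extended `q`-Poincaré algebra is a sub-Hopf algebra of the `q`-conformal algebra
      Function.Injective (Conformal.ofPoincare D q) ∧
      (∀ x, SC.comul (Conformal.ofPoincare D q x) =
        Algebra.TensorProduct.map (Conformal.ofPoincare D q) (Conformal.ofPoincare D q)
          (SP.comul x)) ∧
      (∀ x, SC.counit (Conformal.ofPoincare D q x) = SP.counit x) ∧
      (∀ x, SC.antipode (Conformal.ofPoincare D q x) =
        Conformal.ofPoincare D q (SP.antipode x)) ∧
      -- `Δc = c ⊗ l⁺ ς⁻¹ + 1 ⊗ c`, `ε(c) = 0`, `Sc = -c ς S l⁺`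
      (∀ i, SC.comul (Conformal.c D q i) =
        ∑ a, Conformal.c D q a ⊗ₜ[k] (Conformal.lp D q a i * Conformal.dilInv D q) +
          1 ⊗ₜ[k] Conformal.c D q i) ∧
      (∀ i, SC.counit (Conformal.c D q i) = 0) ∧
      (∀ i, SC.antipode (Conformal.c D q i) =
        -∑ a, Conformal.c D q a * Conformal.dil D q * SC.antipode (Conformal.lp D q a i)) := by
  have hP := Poincare.isPoincareHopf hD
  obtain ⟨SC, h⟩ := (Conformal.isConformalRep q hD).exists_hopfStructure hD
    (Conformal.adjoin_generators D q) (Conformal.exists_lift hD) (Conformal.exists_lift hD)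
    (fun _ _ h => ⟨Conformal.lift hD h, Conformal.lift_ofPoincare hD h, Conformal.lift_c hD h⟩)
    (Poincare.hopfStructure hD)
    (Poincare.lift ((Poincare.isPoincareRep D).antipode hD)) (fun _ => rfl)
    hP.comul_rot hP.comul_p hP.comul_dil
    (Poincare.lift_dilInv ((Poincare.isPoincareRep D).comul (Poincare.isPoincareRep D) hD))
    hP.counit_rot hP.counit_p hP.counit_dil
    (Poincare.lift_dilInv isPoincareRep_counit)
    (Poincare.lift_rot _) (Poincare.lift_p _) (Poincare.lift_dil _) (Poincare.lift_dilInv _)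
  exact ⟨Poincare.hopfStructure hD, SC, hP, Conformal.ofPoincare_injective D hD q, h⟩
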